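/- **Setting.** Fix $c_{12},c_{21},c_{1e},c_{2e}\ge 0$ and $P_1,P_2\ge 0$. The Gaussian interference channel with an external eavesdropper in standard form has, in each channel use, real inputs $X_1,X_2$ and outputs $$Y_1=X_1+\sqrt{c_{21}}X_2+N_1,\qquad Y_2=\sqrt{c_{12}}X_1+X_2+N_2,\qquad Y_e=\sqrt{c_{1e}}X_1+\sqrt{c_{2e}}X_2+N_e,$$ where $(N_1,N_2,N_e)$ is independent of the inputs and i.i.d. over channel uses, and $N_1,N_2,N_e\sim\mathcal N(0,1)$ (with any dependence among the three). Logarithms are to base 2. A secret code of block length $n$ with $M_1,M_2$ messages consists, for $k=1,2$, of a stochastic encoder, which maps $w_k\in\{1,\dots,M_k\}$ to a random word $\mathbf X_k\in\mathbb R^n$ satisfying $\frac1n\sum_{t=1}^n X_k(t)^2\le P_k$ almost surely (the two encoders randomize independently of each other and of the noise), and of a measurable decoder $\phi_k:\mathbb R^n\to\{1,\dots,M_k\}$. Its error probabilities are $P_{e,k}=\frac1{M_1M_2}\sum_{w_1,w_2}\Pr\{\phi_k(\mathbf Y_k)\ne w_k\mid (w_1,w_2)\text{ sent}\}$. A pair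 $(R_1,R_2)$ with $R_1,R_2\ge0$ is achievable if for every $\epsilon>0$ and all sufficiently large $n$ there is a secret code with $M_k=\lceil 2^{nR_k}\rceil$ such that $\max\{P_{e,1},P_{e,2}\}\le\epsilon$ and $R_1+R_2-\frac1nH(W_1,W_2\mid\mathbf Y_e)\le\epsilon$, where $(W_1,W_2)$ is uniform on the message pairs. The secrecy capacity region $\mathbb C^{\mathrm{GIC\text{-}EE}}$ is the closure of the set of achievable pairs. **Gaussian input laws.** Let $\mathcal P_1$ be the set of joint laws $p$ obtained as follows: $Q$ is a random variable with law $p(q)$ on a finite set $\mathcal Q$; for each $q$ there are powers $P_k^c(q),P_k^s(q),P_k^o(q),P_k^j(q)\ge0$ with $\sum_{q}p(q)\,(P_k^c(q)+P_k^s(q)+P_k^o(q)+P_k^j(q))\le P_k$ for $k=1,2$; given $Q=q$ the variables $C_k\sim\mathcal N(0,P_k^c(q))$, $S_k\sim\mathcal N(0,P_k^s(q))$, $O_k\sim\mathcal N(0,P_k^o(q))$, $X_k^j\sim\mathcal N(0,P_k^j(q))$, $k=1,2$, are independent; $X_k=C_k+S_k+O_k+X_k^j$; and $Y_1,Y_2,Y_e$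 are the outputs of the channel for the inputs $X_1,X_2$. **The region $\mathcal R(p)$.** Put $(T_1,\dots,T_6)=(C_1,S_1,O_1,C_2,S_2,O_2)$ and $T_{\mathcal S}=(T_i)_{i\in\mathcal S}$. For $p\in\mathcal P_1$ let $\mathcal R(p)$ be the closure of the set of all $(R_1,R_2)$ for which there are numbers $R_{T_i}\ge0$, $R^x_{T_i}\ge0$ ($1\le i\le6$) with $R_{O_1}=R_{O_2}=0$, $R_1=R_{C_1}+R_{S_1}$, $R_2=R_{C_2}+R_{S_2}$ and - $\sum_{i\in\mathcal S}(R_{T_i}+R^x_{T_i})\le I(T_{\mathcal S};Y_1\mid T_{\{1,2,4,6\}\setminus\mathcal S},Q)$ for all $\mathcal S\subseteq\{1,2,4,6\}$, - $\sum_{i\in\mathcal S}(R_{T_i}+R^x_{T_i})\le I(T_{\mathcal S};Y_2\mid T_{\{1,3,4,5\}\setminus\mathcal S},Q)$ for all $\mathcal S\subseteq\{1,3,4,5\}$, - $\sum_{i\in\mathcal S}R^x_{T_i}\le I(T_{\mathcal S};Y_e\mid T_{\{1,\dots,6\}\setminus\mathcal S},Q)$ for all $\mathcal S\subsetneq\{1,\dots,6\}$,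 and $\sum_{i=1}^6R^x_{T_i}=I(T_1,\dots,T_6;Y_e\mid Q)$. **Claim.** $\displaystyle \overline{\bigcup_{p\in\mathcal P_1}\mathcal R(p)}\subseteq\mathbb C^{\mathrm{GIC\text{-}EE}}.$ -/

import Mathlib

open MeasureTheory ProbabilityTheory
open scoped NNReal ENNReal

noncomputable section

/-! ### Information measures (in bits) -/

/-- Conditional mutual information `I(A; B | C)` in bits: the Kullback-Leibler divergence of the law
of `(C, A, B)` from the law under which `A` and `B` are conditionally independent given `C` with the
same conditional laws. -/
def condMutualInfo {Ω α β γ : Type*} [MeasurableSpace Ω]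
    [MeasurableSpace α] [StandardBorelSpace α] [Nonempty α]
    [MeasurableSpace β] [StandardBorelSpace β] [Nonempty β] [MeasurableSpace γ]
    (μ : Measure Ω) [IsFiniteMeasure μ] (A : Ω → α) (B : Ω → β) (C : Ω → γ) : ℝ≥0∞ :=
  InformationTheory.klDiv (μ.map fun ω => (C ω, A ω, B ω))
    ((μ.map C).compProd (condDistrib A C μ ×ₖ condDistrib B C μ)) / ENNReal.ofReal (Real.log 2)

/-- The posterior probability `P(W = a | Y = y)`, for `μ` the joint law of `(W, Y)`. -/
def posterior {α β : Type*} [MeasurableSpace α] [MeasurableSpace β]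
    (μ : Measure (α × β)) (a : α) (y : β) : ℝ :=
  (((μ.restrict (Prod.fst ⁻¹' {a})).map Prod.snd).rnDeriv (μ.map Prod.snd) y).toReal

/-- Conditional entropy `H(W | Y)` in bits of a finitely valued `W` given an arbitrary `Y`,
for `μ` the joint law of `(W, Y)`: the mean entropy of the posterior law of `W`. -/
def condEntropy {α β : Type*} [Fintype α] [MeasurableSpace α] [MeasurableSpace β]
    (μ : Measure (α × β)) : ℝ :=
  (∫ y, ∑ a, Real.negMulLog (posterior μ a y) ∂(μ.map Prod.snd)) / Real.log 2

/-! ### The channel -/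

/-- The Gaussian interference channel with an external eavesdropper, in standard form.
Users are indexed by `0, 1 : Fin 2`; outputs `0, 1, 2 : Fin 3` are those of receiver 1, receiver 2
and the eavesdropper. `P k` is the power budget of user `k`. `noise` is the law of `(N₁, N₂, Nₑ)`
in one channel use; each of the three is standard normal, and no assumption is made on their
dependence within one channel use. -/
structure GaussianICEE where
  c₁₂ : ℝ≥0
  c₂₁ : ℝ≥0
  c₁ₑ : ℝ≥0
  c₂ₑ : ℝ≥0
  P : Fin 2 → ℝ≥0
  noise : Measure (Fin 3 → ℝ)
  noise_marginal : ∀ r, noise.map (fun z => z r) = gaussianReal 0 1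

namespace GaussianICEE

instance (G : GaussianICEE) : IsProbabilityMeasure G.noise := by
  have h : IsProbabilityMeasure (G.noise.map fun z => z 0) := by
    rw [G.noise_marginal 0]; infer_instance
  exact Measure.isProbabilityMeasure_of_map (fun z : Fin 3 → ℝ => z 0)

/-- `gain r k` is the amplitude with which the input of user `k` appears in output `r`. -/
def gain (G : GaussianICEE) : Fin 3 → Fin 2 → ℝ :=
  ![![1, √(G.c₂₁ : ℝ)],
    ![√(G.c₁₂ : ℝ), 1],
    ![√(G.c₁ₑ : ℝ), √(G.c₂ₑ : ℝ)]]

/-- The three outputs in one channel use, for inputs `x` and noise values `z`. -/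
def output (G : GaussianICEE) (x : Fin 2 → ℝ) (z : Fin 3 → ℝ) : Fin 3 → ℝ :=
  fun r => G.gain r 0 * x 0 + G.gain r 1 * x 1 + z r

/-! ### Secret codes and the secrecy capacity region -/

/-- A secret code of block length `n` with message sets `Fin (M 0)` and `Fin (M 1)`. Encoders are
stochastic: message `w` of user `k` is sent as a random word with law `enc k w`; every word sent
meets the average power constraint. -/
structure SecretCode (G : GaussianICEE) (n : ℕ) (M : Fin 2 → ℕ) where
  enc : (k : Fin 2) → Fin (M k) → Measure (Fin n → ℝ)
  enc_prob : ∀ k w, IsProbabilityMeasure (enc k w)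
  power : ∀ k w, ∀ᵐ x ∂(enc k w), (1 / (n : ℝ)) * ∑ t, x t ^ 2 ≤ G.P k
  dec : (k : Fin 2) → (Fin n → ℝ) → Fin (M k)
  dec_meas : ∀ k, Measurable (dec k)

namespace SecretCode

variable {G : GaussianICEE} {n : ℕ} {M : Fin 2 → ℕ}

/-- The joint law of the three output words when the message pair `w` is sent. The two encoders
randomize independently, and the noise is independent of them and i.i.d. over channel uses. -/
def outputLaw (c : G.SecretCode n M) (w : (k : Fin 2) → Fin (M k)) :
    Measure (Fin n → Fin 3 → ℝ) :=
  ((c.enc 0 (w 0)).prod ((c.enc 1 (w 1)).prod (Measure.pi fun _ : Fin n => G.noise))).map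
    fun ω t => G.output ![ω.1 t, ω.2.1 t] (ω.2.2 t)

/-- The law of the word seen at output `r` when the message pair `w` is sent. -/
def outputLawAt (c : G.SecretCode n M) (r : Fin 3) (w : (k : Fin 2) → Fin (M k)) :
    Measure (Fin n → ℝ) :=
  (c.outputLaw w).map fun y t => y t r

/-- Average error probability of receiver `k` (which observes output `k`). -/
def errorProb (c : G.SecretCode n M) (k : Fin 2) : ℝ :=
  (1 / ((M 0 : ℝ) * (M 1 : ℝ))) *
    ∑ w : (k : Fin 2) → Fin (M k), (c.outputLawAt k.castSucc w).real {y | c.dec k y ≠ w k}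

/-- The joint law of the (independent, uniform) messages and the eavesdropper's output word. -/
def eveJointLaw (c : G.SecretCode n M) :
    Measure (((k : Fin 2) → Fin (M k)) × (Fin n → ℝ)) :=
  ∑ w : (k : Fin 2) → Fin (M k),
    ((M 0 : ℝ≥0∞) * (M 1 : ℝ≥0∞))⁻¹ • (Measure.dirac w).prod (c.outputLawAt 2 w)

/-- The equivocation rate `(1/n) H(W₁, W₂ | Yₑ)` in bits per channel use. -/
def equivocationRate (c : G.SecretCode n M) : ℝ :=
  (1 / (n : ℝ)) * condEntropy c.eveJointLaw

end SecretCode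

/-- Achievability of a rate pair (bits per channel use), with `⌈2 ^ (n R k)⌉` messages for user `k`. -/
def Achievable (G : GaussianICEE) (R : Fin 2 → ℝ) : Prop :=
  (∀ k, 0 ≤ R k) ∧
  ∀ ε : ℝ, 0 < ε → ∃ n₀ : ℕ, ∀ n ≥ n₀,
    ∃ c : G.SecretCode n (fun k => ⌈(2 : ℝ) ^ ((n : ℝ) * R k)⌉₊),
      (∀ k, c.errorProb k ≤ ε) ∧ R 0 + R 1 - c.equivocationRate ≤ ε

/-- The secrecy capacity region. -/
def secrecyCapacityRegion (G : GaussianICEE) : Set (Fin 2 → ℝ) :=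
  closure {R | G.Achievable R}

/-! ### Gaussian inputs

The auxiliary variables are indexed by `Fin 6`, in the order `C₁, S₁, O₁, C₂, S₂, O₂`. -/

/-- The user to whom an auxiliary variable belongs. -/
def user : Fin 6 → Fin 2 := ![0, 0, 0, 1, 1, 1]

/-- The parameters of a Gaussian input law: a time-sharing law `pQ` on a finite set, and for each
value `q` of the time-sharing variable the powers of the six auxiliary variables and of the two
jamming signals, meeting the power constraints on average over `q`. -/
structure GaussianInput (G : GaussianICEE) where
  m : ℕ
  pQ : Fin m → ℝ≥0
  pQ_sum : ∑ q, pQ q = 1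
  auxPower : Fin m → Fin 6 → ℝ≥0
  jamPower : Fin m → Fin 2 → ℝ≥0
  power : ∀ k, ∑ q, ((∑ i with user i = k, auxPower q i) + jamPower q k) * pQ q ≤ G.P k

namespace GaussianInput

variable {G : GaussianICEE}

/-- The sample space of `(Q, (C₁, S₁, O₁, C₂, S₂, O₂), (X₁ʲ, X₂ʲ), (N₁, N₂, Nₑ))`. -/
abbrev Sample (p : G.GaussianInput) : Type :=
  Fin p.m × (Fin 6 → ℝ) × (Fin 2 → ℝ) × (Fin 3 → ℝ)

/-- The joint law: given `Q = q` the auxiliary variables, the jamming signals and the noise are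
independent, the first two kinds being centred Gaussian with the prescribed variances. -/
def law (p : G.GaussianInput) : Measure p.Sample :=
  ∑ q, (p.pQ q : ℝ≥0∞) • (Measure.dirac q).prod
    ((Measure.pi fun i => gaussianReal 0 (p.auxPower q i)).prod
      ((Measure.pi fun k => gaussianReal 0 (p.jamPower q k)).prod G.noise))

instance (p : G.GaussianInput) : IsProbabilityMeasure p.law := by
  refine ⟨?_⟩
  simp only [law, Measure.coe_finsetSum, Finset.sum_apply, Measure.smul_apply, measure_univ,
    smul_eq_mul, mul_one]
  exact_mod_cast congrArg (fun x : ℝ≥0 => (x : ℝ≥0∞)) p.pQ_sum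

/-- The time-sharing variable. -/
def Q (p : G.GaussianInput) (ω : p.Sample) : Fin p.m := ω.1

/-- The auxiliary variables `T_S`. -/
def T (p : G.GaussianInput) (S : Finset (Fin 6)) (ω : p.Sample) : S → ℝ := fun i => ω.2.1 i

/-- The channel inputs `X_k = C_k + S_k + O_k + X_kʲ`. -/
def X (p : G.GaussianInput) (ω : p.Sample) (k : Fin 2) : ℝ :=
  (∑ i with user i = k, ω.2.1 i) + ω.2.2.1 k

/-- The channel outputs `Y₁, Y₂, Yₑ`. -/
def Y (p : G.GaussianInput) (r : Fin 3) (ω : p.Sample) : ℝ := G.output (p.X ω) ω.2.2.2 r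

/-- `I(T_S; Y_r | T_{D \ S}, Q)` in bits. -/
def info (p : G.GaussianInput) (r : Fin 3) (D S : Finset (Fin 6)) : ℝ≥0∞ :=
  condMutualInfo p.law (p.T S) (p.Y r) (fun ω => (p.T (D \ S) ω, p.Q ω))

/-- The rate region `ℛ(p)`. `R i` is the secret rate and `Rx i` the randomization rate of the
auxiliary variable `i`; the variables `O₁` (index 2) and `O₂` (index 5) carry no secret message.
Receiver 1 decodes `C₁, S₁, C₂, O₂`, receiver 2 decodes `C₁, O₁, C₂, S₂`. -/
def rateRegion (p : G.GaussianInput) : Set (Fin 2 → ℝ) :=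
  closure {r | ∃ R Rx : Fin 6 → ℝ,
    (∀ i, 0 ≤ R i) ∧ (∀ i, 0 ≤ Rx i) ∧ R 2 = 0 ∧ R 5 = 0 ∧
    r 0 = R 0 + R 1 ∧ r 1 = R 3 + R 4 ∧
    (∀ S ⊆ ({0, 1, 3, 5} : Finset (Fin 6)),
      ENNReal.ofReal (∑ i ∈ S, (R i + Rx i)) ≤ p.info 0 {0, 1, 3, 5} S) ∧
    (∀ S ⊆ ({0, 2, 3, 4} : Finset (Fin 6)),
      ENNReal.ofReal (∑ i ∈ S, (R i + Rx i)) ≤ p.info 1 {0, 2, 3, 4} S) ∧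
    (∀ S ⊂ (Finset.univ : Finset (Fin 6)),
      ENNReal.ofReal (∑ i ∈ S, Rx i) ≤ p.info 2 Finset.univ S) ∧
    ENNReal.ofReal (∑ i, Rx i) = p.info 2 Finset.univ Finset.univ}

end GaussianInput

end GaussianICEE

end

open MeasureTheory ProbabilityTheory
open scoped NNReal ENNReal

noncomputable section

set_option linter.unusedSectionVars false
set_option linter.unusedSimpArgs false

/-! ### Product measures -/

/-! The code superposes independent Gaussian codebooks, one for each of the six auxiliary variables.
A codeword is labelled by a part of the message and by a randomization index that the encoder draws
uniformly. Jamming and receiver noise merge into one Gaussian noise, so each output is Gaussian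
given the codewords of any set `A` of variables. A `DensityFamily` records these densities for all
`A`, with the one relation between them: averaging out an input removes it from `A`. All
random-coding averages follow from this relation.

Reliability. Let the decoder draw a label tuple with probability proportional to its likelihood. Its
mean error is controlled, for each proper subset `A` of the decoded set `D`, by the chance that the
likelihood ratio of `D` to `A` is below the number of wrong choices in `D \ A` divided by a small
constant (`lintegral_likelihood_error_le`). The logarithm of that ratio is a mutual information plus
centred chi-square sums with second moment of order `n`, so Chebyshev suffices
(`lowRatioProb_gaussFamily_le`). Maximizing the total likelihood of each message makes the decoder
deterministic (`exists_decoder_le`).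

Secrecy. Subtract the eavesdropper constraint for the complement of `A` from the equality for all
six variables. By the chain rule this leaves: the randomization rates in `A` sum to at least `I(T_A;
Y_e | Q)`, for every `A`. This is the soft covering condition: for a typical codebook the
eavesdropper's output law for a message is close to the codebook average, in that the mean of the
logarithm of one plus their density ratio is at most a small multiple of `n`
(`lintegral_dens_mul_logOneAdd_le`, `expect_logOneAdd_meanRatio_le`). `log_card_le_condEntropy`
converts this into a lower bound for the equivocation.

What remains is slack. All powers are scaled by some `a < 1`, and words are conditioned on the power
constraint, which at most doubles each input law (`exists_secretCode`). Time sharing is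
deterministic: about `n p(q)` letters use the powers of `q`. Message rates are lowered by `η` and
randomization rates by `δ ≤ η`: decoding gains a margin, and the leakage grows by a multiple of `n
δ` only. `info_eq` expresses the mutual informations through variances, and `η → 0` recovers the
region by closedness. -/

lemma lintegral_pi_eq_lintegral_update {δ : Type*} [Fintype δ] [DecidableEq δ] {X : δ → Type*}
    [∀ d, MeasurableSpace (X d)] (μ : ∀ d, Measure (X d)) [∀ d, IsProbabilityMeasure (μ d)]
    (d : δ) {F : (∀ d, X d) → ℝ≥0∞} (hF : Measurable F) :
    ∫⁻ x, F x ∂Measure.pi μ = ∫⁻ x, ∫⁻ s, F (Function.update x d s) ∂μ d ∂Measure.pi μ := by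
  have hG : Measurable fun x => ∫⁻ s, F (Function.update x d s) ∂μ d := by
    rw [← lmarginal_singleton]; exact hF.lmarginal μ
  have hne : Nonempty (∀ d, X d) := ⟨fun d => (nonempty_of_isProbabilityMeasure (μ d)).some⟩
  obtain ⟨x⟩ := hne
  rw [lintegral_eq_lmarginal_univ x, lintegral_eq_lmarginal_univ x,
    lmarginal_erase' _ hF (Finset.mem_univ d), lmarginal_erase' _ hG (Finset.mem_univ d)]
  simp

/-- Coordinates outside the range of `e` contribute total mass one. Applied to labels, this says
that the codewords selected by one label tuple are independent with the prescribed laws. -/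
lemma map_pi_comp {ι δ 𝒯 : Type*} [Fintype ι] [Fintype δ] [MeasurableSpace 𝒯]
    (m : δ → Measure 𝒯) [∀ d, IsProbabilityMeasure (m d)] {e : ι → δ}
    (he : Function.Injective e) :
    (Measure.pi m).map (fun x i => x (e i)) = Measure.pi (fun i => m (e i)) := by
  classical
  symm
  refine Measure.pi_eq fun s hs => ?_
  rw [Measure.map_apply (by fun_prop) (MeasurableSet.univ_pi hs)]
  have : (fun (x : δ → 𝒯) i => x (e i)) ⁻¹' Set.univ.pi s
      = Set.univ.pi (fun d => ⋂ i, ⋂ (_ : e i = d), s i) := by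
    ext x
    simp only [Set.mem_preimage, Set.mem_pi, Set.mem_univ, true_implies, Set.mem_iInter]
    exact ⟨fun h d i hi => hi ▸ h i, fun h i => h (e i) i rfl⟩
  rw [this, Measure.pi_pi]
  rw [← Finset.prod_subset (Finset.subset_univ (Finset.univ.map ⟨e, he⟩)), Finset.prod_map]
  · refine Finset.prod_congr rfl fun i _ => ?_
    congr 1
    ext z
    simp only [Function.Embedding.coeFn_mk, Set.mem_iInter]
    exact ⟨fun h => h i rfl, fun h j hj => he hj ▸ h⟩
  · intro d _ hd
    have : ⋂ i, ⋂ (_ : e i = d), s i = Set.univ := by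
      ext z
      simp only [Set.mem_iInter, Set.mem_univ, iff_true]
      intro i hi
      exact absurd (by simp [← hi]) hd
    rw [this, measure_univ]

/-! ### Consistent families of conditional densities -/

/-- A family of densities on `𝒴`, where `dens A t y` is the conditional density of an output given
the inputs with index in `A`, the other inputs being independent with laws `μ i`. -/
structure DensityFamily {ι 𝒯 𝒴 : Type*} [DecidableEq ι] [MeasurableSpace 𝒯] [MeasurableSpace 𝒴]
    (μ : ι → Measure 𝒯) (ν : Measure 𝒴) where
  dens : Finset ι → (ι → 𝒯) → 𝒴 → ℝ≥0∞
  meas : ∀ A, Measurable fun p : (ι → 𝒯) × 𝒴 => dens A p.1 p.2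
  marg : ∀ A i t y, i ∈ A → ∫⁻ s, dens A (Function.update t i s) y ∂μ i = dens (A.erase i) t y
  congr : ∀ A t t' y, (∀ i ∈ A, t i = t' i) → dens A t y = dens A t' y
  -- Positivity and finiteness make all likelihood ratios and their logarithms well behaved.
  ne_zero : ∀ A t y, dens A t y ≠ 0
  ne_top : ∀ A t y, dens A t y ≠ ∞
  lintegral_eq_one : ∀ A t, ∫⁻ y, dens A t y ∂ν = 1

namespace DensityFamily

variable {ι 𝒯 𝒴 : Type*} [DecidableEq ι] [MeasurableSpace 𝒯] [MeasurableSpace 𝒴]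
  {μ : ι → Measure 𝒯} {ν : Measure 𝒴} (W : DensityFamily μ ν)

lemma meas_comp {α : Type*} [MeasurableSpace α] (A : Finset ι) {f : α → ι → 𝒯} {g : α → 𝒴}
    (hf : Measurable f) (hg : Measurable g) : Measurable fun a => W.dens A (f a) (g a) :=
  (W.meas A).comp (hf.prodMk hg)

/-- A coordinate in `E` that `F` ignores can be resampled, and `marg` then deletes it from the
conditioning set; induction handles all of `E`. The index set `δ` may be larger than `ι`, so that
the integral can run over a whole codebook while `e` picks one tuple of labels. -/
lemma lintegral_mul_dens [∀ i, IsProbabilityMeasure (μ i)] {δ : Type*} [Fintype δ] [DecidableEq δ]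
    (m : δ → Measure 𝒯) [∀ d, IsProbabilityMeasure (m d)] {e : ι → δ}
    (he : Function.Injective e) (hm : ∀ i, m (e i) = μ i) {F : (δ → 𝒯) → ℝ≥0∞}
    (hF : Measurable F) (A E : Finset ι) (hE : ∀ i ∈ E, ∀ x s, F (Function.update x (e i) s) = F x)
    (y : 𝒴) :
    ∫⁻ x, F x * W.dens A (fun i => x (e i)) y ∂Measure.pi m
      = ∫⁻ x, F x * W.dens (A \ E) (fun i => x (e i)) y ∂Measure.pi m := by
  induction E using Finset.induction_on with
  | empty => simp
  | insert j E hj ih =>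
    rw [ih fun i hi => hE i (Finset.mem_insert_of_mem hi)]
    by_cases hjA : j ∈ A
    · have hjAE : j ∈ A \ E := by simp [hjA, hj]
      have hmeas : Measurable fun x : δ → 𝒯 => F x * W.dens (A \ E) (fun i => x (e i)) y :=
        hF.mul (W.meas_comp _ (by fun_prop) measurable_const)
      rw [lintegral_pi_eq_lintegral_update m (e j) hmeas]
      refine lintegral_congr fun x => ?_
      have hup : ∀ s, (fun i => Function.update x (e j) s (e i))
          = Function.update (fun i => x (e i)) j s := by
        intro s; ext1 i
        by_cases h : i = j
        · subst h; simp
        · rw [Function.update_of_ne h, Function.update_of_ne (he.ne h)]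
      simp_rw [hE j (Finset.mem_insert_self j E), hup]
      rw [lintegral_const_mul _ (W.meas_comp _ (measurable_update _) measurable_const), hm,
        W.marg _ _ _ _ hjAE]
      congr! 2
      ext i; simp only [Finset.mem_sdiff, Finset.mem_insert, Finset.mem_erase]; grind
    · congr! 4
      ext i; simp only [Finset.mem_sdiff, Finset.mem_insert]; grind

variable [Fintype ι]

/-- The joint density of inputs with index in `D` and output integrates functions that do not depend
on the inputs outside `A ⊆ D` as the joint density for `A` does. -/
lemma lintegral_mul_dens_subset [∀ i, IsProbabilityMeasure (μ i)] {F : (ι → 𝒯) → ℝ≥0∞}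
    (hF : Measurable F) {A D : Finset ι} (hAD : A ⊆ D)
    (h : ∀ t t', (∀ i ∈ A, t i = t' i) → F t = F t') (y : 𝒴) :
    ∫⁻ t, F t * W.dens D t y ∂Measure.pi μ = ∫⁻ t, F t * W.dens A t y ∂Measure.pi μ := by
  refine (W.lintegral_mul_dens μ Function.injective_id (fun _ => rfl) hF D (D \ A) ?_ y).trans ?_
  rotate_left
  · simp [Finset.inter_eq_right.mpr hAD]
  · intro i hi x s
    refine h _ _ fun j hj => ?_
    have : j ≠ i := by rintro rfl; simp_all
    simp [this]

/-! ### Random codebooks and label tuples -/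

variable {L : ι → Type*} [∀ i, Fintype (L i)] [∀ i, DecidableEq (L i)]

/-- The codewords selected by a tuple of labels. -/
def select (x : ((i : ι) × L i) → 𝒯) (l : ∀ i, L i) : ι → 𝒯 := fun i => x ⟨i, l i⟩

/-- The law of independent codebooks with independent codewords. -/
def codebookLaw (L : ι → Type*) [∀ i, Fintype (L i)] (μ : ι → Measure 𝒯) :
    Measure (((i : ι) × L i) → 𝒯) :=
  Measure.pi fun d => μ d.1

instance [∀ i, IsProbabilityMeasure (μ i)] : IsProbabilityMeasure (codebookLaw L μ) := by
  unfold codebookLaw; infer_instance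

lemma measurable_select (l : ∀ i, L i) :
    Measurable fun x : ((i : ι) × L i) → 𝒯 => select x l :=
  measurable_pi_lambda _ fun _ => measurable_pi_apply _

lemma injective_label (l : ∀ i, L i) :
    Function.Injective fun i => (⟨i, l i⟩ : (i : ι) × L i) := fun _ _ h => congrArg Sigma.fst h

lemma lintegral_select [∀ i, IsProbabilityMeasure (μ i)] (l : ∀ i, L i) {φ : (ι → 𝒯) → ℝ≥0∞}
    (hφ : Measurable φ) :
    ∫⁻ x, φ (select x l) ∂codebookLaw L μ = ∫⁻ t, φ t ∂Measure.pi μ := by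
  have h : (codebookLaw L μ).map (fun x => select x l) = Measure.pi μ :=
    map_pi_comp (fun d : (i : ι) × L i => μ d.1) (injective_label l)
  rw [← h, lintegral_map hφ (measurable_select l)]

/-- The coordinates in `D` where two label tuples agree. -/
def agree (D : Finset ι) (l l' : ∀ i, L i) : Finset ι := D.filter fun i => l i = l' i

/-- Where the labels of `l'` differ from those of `l`, the codewords of `l'` are independent of
those of `l` and average out. Only the shared codewords remain in the conditioning, which is what
makes the error and covering terms single-tuple integrals. -/
lemma lintegral_select_mul_dens [∀ i, IsProbabilityMeasure (μ i)] (D : Finset ι) (l l' : ∀ i, L i)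
    {φ : (ι → 𝒯) → ℝ≥0∞} (hφ : Measurable φ) (y : 𝒴) :
    ∫⁻ x, φ (select x l) * W.dens D (select x l') y ∂codebookLaw L μ
      = ∫⁻ t, φ t * W.dens (agree D l l') t y ∂Measure.pi μ := by
  classical
  have h := W.lintegral_mul_dens (fun d : (i : ι) × L i => μ d.1) (injective_label l')
    (fun _ => rfl) (F := fun x => φ (select x l)) (hφ.comp (measurable_select l)) D
    (Finset.univ.filter fun i => l i ≠ l' i) ?_ y
  · refine h.trans ?_
    have hmeas : Measurable fun t => φ t * W.dens (agree D l l') t y :=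
      hφ.mul (W.meas_comp _ measurable_id measurable_const)
    rw [← lintegral_select l hmeas]
    refine lintegral_congr fun x => ?_
    have hset : D \ (Finset.univ.filter fun i => l i ≠ l' i) = agree D l l' := by
      ext i; simp [agree]
    rw [hset]
    congr 1
    refine W.congr _ _ _ _ fun i hi => ?_
    simp only [agree, Finset.mem_filter] at hi
    simp [select, hi.2]
  · intro i hi x s
    simp only [Finset.mem_filter, Finset.mem_univ, true_and] at hi
    congr 1
    ext1 j
    refine Function.update_of_ne ?_ _ _
    intro hj
    have : j = i := congrArg Sigma.fst hj
    subst this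
    exact hi (by simpa using hj)

/-- Labels outside `D` are free, those in `A` are forced, and those in `D \ A` must differ from the
label in `l`. The `- 1` matters later: a codebook with a single codeword allows no wrong tuple at
all. -/
lemma card_agree_le (Λ : Finset (∀ i, L i)) (D A : Finset ι) (hA : A ⊆ D) (l : ∀ i, L i) :
    (Λ.filter fun l' => agree D l l' = A).card
      ≤ (∏ i ∈ Dᶜ, Fintype.card (L i)) * ∏ i ∈ D \ A, (Fintype.card (L i) - 1) := by
  classical
  let s : ∀ i, Finset (L i) := fun i =>
    if i ∈ A then {l i} else if i ∈ D then Finset.univ.erase (l i) else Finset.univ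
  have hsub : (Λ.filter fun l' => agree D l l' = A) ⊆ Fintype.piFinset s := by
    intro l' hl'
    rw [Finset.mem_filter] at hl'
    rw [Fintype.mem_piFinset]
    intro i
    have hi : i ∈ agree D l l' ↔ i ∈ A := by rw [hl'.2]
    simp only [agree, Finset.mem_filter] at hi
    by_cases h1 : i ∈ A
    · simp [s, h1, (hi.2 h1).2]
    · by_cases h2 : i ∈ D
      · have : ¬ l i = l' i := fun h => h1 (hi.1 ⟨h2, h⟩)
        simp [s, h1, h2, Ne.symm this]
      · simp [s, h1, h2]
  refine (Finset.card_le_card hsub).trans ?_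
  rw [Fintype.card_piFinset, ← Finset.prod_mul_prod_compl D, mul_comm]
  refine Nat.mul_le_mul (Finset.prod_le_prod' fun i hi => ?_) ?_
  · have h2 : i ∉ D := by simpa using hi
    have h1 : i ∉ A := fun h => h2 (hA h)
    simp [s, h1, h2]
  · rw [← Finset.prod_sdiff hA]
    have : ∏ i ∈ A, (s i).card = 1 := Finset.prod_eq_one fun i hi => by simp [s, hi]
    rw [this, mul_one]
    refine Finset.prod_le_prod' fun i hi => ?_
    rw [Finset.mem_sdiff] at hi
    simp [s, hi.1, hi.2, Finset.card_univ]

end DensityFamily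

/-- The function `z ↦ log (1 + z)` on the extended nonnegative reals (`0` at infinity). -/
def logOneAdd (z : ℝ≥0∞) : ℝ≥0∞ := ENNReal.ofReal (Real.log (1 + z.toReal))

lemma measurable_logOneAdd : Measurable logOneAdd := by
  unfold logOneAdd; fun_prop

/-- The tangent of the logarithm at `1 + h`, with the helpful term `-h / (1 + h)` dropped. When `h`
bounds a conditional mean of `f`, it acts as Jensen's inequality with an additive loss of at most
one. -/
lemma logOneAdd_le_add_div {f h : ℝ≥0∞} (hf : f ≠ ∞) (hh : h ≠ ∞) :
    logOneAdd f ≤ logOneAdd h + f / (1 + h) := by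
  lift f to ℝ≥0 using hf
  lift h to ℝ≥0 using hh
  have h1 : (f : ℝ≥0∞) / (1 + h) = ENNReal.ofReal ((f : ℝ) / (1 + h)) := by
    rw [ENNReal.ofReal_div_of_pos (by positivity), ENNReal.ofReal_add (by norm_num) (by positivity)]
    simp
  rw [h1, logOneAdd, logOneAdd, ← ENNReal.ofReal_add (Real.log_nonneg (by simp)) (by positivity)]
  refine ENNReal.ofReal_le_ofReal ?_
  simp only [ENNReal.coe_toReal]
  have hp : (0 : ℝ) < 1 + h := by positivity
  have hq : (0 : ℝ) < 1 + f := by positivity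
  have := Real.log_le_sub_one_of_pos (div_pos hq hp)
  rw [Real.log_div hq.ne' hp.ne'] at this
  have h2 : (1 + (f : ℝ)) / (1 + h) - 1 ≤ f / (1 + h) := by
    rw [div_sub_one hp.ne']
    gcongr
    have : (0 : ℝ) ≤ h := h.2
    linarith
  linarith

/-! ### Likelihood decoding and soft covering with random codebooks -/

namespace DensityFamily

variable {ι 𝒯 𝒴 : Type*} [DecidableEq ι] [MeasurableSpace 𝒯] [MeasurableSpace 𝒴]
  {μ : ι → Measure 𝒯} {ν : Measure 𝒴} (W : DensityFamily μ ν) [Fintype ι]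
  [∀ i, IsProbabilityMeasure (μ i)] [SFinite ν]
  {L : ι → Type*} [∀ i, Fintype (L i)] [∀ i, DecidableEq (L i)]

/-- The pairs of inputs and output for which the likelihood ratio of `D` to `A` is below
`K / ε`. -/
def lowRatio (D A : Finset ι) (K ε : ℝ≥0∞) : Set ((ι → 𝒯) × 𝒴) :=
  {p | ε * W.dens D p.1 p.2 < K * W.dens A p.1 p.2}

lemma measurableSet_lowRatio (D A : Finset ι) (K ε : ℝ≥0∞) :
    MeasurableSet (W.lowRatio D A K ε) :=
  measurableSet_lt ((W.meas D).const_mul _) ((W.meas A).const_mul _)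

/-- The probability that the likelihood ratio of `D` to `A` is below `K / ε`. -/
def lowRatioProb (D A : Finset ι) (K ε : ℝ≥0∞) : ℝ≥0∞ :=
  ∫⁻ y, ∫⁻ t, (W.lowRatio D A K ε).indicator 1 (t, y) * W.dens D t y ∂Measure.pi μ ∂ν

lemma lintegral_lintegral_dens (D : Finset ι) :
    ∫⁻ y, ∫⁻ t, W.dens D t y ∂Measure.pi μ ∂ν = 1 := by
  rw [lintegral_lintegral_swap]
  swap
  · exact ((W.meas D).comp measurable_swap).aemeasurable
  simp [W.lintegral_eq_one]

/-- Tuples that agree with `l` on `D` all have the same density, whatever their labels outside `D`.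
This bounds the normalization of the likelihood decoder from below. -/
lemma card_mul_dens_le_sum (D : Finset ι) (l : ∀ i, L i) (x : ((i : ι) × L i) → 𝒯) (y : 𝒴) :
    ((∏ i ∈ Dᶜ, Fintype.card (L i) : ℕ) : ℝ≥0∞) * W.dens D (select x l) y
      ≤ ∑ l' : ∀ i, L i, W.dens D (select x l') y := by
  let s : ∀ i, Finset (L i) := fun i => if i ∈ D then {l i} else Finset.univ
  have hcard : (Fintype.piFinset s).card = ∏ i ∈ Dᶜ, Fintype.card (L i) := by
    rw [Fintype.card_piFinset, ← Finset.prod_mul_prod_compl D]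
    rw [Finset.prod_eq_one fun i hi => by simp [s, hi], one_mul]
    refine Finset.prod_congr rfl fun i hi => ?_
    have : i ∉ D := by simpa using hi
    simp [s, this]
  calc _ = ∑ l' ∈ Fintype.piFinset s, W.dens D (select x l') y := by
        rw [Finset.sum_congr rfl (g := fun _ => W.dens D (select x l) y), Finset.sum_const, hcard,
          nsmul_eq_mul]
        intro l' hl'
        refine W.congr _ _ _ _ fun i hi => ?_
        have := Fintype.mem_piFinset.1 hl' i
        simp only [s, hi, if_true, Finset.mem_singleton] at this
        simp [select, this]
    _ ≤ _ := Finset.sum_le_sum_of_subset (Finset.subset_univ _)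

/-- Random coding bound for the stochastic likelihood decoder: the sent labels are `l`, the decoder
uses the inputs with index in `D` and errs if it picks a tuple from `Bad`. -/
lemma lintegral_likelihood_error_le (D : Finset ι) (l : ∀ i, L i) (Bad : Finset (∀ i, L i))
    (hBad : ∀ l' ∈ Bad, agree D l l' ≠ D) (ε : ℝ≥0∞) :
    ∫⁻ x, ∫⁻ y, W.dens Finset.univ (select x l) y *
        ((∑ l' ∈ Bad, W.dens D (select x l') y) / ∑ l', W.dens D (select x l') y)
          ∂ν ∂codebookLaw L μ
      ≤ ∑ A ∈ D.powerset.erase D,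
          (W.lowRatioProb D A (∏ i ∈ D \ A, (Fintype.card (L i) - 1) : ℕ) ε + ε) := by
  classical
  have hms : ∀ (A : Finset ι) (l' : ∀ i, L i), Measurable
      fun p : (((i : ι) × L i) → 𝒯) × 𝒴 => W.dens A (select p.1 l') p.2 := fun A l' =>
    W.meas_comp A ((measurable_select l').comp measurable_fst) measurable_snd
  have hms' : ∀ (A : Finset ι) (l' : ∀ i, L i) (y : 𝒴), Measurable
      fun x : (((i : ι) × L i) → 𝒯) => W.dens A (select x l') y := fun A l' y =>
    W.meas_comp A (measurable_select l') measurable_const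
  rw [lintegral_lintegral_swap]
  swap
  · exact ((hms _ l).mul ((Finset.measurable_sum _ fun l' _ => hms D l').div
      (Finset.measurable_sum _ fun l' _ => hms D l'))).aemeasurable
  set c : ℝ≥0∞ := ((∏ i ∈ Dᶜ, Fintype.card (L i) : ℕ) : ℝ≥0∞) with hc
  have hc0 : c ≠ 0 := by
    rw [hc, Nat.cast_ne_zero, Finset.prod_ne_zero_iff]
    exact fun i _ => (Fintype.card_pos_iff.2 ⟨l i⟩).ne'
  have hcT : c ≠ ∞ := ENNReal.natCast_ne_top _
  have hind : ∀ A K y, Measurable fun t : ι → 𝒯 =>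
      (W.lowRatio D A K ε).indicator (1 : (ι → 𝒯) × 𝒴 → ℝ≥0∞) (t, y) := fun A K y =>
    (measurable_one.indicator (W.measurableSet_lowRatio D A K ε)).comp
      (measurable_id.prodMk measurable_const)
  have hind' : ∀ A K y, Measurable fun t : ι → 𝒯 =>
      (W.lowRatio D A K ε)ᶜ.indicator (1 : (ι → 𝒯) × 𝒴 → ℝ≥0∞) (t, y) := fun A K y =>
    (measurable_one.indicator (W.measurableSet_lowRatio D A K ε).compl).comp
      (measurable_id.prodMk measurable_const)
  have hmd : ∀ A y, Measurable fun t : ι → 𝒯 => W.dens A t y := fun A y =>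
    W.meas_comp A measurable_id measurable_const
  have key : ∀ y, ∫⁻ x, W.dens Finset.univ (select x l) y *
        ((∑ l' ∈ Bad, W.dens D (select x l') y) / ∑ l', W.dens D (select x l') y)
          ∂codebookLaw L μ
      ≤ ∑ A ∈ D.powerset.erase D, (∫⁻ t, (W.lowRatio D A
        (∏ i ∈ D \ A, (Fintype.card (L i) - 1) : ℕ) ε).indicator 1 (t, y) * W.dens D t y
          ∂Measure.pi μ + ε * ∫⁻ t, W.dens D t y ∂Measure.pi μ) := by
    intro y
    have hG : Measurable fun x : ((i : ι) × L i) → 𝒯 =>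
        (∑ l' ∈ Bad, W.dens D (select x l') y) / ∑ l', W.dens D (select x l') y :=
      (Finset.measurable_sum _ fun l' _ => hms' D l' y).div
        (Finset.measurable_sum _ fun l' _ => hms' D l' y)
    -- The decoder looks only at codewords of variables in `D`, so the sent codewords outside `D`
    -- average out and the channel density becomes `dens D`.
    have h1 := W.lintegral_mul_dens (fun d : (i : ι) × L i => μ d.1) (injective_label l)
      (fun _ => rfl) hG Finset.univ Dᶜ (by
        intro i hi x s
        have hi' : i ∉ D := by simpa using hi
        have : ∀ l' : ∀ i, L i, W.dens D (select (Function.update x ⟨i, l i⟩ s) l') y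
            = W.dens D (select x l') y := by
          intro l'
          refine W.congr _ _ _ _ fun j hj => ?_
          refine Function.update_of_ne ?_ _ _
          intro h
          have : j = i := congrArg Sigma.fst h
          exact hi' (this ▸ hj)
        simp only [this]) y
    rw [← Finset.compl_eq_univ_sdiff, compl_compl] at h1
    calc _ = ∫⁻ x, (∑ l' ∈ Bad, W.dens D (select x l') y) / (∑ l', W.dens D (select x l') y)
            * W.dens D (select x l) y ∂codebookLaw L μ := by
          simp_rw [mul_comm (W.dens Finset.univ _ y)]; exact h1
      -- Wrong tuples are split by the set `A` on which they agree with the sent one. If the ratio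
      -- of `D` to `A` is low, their share of the likelihood is bounded by one; otherwise the
      -- normalization is bounded below by `c` times the sent likelihood.
      _ ≤ ∫⁻ x, ∑ A ∈ D.powerset.erase D, ((W.lowRatio D A
            (∏ i ∈ D \ A, (Fintype.card (L i) - 1) : ℕ) ε).indicator 1 (select x l, y)
              * W.dens D (select x l) y +
            ∑ l' ∈ Bad with agree D l l' = A, ((W.lowRatio D A
            (∏ i ∈ D \ A, (Fintype.card (L i) - 1) : ℕ) ε)ᶜ.indicator 1 (select x l, y) * c⁻¹)
              * W.dens D (select x l') y) ∂codebookLaw L μ := by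
          refine lintegral_mono fun x => ?_
          have hfib : ∑ l' ∈ Bad, W.dens D (select x l') y = ∑ A ∈ D.powerset.erase D,
              ∑ l' ∈ Bad with agree D l l' = A, W.dens D (select x l') y := by
            rw [Finset.sum_fiberwise_of_maps_to]
            intro l' hl'
            rw [Finset.mem_erase, Finset.mem_powerset]
            exact ⟨hBad l' hl', Finset.filter_subset _ _⟩
          rw [hfib, div_eq_mul_inv, Finset.sum_mul, Finset.sum_mul]
          refine Finset.sum_le_sum fun A _ => ?_
          rw [← Finset.mul_sum]
          set Z := ∑ l' ∈ Bad with agree D l l' = A, W.dens D (select x l') y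
          set T := ∑ l', W.dens D (select x l') y with hT
          have hZT : Z ≤ T := Finset.sum_le_sum_of_subset (Finset.subset_univ _)
          have hcT' : c * W.dens D (select x l) y ≤ T := W.card_mul_dens_le_sum D l x y
          by_cases hmem : (select x l, y) ∈ W.lowRatio D A
            (∏ i ∈ D \ A, (Fintype.card (L i) - 1) : ℕ) ε
          · rw [Set.indicator_of_mem hmem]
            simp only [Pi.one_apply, one_mul]
            refine le_add_right ?_
            refine mul_le_of_le_one_left' ?_
            rw [← div_eq_mul_inv]
            exact ENNReal.div_le_of_le_mul (by simpa using hZT)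
          · rw [Set.indicator_of_notMem hmem, Set.indicator_of_mem (by exact hmem)]
            simp only [Pi.one_apply, one_mul, zero_mul, zero_add]
            rw [mul_assoc, mul_comm Z]
            gcongr
            have hT0 : T ≠ 0 := fun h => by
              have := le_antisymm (h ▸ hcT') bot_le
              simp [hc0, W.ne_zero] at this
            have hTt : T ≠ ∞ := by
              rw [hT]
              exact ENNReal.sum_ne_top.2 fun l' _ => W.ne_top _ _ _
            rw [mul_comm, ← div_eq_mul_inv]
            refine ENNReal.div_le_of_le_mul ?_
            rw [mul_comm, ← div_eq_mul_inv, ENNReal.le_div_iff_mul_le (Or.inl hc0) (Or.inl hcT),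
              mul_comm]
            exact hcT'
      _ ≤ _ := by
          have hmA : ∀ A K, Measurable fun x : ((i : ι) × L i) → 𝒯 =>
              (W.lowRatio D A K ε).indicator (1 : (ι → 𝒯) × 𝒴 → ℝ≥0∞) (select x l, y)
                * W.dens D (select x l) y := fun A K =>
            ((hind A K y).comp (measurable_select l)).mul (hms' D l y)
          have hmA' : ∀ A K l', Measurable fun x : ((i : ι) × L i) → 𝒯 =>
              ((W.lowRatio D A K ε)ᶜ.indicator (1 : (ι → 𝒯) × 𝒴 → ℝ≥0∞) (select x l, y) * c⁻¹)
                * W.dens D (select x l') y := fun A K l' =>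
            (((hind' A K y).comp (measurable_select l)).mul_const _).mul (hms' D l' y)
          rw [lintegral_finsetSum _ fun A _ => (hmA A _).fun_add
            (Finset.measurable_fun_sum _ fun l' _ => hmA' A _ l')]
          refine Finset.sum_le_sum fun A hA => ?_
          rw [Finset.mem_erase, Finset.mem_powerset] at hA
          rw [lintegral_add_left (hmA A _), lintegral_finsetSum _ fun l' _ => hmA' A _ l']
          set K : ℝ≥0∞ := ((∏ i ∈ D \ A, (Fintype.card (L i) - 1) : ℕ) : ℝ≥0∞) with hK
          gcongr
          · have := lintegral_select (μ := μ) l ((hind A K y).mul (hmd D y))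
            exact this.le
          -- Averaging the unsent codewords turns each wrong `dens D` into `dens A` of the sent
          -- tuple. There are at most `c * K` such tuples, and off the low-ratio set `K * dens A ≤ ε
          -- * dens D`.
          · calc
              _ = ∑ l' ∈ Bad with agree D l l' = A, ∫⁻ t,
                  ((W.lowRatio D A K ε)ᶜ.indicator (1 : (ι → 𝒯) × 𝒴 → ℝ≥0∞) (t, y) * c⁻¹) * W.dens A t y
                    ∂Measure.pi μ := by
                refine Finset.sum_congr rfl fun l' hl' => ?_
                have := W.lintegral_select_mul_dens D l l' ((hind' A K y).mul_const c⁻¹) y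
                rw [(Finset.mem_filter.1 hl').2] at this
                exact this
              _ = ((Bad.filter fun l' => agree D l l' = A).card : ℝ≥0∞) * c⁻¹ * ∫⁻ t,
                  (W.lowRatio D A K ε)ᶜ.indicator (1 : (ι → 𝒯) × 𝒴 → ℝ≥0∞) (t, y) * W.dens A t y
                    ∂Measure.pi μ := by
                rw [Finset.sum_const, nsmul_eq_mul, mul_assoc,
                  ← lintegral_const_mul c⁻¹ ((hind' A K y).fun_mul (hmd A y))]
                congr! 3
                ring
              _ ≤ K * ∫⁻ t,
                  (W.lowRatio D A K ε)ᶜ.indicator (1 : (ι → 𝒯) × 𝒴 → ℝ≥0∞) (t, y) * W.dens A t y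
                    ∂Measure.pi μ := by
                gcongr
                rw [← div_eq_mul_inv]
                refine ENNReal.div_le_of_le_mul ?_
                rw [hK, hc, ← Nat.cast_mul, Nat.cast_le, mul_comm]
                exact card_agree_le Bad D A hA.2 l
              _ ≤ _ := by
                rw [← lintegral_const_mul K ((hind' A K y).fun_mul (hmd A y)),
                  ← lintegral_const_mul ε (hmd D y)]
                refine lintegral_mono fun t => ?_
                by_cases hmem : (t, y) ∈ W.lowRatio D A K ε
                · simp [Set.indicator_of_notMem (show (t, y) ∉ (W.lowRatio D A K ε)ᶜ by simpa)]
                · rw [Set.indicator_of_mem (by exact hmem)]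
                  simpa [lowRatio] using hmem
  refine (lintegral_mono key).trans ?_
  have hm1 : ∀ A K, Measurable fun y => ∫⁻ t, (W.lowRatio D A K ε).indicator 1 (t, y)
      * W.dens D t y ∂Measure.pi μ := fun A K =>
    ((measurable_one.indicator (W.measurableSet_lowRatio D A K ε)).mul (W.meas D)).lintegral_prod_left'
  have hm2 : Measurable fun y => ∫⁻ t, W.dens D t y ∂Measure.pi μ := (W.meas D).lintegral_prod_left'
  rw [lintegral_finsetSum _ fun A _ => (hm1 A _).fun_add (hm2.const_mul ε)]
  refine Finset.sum_le_sum fun A _ => ?_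
  rw [lintegral_add_left (hm1 A _), lintegral_const_mul ε hm2, W.lintegral_lintegral_dens, mul_one]
  rfl

/-- The mean of `dens · / q` given the selected codewords, when each input `i` has a codebook of
size `b i`. -/
def meanRatio (b : ι → ℕ) (q : 𝒴 → ℝ≥0∞) (t : ι → 𝒯) (y : 𝒴) : ℝ≥0∞ :=
  ∑ A : Finset ι, ((∏ i ∈ A, b i : ℕ) : ℝ≥0∞)⁻¹ * (W.dens A t y / q y)

/-- Soft covering bound: mean log-likelihood of the output law of a random codebook. -/
lemma lintegral_dens_mul_logOneAdd_le (l : ∀ i, L i) (Λ : Finset (∀ i, L i)) (b : ι → ℕ)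
    (hb : ∀ i, b i ≠ 0)
    (hΛ : ∀ A, (Λ.filter fun l' => agree Finset.univ l l' = A).card ≤ ∏ i ∈ Aᶜ, b i)
    (q : 𝒴 → ℝ≥0∞) (hq : ∀ t y, W.dens ∅ t y = q y) (hqm : Measurable q) :
    ∫⁻ x, ∫⁻ y, W.dens Finset.univ (select x l) y *
        logOneAdd (((∏ i, b i : ℕ) : ℝ≥0∞)⁻¹ *
          (∑ l' ∈ Λ, W.dens Finset.univ (select x l') y) / q y) ∂ν ∂codebookLaw L μ
      ≤ 1 + ∫⁻ y, ∫⁻ t, W.dens Finset.univ t y * logOneAdd (W.meanRatio b q t y)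
          ∂Measure.pi μ ∂ν := by
  classical
  have hne : Nonempty (ι → 𝒯) := ⟨fun i => (nonempty_of_isProbabilityMeasure (μ i)).some⟩
  obtain ⟨t₀⟩ := hne
  have hq0 : ∀ y, q y ≠ 0 := fun y => hq t₀ y ▸ W.ne_zero _ _ _
  have hqT : ∀ y, q y ≠ ∞ := fun y => hq t₀ y ▸ W.ne_top _ _ _
  have hbA : ∀ A : Finset ι, ((∏ i ∈ A, b i : ℕ) : ℝ≥0∞) ≠ 0 := fun A => by
    rw [Nat.cast_ne_zero, Finset.prod_ne_zero_iff]; exact fun i _ => hb i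
  set B : ℝ≥0∞ := ((∏ i, b i : ℕ) : ℝ≥0∞) with hB
  have hms : ∀ (A : Finset ι) (l' : ∀ i, L i), Measurable
      fun p : (((i : ι) × L i) → 𝒯) × 𝒴 => W.dens A (select p.1 l') p.2 := fun A l' =>
    W.meas_comp A ((measurable_select l').comp measurable_fst) measurable_snd
  have hms' : ∀ (A : Finset ι) (l' : ∀ i, L i) (y : 𝒴), Measurable
      fun x : (((i : ι) × L i) → 𝒯) => W.dens A (select x l') y := fun A l' y =>
    W.meas_comp A (measurable_select l') measurable_const
  have hmd : ∀ A y, Measurable fun t : ι → 𝒯 => W.dens A t y := fun A y =>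
    W.meas_comp A measurable_id measurable_const
  have hh : Measurable fun p : (ι → 𝒯) × 𝒴 => W.meanRatio b q p.1 p.2 := by
    unfold meanRatio
    exact Finset.measurable_sum _ fun A _ =>
      (((W.meas A).div (hqm.comp measurable_snd)).const_mul _)
  have hhy : ∀ y, Measurable fun t : ι → 𝒯 => W.meanRatio b q t y := fun y =>
    hh.comp (measurable_id.prodMk measurable_const)
  have hhT : ∀ t y, W.meanRatio b q t y ≠ ∞ := fun t y =>
    ENNReal.sum_ne_top.2 fun A _ => ENNReal.mul_ne_top (ENNReal.inv_ne_top.2 (hbA A))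
      (ENNReal.div_ne_top (W.ne_top _ _ _) (hq0 y))
  rw [lintegral_lintegral_swap]
  swap
  · exact ((hms _ l).mul (measurable_logOneAdd.comp (((Finset.measurable_sum _ fun l' _ =>
      hms Finset.univ l').const_mul _).div (hqm.comp measurable_snd)))).aemeasurable
  have key : ∀ y, ∫⁻ x, W.dens Finset.univ (select x l) y *
        logOneAdd (B⁻¹ * (∑ l' ∈ Λ, W.dens Finset.univ (select x l') y) / q y) ∂codebookLaw L μ
      ≤ ∫⁻ t, W.dens Finset.univ t y ∂Measure.pi μ +
        ∫⁻ t, W.dens Finset.univ t y * logOneAdd (W.meanRatio b q t y) ∂Measure.pi μ := by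
    intro y
    -- The tangent bound is used with `h = meanRatio`, which dominates the mean of the codebook
    -- ratio given the sent codewords and the output. The weight `φ` depends on the sent codewords
    -- only, so the other codewords can be averaged out.
    set φ : (ι → 𝒯) → ℝ≥0∞ := fun t =>
      W.dens Finset.univ t y * (1 + W.meanRatio b q t y)⁻¹ * (B⁻¹ * (q y)⁻¹) with hφd
    have hφ : Measurable φ :=
      (((hmd _ y).mul ((hhy y).const_add 1).inv).mul_const _)
    calc _ ≤ ∫⁻ x, (W.dens Finset.univ (select x l) y * logOneAdd (W.meanRatio b q (select x l) y) +
            ∑ l' ∈ Λ, φ (select x l) * W.dens Finset.univ (select x l') y) ∂codebookLaw L μ := by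
          refine lintegral_mono fun x => ?_
          have hfT : B⁻¹ * (∑ l' ∈ Λ, W.dens Finset.univ (select x l') y) / q y ≠ ∞ :=
            ENNReal.div_ne_top (ENNReal.mul_ne_top (ENNReal.inv_ne_top.2 (hbA _))
              (ENNReal.sum_ne_top.2 fun l' _ => W.ne_top _ _ _)) (hq0 y)
          refine (mul_le_mul_right (logOneAdd_le_add_div hfT (hhT (select x l) y)) _).trans ?_
          rw [mul_add, ← Finset.mul_sum]
          refine add_le_add_right (le_of_eq ?_) _
          simp only [hφd, div_eq_mul_inv]
          ring
      _ = ∫⁻ t, W.dens Finset.univ t y * logOneAdd (W.meanRatio b q t y) ∂Measure.pi μ +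
            ∑ l' ∈ Λ, ∫⁻ t, φ t * W.dens (agree Finset.univ l l') t y ∂Measure.pi μ := by
          have hm1 : Measurable fun t => W.dens Finset.univ t y * logOneAdd (W.meanRatio b q t y) :=
            (hmd _ y).mul (measurable_logOneAdd.comp (hhy y))
          have hm2 : ∀ l', Measurable fun x : ((i : ι) × L i) → 𝒯 =>
              φ (select x l) * W.dens Finset.univ (select x l') y := fun l' =>
            (hφ.comp (measurable_select l)).mul (hms' _ l' y)
          have hm1' : Measurable fun x : ((i : ι) × L i) → 𝒯 => W.dens Finset.univ (select x l) y *
              logOneAdd (W.meanRatio b q (select x l) y) := hm1.comp (measurable_select l)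
          rw [lintegral_add_left hm1',
            lintegral_finsetSum _ fun l' _ => hm2 l', lintegral_select l hm1]
          congr 1
          exact Finset.sum_congr rfl fun l' _ => W.lintegral_select_mul_dens Finset.univ l l' hφ y
      _ ≤ _ := by
          rw [add_comm]
          gcongr
          have hm3 : ∀ l' ∈ Λ, Measurable fun t => φ t * W.dens (agree Finset.univ l l') t y :=
            fun l' _ => hφ.mul (hmd _ y)
          rw [← lintegral_finsetSum _ hm3]
          refine lintegral_mono fun t => ?_
          rw [← Finset.sum_fiberwise Λ (fun l' => agree Finset.univ l l')
            (fun l' => φ t * W.dens (agree Finset.univ l l') t y)]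
          -- Grouping by agreement set rebuilds `meanRatio`; the quotient `h / (1 + h) ≤ 1` is the
          -- source of the additive `1`.
          calc _ ≤ ∑ A : Finset ι, ((∏ i ∈ Aᶜ, b i : ℕ) : ℝ≥0∞) * (φ t * W.dens A t y) := by
                refine Finset.sum_le_sum fun A _ => ?_
                rw [Finset.sum_congr rfl (g := fun _ => φ t * W.dens A t y), Finset.sum_const,
                  nsmul_eq_mul]
                · gcongr; exact hΛ A
                · intro l' hl'; rw [(Finset.mem_filter.1 hl').2]
            _ = W.dens Finset.univ t y * (1 + W.meanRatio b q t y)⁻¹ * W.meanRatio b q t y := by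
                rw [meanRatio, Finset.mul_sum]
                refine Finset.sum_congr rfl fun A _ => ?_
                have hBA : ((∏ i ∈ Aᶜ, b i : ℕ) : ℝ≥0∞) * B⁻¹
                    = ((∏ i ∈ A, b i : ℕ) : ℝ≥0∞)⁻¹ := by
                  rw [hB, ← Finset.prod_mul_prod_compl A, Nat.cast_mul,
                    ENNReal.mul_inv (Or.inl (hbA A)) (Or.inr (hbA Aᶜ)), mul_comm, mul_assoc,
                    ENNReal.inv_mul_cancel (hbA Aᶜ) (ENNReal.natCast_ne_top _), mul_one]
                rw [← hBA]
                simp only [hφd, div_eq_mul_inv, meanRatio]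
                ring
            _ ≤ W.dens Finset.univ t y * 1 := by
                rw [mul_assoc]
                gcongr
                rw [mul_comm, ← div_eq_mul_inv]
                exact ENNReal.div_le_of_le_mul (by rw [one_mul]; exact le_add_self)
            _ = _ := mul_one _
  refine (lintegral_mono key).trans ?_
  rw [lintegral_add_left (W.meas _).lintegral_prod_left', W.lintegral_lintegral_dens]

end DensityFamily

/-! ### Products of densities -/

lemma lmarginal_prod_apply {κ : Type*} [DecidableEq κ] {X : κ → Type*}
    [∀ k, MeasurableSpace (X k)] (μ : ∀ k, Measure (X k)) [∀ k, SigmaFinite (μ k)]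
    {f : ∀ k, X k → ℝ≥0∞} (hf : ∀ k, Measurable (f k)) (s : Finset κ) (x : ∀ k, X k) :
    (∫⋯∫⁻_s, (fun x => ∏ k ∈ s, f k (x k)) ∂μ) x = ∏ k ∈ s, ∫⁻ z, f k z ∂μ k := by
  have hm : ∀ s : Finset κ, Measurable fun x : ∀ k, X k => ∏ k ∈ s, f k (x k) := fun s =>
    Finset.measurable_fun_prod _ fun k _ => (hf k).comp (measurable_pi_apply k)
  induction s using Finset.induction_on generalizing x with
  | empty => simp
  | insert j s hj ih =>
    rw [lmarginal_insert' _ (hm _) hj]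
    have h : (fun x : ∀ k, X k => ∫⁻ z, ∏ k ∈ insert j s, f k (Function.update x j z k) ∂μ j)
        = fun x => (∫⁻ z, f j z ∂μ j) * ∏ k ∈ s, f k (x k) := by
      ext1 x
      rw [mul_comm, ← lintegral_const_mul _ (hf j)]
      refine lintegral_congr fun z => ?_
      rw [Finset.prod_insert hj, Function.update_self, mul_comm]
      congr 1
      refine Finset.prod_congr rfl fun k hk => ?_
      rw [Function.update_of_ne (by rintro rfl; exact hj hk)]
    rw [h, Finset.prod_insert hj, ← ih x]
    exact lintegral_const_mul _ ((hm s).comp measurable_updateFinset)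

lemma lintegral_pi_prod {κ : Type*} [Fintype κ] {X : κ → Type*}
    [∀ k, MeasurableSpace (X k)] (μ : ∀ k, Measure (X k)) [∀ k, SigmaFinite (μ k)]
    {f : ∀ k, X k → ℝ≥0∞} (hf : ∀ k, Measurable (f k)) :
    ∫⁻ x, ∏ k, f k (x k) ∂Measure.pi μ = ∏ k, ∫⁻ z, f k z ∂μ k := by
  classical
  by_cases hne : Nonempty (∀ k, X k)
  · obtain ⟨x⟩ := hne
    rw [lintegral_eq_lmarginal_univ x, lmarginal_prod_apply μ hf]
  · have : IsEmpty (∀ k, X k) := not_nonempty_iff.1 hne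
    obtain ⟨k, hk⟩ := isEmpty_pi.1 this
    rw [lintegral_of_isEmpty]
    symm
    exact Finset.prod_eq_zero (Finset.mem_univ k) (lintegral_of_isEmpty _ _)

lemma pi_withDensity {κ : Type*} [Fintype κ] {X : κ → Type*}
    [∀ k, MeasurableSpace (X k)] (μ : ∀ k, Measure (X k)) [∀ k, SigmaFinite (μ k)]
    {f : ∀ k, X k → ℝ≥0∞} (hf : ∀ k, Measurable (f k))
    [∀ k, SigmaFinite ((μ k).withDensity (f k))] :
    Measure.pi (fun k => (μ k).withDensity (f k))
      = (Measure.pi μ).withDensity fun x => ∏ k, f k (x k) := by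
  classical
  refine Measure.pi_eq fun s hs => ?_
  rw [withDensity_apply _ (MeasurableSet.univ_pi hs),
    ← lintegral_indicator (MeasurableSet.univ_pi hs)]
  have h : (Set.univ.pi s).indicator (fun x : ∀ k, X k => ∏ k, f k (x k))
      = fun x => ∏ k, (s k).indicator (f k) (x k) := by
    ext1 x
    by_cases hx : x ∈ Set.univ.pi s
    · rw [Set.indicator_of_mem hx]
      exact Finset.prod_congr rfl fun k _ =>
        (Set.indicator_of_mem (hx k (Set.mem_univ k)) _).symm
    · rw [Set.indicator_of_notMem hx]
      simp only [Set.mem_pi, Set.mem_univ, true_implies, not_forall] at hx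
      obtain ⟨k, hk⟩ := hx
      exact (Finset.prod_eq_zero (Finset.mem_univ k) (Set.indicator_of_notMem hk _)).symm
  rw [h, lintegral_pi_prod μ fun k => (hf k).indicator (hs k)]
  refine Finset.prod_congr rfl fun k _ => ?_
  rw [lintegral_indicator (hs k), withDensity_apply _ (hs k)]

/-! ### Gaussian densities -/

lemma gaussianPDF_ne_top (m : ℝ) (v : ℝ≥0) (x : ℝ) : gaussianPDF m v x ≠ ∞ :=
  ENNReal.ofReal_ne_top

lemma gaussianPDF_ne_zero (m : ℝ) {v : ℝ≥0} (hv : v ≠ 0) (x : ℝ) : gaussianPDF m v x ≠ 0 :=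
  (gaussianPDF_pos m hv x).ne'

/-- Completing the square in `s`: prior times likelihood equals the marginal density of `y` times
the posterior density of `s`, and the latter integrates to one. -/
lemma gaussianPDFReal_mul_gaussianPDFReal (m g y s : ℝ) {v P : ℝ≥0} (hv : v ≠ 0) (hP : P ≠ 0) :
    gaussianPDFReal 0 P s * gaussianPDFReal (m + g * s) v y
      = gaussianPDFReal m (v + ‖g‖₊ ^ 2 * P) y *
        gaussianPDFReal (g * P * (y - m) / (v + ‖g‖₊ ^ 2 * P : ℝ≥0)) (v * P / (v + ‖g‖₊ ^ 2 * P)) s := by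
  have hv' : (0 : ℝ) < v := by positivity
  have hP' : (0 : ℝ) < P := by positivity
  have hV : (0 : ℝ) < v + g ^ 2 * P := by positivity
  have hVc : ((v + ‖g‖₊ ^ 2 * P : ℝ≥0) : ℝ) = v + g ^ 2 * P := by
    push_cast; rw [Real.norm_eq_abs, sq_abs]
  have hWc : ((v * P / (v + ‖g‖₊ ^ 2 * P) : ℝ≥0) : ℝ) = v * P / (v + g ^ 2 * P) := by
    rw [NNReal.coe_div, hVc, NNReal.coe_mul]
  simp only [gaussianPDFReal, hVc, hWc]
  rw [mul_mul_mul_comm, ← Real.exp_add, mul_mul_mul_comm, ← Real.exp_add, ← mul_inv, ← mul_inv,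
    ← Real.sqrt_mul (by positivity), ← Real.sqrt_mul (by positivity)]
  congr 1
  · congr 2
    field_simp
  · congr 1
    field_simp
    ring

lemma lintegral_gaussianPDF_add_mul (m g y : ℝ) {v : ℝ≥0} (hv : v ≠ 0) (P : ℝ≥0) :
    ∫⁻ s, gaussianPDF (m + g * s) v y ∂gaussianReal 0 P = gaussianPDF m (v + ‖g‖₊ ^ 2 * P) y := by
  -- An input of zero power is a Dirac mass and has no density, so it is treated apart.
  by_cases hP : P = 0
  · subst hP
    simp [gaussianReal_zero_var]
  have hmeas : Measurable fun s => gaussianPDF (m + g * s) v y := by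
    unfold gaussianPDF gaussianPDFReal; fun_prop
  rw [gaussianReal_of_var_ne_zero _ hP, lintegral_withDensity_eq_lintegral_mul _ (by fun_prop) hmeas]
  have h : ∀ s, (gaussianPDF 0 P * fun s => gaussianPDF (m + g * s) v y) s
      = gaussianPDF m (v + ‖g‖₊ ^ 2 * P) y *
        gaussianPDF (g * P * (y - m) / (v + ‖g‖₊ ^ 2 * P : ℝ≥0)) (v * P / (v + ‖g‖₊ ^ 2 * P)) s := by
    intro s
    simp only [gaussianPDF, Pi.mul_apply]
    rw [← ENNReal.ofReal_mul (gaussianPDFReal_nonneg _ _ _),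
      ← ENNReal.ofReal_mul (gaussianPDFReal_nonneg _ _ _),
      gaussianPDFReal_mul_gaussianPDFReal m g y s hv hP]
  simp_rw [h]
  rw [lintegral_const_mul _ (by fun_prop), lintegral_gaussianPDF_eq_one, mul_one]
  positivity

section GaussFamily

variable {ι : Type*} [DecidableEq ι] [Fintype ι]

/-- Variance of the output given the inputs with index in `A`, for gains `g`, input powers `p` and
noise variance `v`. -/
def outVar (g : ι → ℝ) (p : ι → ℝ≥0) (v : ℝ≥0) (A : Finset ι) : ℝ≥0 :=
  v + ∑ i ∈ Aᶜ, ‖g i‖₊ ^ 2 * p i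

/-- Mean of the output given the inputs with index in `A`. -/
def outMean (g : ι → ℝ) (A : Finset ι) (t : ι → ℝ) : ℝ := ∑ i ∈ A, g i * t i

lemma outVar_ne_zero (g : ι → ℝ) (p : ι → ℝ≥0) {v : ℝ≥0} (hv : v ≠ 0) (A : Finset ι) :
    outVar g p v A ≠ 0 := by
  unfold outVar; positivity

lemma measurable_outMean (g : ι → ℝ) (A : Finset ι) : Measurable (outMean g A) := by
  unfold outMean; fun_prop

lemma lintegral_gaussianPDF_update (g : ι → ℝ) (p : ι → ℝ≥0) {v : ℝ≥0} (hv : v ≠ 0) {A : Finset ι}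
    {i : ι} (hi : i ∈ A) (t : ι → ℝ) (y : ℝ) :
    ∫⁻ s, gaussianPDF (outMean g A (Function.update t i s)) (outVar g p v A) y ∂gaussianReal 0 (p i)
      = gaussianPDF (outMean g (A.erase i) t) (outVar g p v (A.erase i)) y := by
  have h : ∀ s, outMean g A (Function.update t i s) = outMean g (A.erase i) t + g i * s := by
    intro s
    unfold outMean
    rw [← Finset.add_sum_erase A _ hi, Function.update_self, add_comm]
    congr 1
    refine Finset.sum_congr rfl fun j hj => ?_
    rw [Function.update_of_ne (Finset.ne_of_mem_erase hj)]
  simp_rw [h]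
  rw [lintegral_gaussianPDF_add_mul _ _ _ (outVar_ne_zero g p hv A)]
  congr 1
  unfold outVar
  rw [Finset.compl_erase, Finset.sum_insert (by simpa using hi)]
  ring

variable {κ : Type*} [Fintype κ]

/-- The densities of a memoryless Gaussian multiple-access output: letter `k` has input powers
`p k` and noise variance `v k`. -/
def gaussFamily (g : ι → ℝ) (p : κ → ι → ℝ≥0) (v : κ → ℝ≥0) (hv : ∀ k, v k ≠ 0) :
    DensityFamily (fun i => Measure.pi fun k => gaussianReal 0 (p k i))
      (volume : Measure (κ → ℝ)) where
  dens A t y := ∏ k, gaussianPDF (outMean g A fun i => t i k) (outVar g (p k) (v k) A) (y k)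
  meas A := by
    refine Finset.measurable_fun_prod _ fun k _ => ?_
    have := measurable_outMean g A
    unfold gaussianPDF gaussianPDFReal
    fun_prop
  marg A i t y hi := by
    have h : ∀ s : κ → ℝ, (∏ k, gaussianPDF (outMean g A fun j => Function.update t i s j k)
        (outVar g (p k) (v k) A) (y k)) = ∏ k, (fun k z => gaussianPDF
          (outMean g A (Function.update (fun j => t j k) i z)) (outVar g (p k) (v k) A) (y k))
            k (s k) := by
      intro s
      refine Finset.prod_congr rfl fun k _ => ?_
      congr 2
      ext j
      by_cases hj : j = i
      · subst hj; simp
      · simp [Function.update_of_ne hj]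
    rw [lintegral_congr h]
    refine (lintegral_pi_prod (X := fun _ : κ => ℝ) (fun k => gaussianReal 0 (p k i))
      (f := fun k z => gaussianPDF (outMean g A (Function.update (fun j => t j k) i z))
        (outVar g (p k) (v k) A) (y k)) ?_).trans ?_
    rotate_left
    · exact Finset.prod_congr rfl fun k _ => lintegral_gaussianPDF_update g (p k) (hv k) hi _ _
    · intro k
      have := measurable_outMean g A
      have h2 : Measurable fun z : ℝ => Function.update (fun j => t j k) i z := measurable_update _
      unfold gaussianPDF gaussianPDFReal
      fun_prop
  congr A t t' y h := by
    refine Finset.prod_congr rfl fun k _ => ?_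
    congr 1
    unfold outMean
    exact Finset.sum_congr rfl fun i hi => by simp only [h i hi]
  ne_zero A t y := Finset.prod_ne_zero_iff.2 fun k _ =>
    gaussianPDF_ne_zero _ (outVar_ne_zero g (p k) (hv k) A) _
  ne_top A t y := ENNReal.prod_ne_top fun k _ => gaussianPDF_ne_top _ _ _
  lintegral_eq_one A t := by
    rw [volume_pi, lintegral_pi_prod _ fun k => by fun_prop]
    exact Finset.prod_eq_one fun k _ =>
      lintegral_gaussianPDF_eq_one _ (outVar_ne_zero g (p k) (hv k) A)

/-- The single-letter version of `gaussFamily`. -/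
def gaussFamilyLetter (g : ι → ℝ) (p : ι → ℝ≥0) (v : ℝ≥0) (hv : v ≠ 0) :
    DensityFamily (fun i => gaussianReal 0 (p i)) (volume : Measure ℝ) where
  dens A t y := gaussianPDF (outMean g A t) (outVar g p v A) y
  meas A := by
    have := measurable_outMean g A
    unfold gaussianPDF gaussianPDFReal
    fun_prop
  marg A i t y hi := lintegral_gaussianPDF_update g p hv hi t y
  congr A t t' y h := by
    congr 1
    unfold outMean
    exact Finset.sum_congr rfl fun i hi => by rw [h i hi]
  ne_zero A t y := gaussianPDF_ne_zero _ (outVar_ne_zero g p hv A) _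
  ne_top A t y := gaussianPDF_ne_top _ _ _
  lintegral_eq_one A t := lintegral_gaussianPDF_eq_one _ (outVar_ne_zero g p hv A)

end GaussFamily

/-! ### Second moments of sums of squares of Gaussians -/

/-- The variance of the square of a standard Gaussian. -/
def gaussSqVar : ℝ := Var[fun x => x ^ 2; gaussianReal 0 1]

lemma gaussSqVar_nonneg : 0 ≤ gaussSqVar := variance_nonneg _ _

lemma memLp_sq_gaussianReal : MemLp (fun x : ℝ => x ^ 2) 2 (gaussianReal 0 1) := by
  have h : MemLp (id : ℝ → ℝ) 4 (gaussianReal 0 1) := memLp_id_gaussianReal 4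
  have h2 := h.norm_rpow_div (2 : ℝ≥0∞)
  have : (4 : ℝ≥0∞) / 2 = 2 := by
    symm
    rw [ENNReal.eq_div_iff (by norm_num) (by norm_num)]
    norm_num
  rw [this] at h2
  refine h2.congr_norm (by fun_prop) ?_
  filter_upwards with x
  simp

lemma integral_sq_gaussianReal : ∫ x : ℝ, x ^ 2 ∂gaussianReal 0 1 = 1 := by
  have h := variance_id_gaussianReal (μ := 0) (v := 1)
  rw [variance_of_integral_eq_zero (by fun_prop) (by simp)] at h
  simpa using h

lemma gaussianReal_eq_map (m : ℝ) (v : ℝ≥0) :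
    gaussianReal m v = (gaussianReal 0 1).map fun x => m + √v * x := by
  have h : (fun x : ℝ => m + √v * x) = (m + ·) ∘ (√v * ·) := rfl
  rw [h, ← Measure.map_map (by fun_prop) (by fun_prop), gaussianReal_map_const_mul,
    gaussianReal_map_const_add]
  congr 1
  · simp
  · ext; simp

/-- After standardizing each coordinate, the sum is a centred combination of squares of independent
standard Gaussians, and variances add. -/
lemma lintegral_sq_sum_sq {κ : Type*} [Fintype κ] (m c : κ → ℝ) (v : κ → ℝ≥0) :
    ∫⁻ y : κ → ℝ, ENNReal.ofReal ((∑ k, c k * ((y k - m k) ^ 2 - v k)) ^ 2)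
        ∂Measure.pi (fun k => gaussianReal (m k) (v k))
      = ENNReal.ofReal ((∑ k, (c k * v k) ^ 2) * gaussSqVar) := by
  have hpi : Measure.pi (fun k => gaussianReal (m k) (v k))
      = (Measure.pi fun _ : κ => gaussianReal 0 1).map fun x k => m k + √(v k) * x k := by
    rw [Measure.pi_map_pi (f := fun k x => m k + √(v k) * x) (by fun_prop)]
    simp_rw [← gaussianReal_eq_map]
  rw [hpi, lintegral_map (by fun_prop) (by fun_prop)]
  have hX : ∀ k, MemLp (fun x : ℝ => (c k * v k) * x ^ 2) 2 (gaussianReal 0 1) := fun k =>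
    memLp_sq_gaussianReal.const_mul _
  have hvar := variance_sum_pi (μ := fun _ : κ => gaussianReal 0 1) hX
  have hX' : MemLp (∑ k, fun x : κ → ℝ => (c k * v k) * x k ^ 2) 2
      (Measure.pi fun _ : κ => gaussianReal 0 1) :=
    memLp_finsetSum' _ fun k _ => (hX k).comp_measurePreserving (measurePreserving_eval _ k)
  have hmean : ∫ x, (∑ k, fun x : κ → ℝ => (c k * v k) * x k ^ 2) x
      ∂(Measure.pi fun _ : κ => gaussianReal 0 1) = ∑ k, c k * v k := by
    simp only [Finset.sum_apply]
    rw [integral_finsetSum]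
    · refine Finset.sum_congr rfl fun k _ => ?_
      rw [integral_const_mul]
      have : ∫ x : κ → ℝ, x k ^ 2 ∂(Measure.pi fun _ : κ => gaussianReal 0 1) = 1 := by
        have hmp := measurePreserving_eval (fun _ : κ => gaussianReal 0 1) k
        have h1 := integral_map (μ := Measure.pi fun _ : κ => gaussianReal 0 1)
          hmp.measurable.aemeasurable
          (f := fun z : ℝ => z ^ 2) (by fun_prop)
        rw [hmp.map_eq, integral_sq_gaussianReal] at h1
        exact h1.symm
      rw [this, mul_one]
    · intro k _
      exact ((hX k).comp_measurePreserving (measurePreserving_eval _ k)).integrable one_le_two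
  have hev := hX'.ofReal_variance_eq
  rw [hvar] at hev
  simp only [variance_const_mul] at hev
  rw [← Finset.sum_mul] at hev
  change ENNReal.ofReal ((∑ k, (c k * v k) ^ 2) * gaussSqVar) = _ at hev
  rw [hev, evariance, hmean]
  refine lintegral_congr fun x => ?_
  rw [← ofReal_norm, ← ENNReal.ofReal_pow (norm_nonneg _), Real.norm_eq_abs, sq_abs]
  congr 2
  rw [Finset.sum_apply, ← Finset.sum_sub_distrib]
  refine Finset.sum_congr rfl fun k _ => ?_
  have : √(v k : ℝ) ^ 2 = v k := Real.sq_sqrt (v k).2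
  have h2 : (m k + √(v k : ℝ) * x k - m k) ^ 2 = v k * x k ^ 2 := by
    rw [add_sub_cancel_left, mul_pow, this]
  rw [h2]; ring

/-! ### Expectations under the joint law of inputs and output -/

namespace DensityFamily

variable {ι 𝒯 𝒴 : Type*} [DecidableEq ι] [MeasurableSpace 𝒯] [MeasurableSpace 𝒴]
  {μ : ι → Measure 𝒯} {ν : Measure 𝒴} (W : DensityFamily μ ν) [Fintype ι]
  [∀ i, IsProbabilityMeasure (μ i)] [SFinite ν]

/-- Expectation of a function of inputs and output, under the joint law given by the density of the
output given the inputs with index in `D`. -/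
def expect (D : Finset ι) (F : (ι → 𝒯) → 𝒴 → ℝ≥0∞) : ℝ≥0∞ :=
  ∫⁻ y, ∫⁻ t, F t y * W.dens D t y ∂Measure.pi μ ∂ν

lemma expect_mono (D : Finset ι) {F F' : (ι → 𝒯) → 𝒴 → ℝ≥0∞} (h : ∀ t y, F t y ≤ F' t y) :
    W.expect D F ≤ W.expect D F' :=
  lintegral_mono fun y => lintegral_mono fun t => mul_le_mul_left (h t y) _

lemma expect_const (D : Finset ι) (c : ℝ≥0∞) : W.expect D (fun _ _ => c) = c := by
  have hm : ∀ y, Measurable fun t => W.dens D t y := fun y =>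
    W.meas_comp D measurable_id measurable_const
  unfold expect
  simp_rw [fun y => lintegral_const_mul (μ := Measure.pi μ) c (hm y)]
  rw [lintegral_const_mul c (W.meas D).lintegral_prod_left', W.lintegral_lintegral_dens, mul_one]

lemma expect_const_mul (D : Finset ι) (c : ℝ≥0∞) {F : (ι → 𝒯) → 𝒴 → ℝ≥0∞}
    (hF : Measurable fun q : (ι → 𝒯) × 𝒴 => F q.1 q.2) :
    W.expect D (fun t y => c * F t y) = c * W.expect D F := by
  have hm : Measurable fun q : (ι → 𝒯) × 𝒴 => F q.1 q.2 * W.dens D q.1 q.2 := hF.mul (W.meas D)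
  have hmy : ∀ y, Measurable fun t => F t y * W.dens D t y := fun y =>
    hm.comp (measurable_id.prodMk measurable_const)
  unfold expect
  simp_rw [mul_assoc, fun y => lintegral_const_mul (μ := Measure.pi μ) c (hmy y)]
  rw [lintegral_const_mul c hm.lintegral_prod_left']

lemma expect_add (D : Finset ι) {F F' : (ι → 𝒯) → 𝒴 → ℝ≥0∞}
    (hF : Measurable fun q : (ι → 𝒯) × 𝒴 => F q.1 q.2) :
    W.expect D (fun t y => F t y + F' t y) = W.expect D F + W.expect D F' := by
  have hm : Measurable fun q : (ι → 𝒯) × 𝒴 => F q.1 q.2 * W.dens D q.1 q.2 := hF.mul (W.meas D)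
  have hmy : ∀ y, Measurable fun t => F t y * W.dens D t y := fun y =>
    hm.comp (measurable_id.prodMk measurable_const)
  unfold expect
  simp_rw [add_mul, fun y => lintegral_add_left (μ := Measure.pi μ) (hmy y)]
  rw [lintegral_add_left hm.lintegral_prod_left']

lemma expect_finsetSum {β : Type*} (s : Finset β) (D : Finset ι) {F : β → (ι → 𝒯) → 𝒴 → ℝ≥0∞}
    (hF : ∀ b, Measurable fun q : (ι → 𝒯) × 𝒴 => F b q.1 q.2) :
    W.expect D (fun t y => ∑ b ∈ s, F b t y) = ∑ b ∈ s, W.expect D (F b) := by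
  classical
  induction s using Finset.induction_on with
  | empty => simpa using W.expect_const D 0
  | insert b s hb ih =>
    rw [Finset.sum_insert hb, ← ih, ← W.expect_add D (hF b)]
    simp_rw [Finset.sum_insert hb]

lemma expect_eq_lintegral_input {D : Finset ι} {F : (ι → 𝒯) → 𝒴 → ℝ≥0∞}
    (hF : Measurable fun q : (ι → 𝒯) × 𝒴 => F q.1 q.2) :
    W.expect D F = ∫⁻ t, ∫⁻ y, F t y * W.dens D t y ∂ν ∂Measure.pi μ := by
  have hm : Measurable fun q : (ι → 𝒯) × 𝒴 => F q.1 q.2 * W.dens D q.1 q.2 := hF.mul (W.meas D)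
  exact (lintegral_lintegral_swap hm.aemeasurable).symm

lemma expect_subset {A D : Finset ι} (hAD : A ⊆ D) {F : (ι → 𝒯) → 𝒴 → ℝ≥0∞}
    (hF : Measurable fun q : (ι → 𝒯) × 𝒴 => F q.1 q.2)
    (h : ∀ t t' y, (∀ i ∈ A, t i = t' i) → F t y = F t' y) :
    W.expect D F = W.expect A F := by
  unfold expect
  refine lintegral_congr fun y => ?_
  exact W.lintegral_mul_dens_subset (hF.comp (measurable_id.prodMk measurable_const)) hAD
    (fun t t' => h t t' y) y

end DensityFamily

/-! ### Information density of the Gaussian channel and its concentration -/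

section GaussFamily

variable {ι : Type*} [DecidableEq ι] [Fintype ι] {κ : Type*} [Fintype κ]
  (g : ι → ℝ) (p : κ → ι → ℝ≥0) (v : κ → ℝ≥0)

/-- The centred sum of normalized squares of the output noise given the inputs in `A`. -/
def chiSum (A : Finset ι) (t : ι → κ → ℝ) (y : κ → ℝ) : ℝ :=
  ∑ k, (outVar g (p k) (v k) A : ℝ)⁻¹ *
    ((y k - outMean g A fun i => t i k) ^ 2 - outVar g (p k) (v k) A)

/-- The information (in nats) that the inputs in `D` give about the output beyond those in `A`. -/
def infoSum (A D : Finset ι) : ℝ :=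
  ∑ k, 1 / 2 * Real.log (outVar g (p k) (v k) A / outVar g (p k) (v k) D)

lemma measurable_chiSum (A : Finset ι) :
    Measurable fun q : (ι → κ → ℝ) × (κ → ℝ) => chiSum g p v A q.1 q.2 := by
  have := measurable_outMean g A
  unfold chiSum
  fun_prop

variable {v} (hv : ∀ k, v k ≠ 0)

lemma log_gaussianPDFReal (m : ℝ) {w : ℝ≥0} (hw : w ≠ 0) (x : ℝ) :
    Real.log (gaussianPDFReal m w x)
      = -(1 / 2 * Real.log (2 * Real.pi)) - 1 / 2 * Real.log w - 1 / 2
        - 1 / 2 * ((w : ℝ)⁻¹ * ((x - m) ^ 2 - w)) := by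
  have hw' : (0 : ℝ) < w := by positivity
  rw [gaussianPDFReal, Real.log_mul (by positivity) (by positivity), Real.log_inv, Real.log_exp,
    Real.log_sqrt (by positivity), Real.log_mul (by positivity) (by positivity)]
  field_simp
  ring

lemma log_dens (A : Finset ι) (t : ι → κ → ℝ) (y : κ → ℝ) :
    Real.log ((gaussFamily g p v hv).dens A t y).toReal
      = Fintype.card κ * (-(1 / 2 * Real.log (2 * Real.pi)) - 1 / 2)
        - ∑ k, 1 / 2 * Real.log (outVar g (p k) (v k) A) - 1 / 2 * chiSum g p v A t y := by
  have hpos : ∀ k, 0 < gaussianPDFReal (outMean g A fun i => t i k) (outVar g (p k) (v k) A) (y k) :=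
    fun k => gaussianPDFReal_pos _ _ _ (outVar_ne_zero g (p k) (hv k) A)
  have h : ((gaussFamily g p v hv).dens A t y).toReal
      = ∏ k, gaussianPDFReal (outMean g A fun i => t i k) (outVar g (p k) (v k) A) (y k) := by
    simp only [gaussFamily, ENNReal.toReal_prod, gaussianPDF]
    exact Finset.prod_congr rfl fun k _ => ENNReal.toReal_ofReal (hpos k).le
  rw [h, Real.log_prod fun k _ => (hpos k).ne']
  simp_rw [log_gaussianPDFReal _ (outVar_ne_zero g (p _) (hv _) A)]
  rw [chiSum, Finset.mul_sum]
  simp only [Finset.sum_sub_distrib, Finset.sum_const, Finset.card_univ, nsmul_eq_mul]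
  ring

/-- The information density splits into a deterministic information and half the difference of two
centred chi-square sums, so second moments of `chiSum` control all fluctuations. -/
lemma log_dens_sub (A D : Finset ι) (t : ι → κ → ℝ) (y : κ → ℝ) :
    Real.log ((gaussFamily g p v hv).dens D t y).toReal
      - Real.log ((gaussFamily g p v hv).dens A t y).toReal
      = infoSum g p v A D + (1 / 2 * chiSum g p v A t y - 1 / 2 * chiSum g p v D t y) := by
  rw [log_dens, log_dens, infoSum]
  have : ∀ k, 1 / 2 * Real.log (outVar g (p k) (v k) A / outVar g (p k) (v k) D)
      = 1 / 2 * Real.log (outVar g (p k) (v k) A) - 1 / 2 * Real.log (outVar g (p k) (v k) D) := by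
    intro k
    have h1 := outVar_ne_zero g (p k) (hv k) A
    have h2 := outVar_ne_zero g (p k) (hv k) D
    rw [Real.log_div (by exact_mod_cast h1) (by exact_mod_cast h2)]
    ring
  simp_rw [this, Finset.sum_sub_distrib]
  ring

lemma withDensity_dens (A : Finset ι) (t : ι → κ → ℝ) :
    (volume : Measure (κ → ℝ)).withDensity ((gaussFamily g p v hv).dens A t)
      = Measure.pi fun k => gaussianReal (outMean g A fun i => t i k) (outVar g (p k) (v k) A) := by
  have h : ∀ k, gaussianReal (outMean g A fun i => t i k) (outVar g (p k) (v k) A)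
      = (volume : Measure ℝ).withDensity
        (gaussianPDF (outMean g A fun i => t i k) (outVar g (p k) (v k) A)) := fun k =>
    gaussianReal_of_var_ne_zero _ (outVar_ne_zero g (p k) (hv k) A)
  have : ∀ k, IsProbabilityMeasure ((volume : Measure ℝ).withDensity
        (gaussianPDF (outMean g A fun i => t i k) (outVar g (p k) (v k) A))) := fun k => by
    rw [← h k]; infer_instance
  simp_rw [h]
  rw [pi_withDensity _ fun k => by fun_prop]
  rfl

attribute [local irreducible] gaussFamily

lemma lintegral_dens_mul (A : Finset ι) (t : ι → κ → ℝ) {F : (κ → ℝ) → ℝ≥0∞} (hF : Measurable F) :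
    ∫⁻ y, F y * (gaussFamily g p v hv).dens A t y
      = ∫⁻ y, F y ∂Measure.pi fun k =>
          gaussianReal (outMean g A fun i => t i k) (outVar g (p k) (v k) A) := by
  have hmd : Measurable ((gaussFamily g p v hv).dens A t) :=
    (gaussFamily g p v hv).meas_comp A measurable_const measurable_id
  rw [← withDensity_dens g p hv, lintegral_withDensity_eq_lintegral_mul volume hmd hF]
  exact lintegral_congr fun y => mul_comm _ _

lemma lintegral_chiSum_sq (hv : ∀ k, v k ≠ 0) (A : Finset ι) (t : ι → κ → ℝ) :
    ∫⁻ y, ENNReal.ofReal (chiSum g p v A t y ^ 2) ∂(Measure.pi fun k =>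
        gaussianReal (outMean g A fun i => t i k) (outVar g (p k) (v k) A))
      = ENNReal.ofReal (Fintype.card κ * gaussSqVar) := by
  unfold chiSum
  rw [lintegral_sq_sum_sq]
  congr 2
  have : ∀ k, ((outVar g (p k) (v k) A : ℝ)⁻¹ * (outVar g (p k) (v k) A : ℝ)) ^ 2 = 1 := by
    intro k
    have h2 := outVar_ne_zero g (p k) (hv k) A
    rw [inv_mul_cancel₀ (by exact_mod_cast h2), one_pow]
  simp [this, Finset.card_univ]

lemma chiSum_congr {A : Finset ι} {t t' : ι → κ → ℝ} (h : ∀ i ∈ A, t i = t' i) (y : κ → ℝ) :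
    chiSum g p v A t y = chiSum g p v A t' y := by
  unfold chiSum outMean
  refine Finset.sum_congr rfl fun k _ => ?_
  have h' : ∑ i ∈ A, g i * t i k = ∑ i ∈ A, g i * t' i k :=
    Finset.sum_congr rfl fun i hi => by rw [h i hi]
  simp only [h']

/-- `chiSum` for `A` does not involve the other inputs, which average out. Given the inputs in `A`
the output is a product of Gaussians, and the value no longer depends on these inputs. -/
lemma expect_chiSum_sq {A D : Finset ι} (hAD : A ⊆ D) :
    (gaussFamily g p v hv).expect D (fun t y => ENNReal.ofReal (chiSum g p v A t y ^ 2))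
      = ENNReal.ofReal (Fintype.card κ * gaussSqVar) := by
  have hm2 : Measurable fun q : (ι → κ → ℝ) × (κ → ℝ) =>
      ENNReal.ofReal (chiSum g p v A q.1 q.2 ^ 2) :=
    ((measurable_chiSum g p v A).pow_const 2).ennreal_ofReal
  rw [DensityFamily.expect_subset (gaussFamily g p v hv) hAD
    (F := fun t y => ENNReal.ofReal (chiSum g p v A t y ^ 2)) hm2
    (fun t t' y h => by rw [chiSum_congr g p h]),
    DensityFamily.expect_eq_lintegral_input (gaussFamily g p v hv)
    (F := fun t y => ENNReal.ofReal (chiSum g p v A t y ^ 2)) hm2]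
  have h2 : ∀ t, ∫⁻ y, ENNReal.ofReal (chiSum g p v A t y ^ 2) *
      (gaussFamily g p v hv).dens A t y = ENNReal.ofReal (Fintype.card κ * gaussSqVar) := by
    intro t
    rw [lintegral_dens_mul g p hv A t
      (F := fun y => ENNReal.ofReal (chiSum g p v A t y ^ 2)) (by unfold chiSum; fun_prop),
      lintegral_chiSum_sq g p hv]
  rw [lintegral_congr h2, lintegral_const, measure_univ, mul_one]

lemma expect_const_mul_chiSum_sq_add {A B D : Finset ι} (hA : A ⊆ D) (hB : B ⊆ D) {c : ℝ}
    (hc : 0 ≤ c) :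
    (gaussFamily g p v hv).expect D
        (fun t y => ENNReal.ofReal (c * (chiSum g p v A t y ^ 2 + chiSum g p v B t y ^ 2)))
      = ENNReal.ofReal (2 * c * (Fintype.card κ * gaussSqVar)) := by
  have hm : ∀ A : Finset ι, Measurable fun q : (ι → κ → ℝ) × (κ → ℝ) =>
      ENNReal.ofReal (chiSum g p v A q.1 q.2 ^ 2) :=
    fun A => ((measurable_chiSum g p v A).pow_const 2).ennreal_ofReal
  simp_rw [ENNReal.ofReal_mul hc, ENNReal.ofReal_add (sq_nonneg _) (sq_nonneg _)]
  rw [DensityFamily.expect_const_mul _ _ _ ((hm A).fun_add (hm B)),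
    DensityFamily.expect_add _ _ (hm A), expect_chiSum_sq g p hv hA, expect_chiSum_sq g p hv hB,
    ← ENNReal.ofReal_add (by have := gaussSqVar_nonneg; positivity)
      (by have := gaussSqVar_nonneg; positivity), ← ENNReal.ofReal_mul hc]
  congr 1
  ring

/-- Chebyshev: a low ratio forces the fluctuation of the information density to be at least `s` in
size. The square of half a difference is at most half the sum of the squares, so the dependence
between the two chi-square sums is harmless. For `K = 0` the event is empty and no rate condition is
needed. -/
lemma lowRatioProb_gaussFamily_le {A D : Finset ι} (hAD : A ⊆ D) (K : ℕ) {ε s : ℝ} (hε : 0 < ε)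
    (hs : 0 < s) (h : K = 0 ∨ Real.log K - Real.log ε + s ≤ infoSum g p v A D) :
    (gaussFamily g p v hv).lowRatioProb D A K (ENNReal.ofReal ε)
      ≤ ENNReal.ofReal (Fintype.card κ * gaussSqVar / s ^ 2) := by
  set W := gaussFamily g p v hv
  have hpt : ∀ t y, (W.lowRatio D A K (ENNReal.ofReal ε)).indicator (1 : _ × _ → ℝ≥0∞) (t, y)
      ≤ ENNReal.ofReal
        (1 / (2 * s ^ 2) * (chiSum g p v A t y ^ 2 + chiSum g p v D t y ^ 2)) := by
    intro t y
    by_cases hmem : (t, y) ∈ W.lowRatio D A K (ENNReal.ofReal ε)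
    · rw [Set.indicator_of_mem hmem, Pi.one_apply, ← ENNReal.ofReal_one]
      refine ENNReal.ofReal_le_ofReal ?_
      simp only [DensityFamily.lowRatio, Set.mem_ofPred_eq] at hmem
      rcases h with rfl | h
      · simp at hmem
      have hK : K ≠ 0 := by rintro rfl; simp at hmem
      have hD : 0 < (W.dens D t y).toReal := ENNReal.toReal_pos (W.ne_zero _ _ _) (W.ne_top _ _ _)
      have hA : 0 < (W.dens A t y).toReal := ENNReal.toReal_pos (W.ne_zero _ _ _) (W.ne_top _ _ _)
      have h1 := ENNReal.toReal_strict_mono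
        (ENNReal.mul_ne_top (ENNReal.natCast_ne_top _) (W.ne_top _ _ _)) hmem
      rw [ENNReal.toReal_mul, ENNReal.toReal_mul, ENNReal.toReal_ofReal hε.le,
        ENNReal.toReal_natCast] at h1
      have hKpos : (0 : ℝ) < K := by positivity
      have h2 := Real.log_lt_log (by positivity) h1
      rw [Real.log_mul hε.ne' hD.ne', Real.log_mul hKpos.ne' hA.ne'] at h2
      have h3 := log_dens_sub g p hv A D t y
      have h4 : s ≤ 1 / 2 * chiSum g p v D t y - 1 / 2 * chiSum g p v A t y := by linarith
      have h5 : s ^ 2 ≤ (1 / 2 * chiSum g p v D t y - 1 / 2 * chiSum g p v A t y) ^ 2 :=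
        pow_le_pow_left₀ hs.le h4 2
      rw [div_mul_eq_mul_div, one_mul, le_div_iff₀ (by positivity), one_mul]
      nlinarith [sq_nonneg (chiSum g p v D t y + chiSum g p v A t y)]
    · rw [Set.indicator_of_notMem hmem]
      exact bot_le
  refine (W.expect_mono D hpt).trans ?_
  rw [expect_const_mul_chiSum_sq_add g p hv hAD subset_rfl (by positivity)]
  refine ENNReal.ofReal_le_ofReal (le_of_eq ?_)
  field_simp

/-- Each term of `meanRatio` is an exponential, and the logarithm of one plus a sum of exponentials
is at most the logarithm of the number of terms plus the positive parts of the exponents. Each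
positive part is at most the excess of the information over the logarithm of the index count, plus
the absolute fluctuation. -/
lemma expect_logOneAdd_meanRatio_le (b : ι → ℕ) (hb : ∀ i, b i ≠ 0) (q : (κ → ℝ) → ℝ≥0∞)
    (hq : ∀ t y, (gaussFamily g p v hv).dens ∅ t y = q y) {s : ℝ} (hs : 0 < s) :
    (gaussFamily g p v hv).expect Finset.univ
        (fun t y => logOneAdd ((gaussFamily g p v hv).meanRatio b q t y))
      ≤ ENNReal.ofReal (Real.log (1 + Fintype.card (Finset ι)) + ∑ A : Finset ι,
          (max (infoSum g p v ∅ A - Real.log (∏ i ∈ A, b i : ℕ)) 0 + s +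
            Fintype.card κ * gaussSqVar / s)) := by
  set W := gaussFamily g p v hv with hW
  have hbA : ∀ A : Finset ι, (0 : ℝ) < ((∏ i ∈ A, b i : ℕ) : ℝ) := fun A => by
    rw [Nat.cast_pos]; exact Finset.prod_pos fun i _ => Nat.pos_of_ne_zero (hb i)
  set d : Finset ι → ℝ := fun A => max (infoSum g p v ∅ A - Real.log (∏ i ∈ A, b i : ℕ)) 0 + s
    with hd
  have hd0 : ∀ A, 0 ≤ d A := fun A => add_nonneg (le_max_right _ _) hs.le
  set c₀ : ℝ := Real.log (1 + Fintype.card (Finset ι)) + ∑ A, d A with hc₀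
  have hl0 : 0 ≤ Real.log (1 + Fintype.card (Finset ι)) := Real.log_nonneg (by simp)
  have hc₀0 : 0 ≤ c₀ := add_nonneg hl0 (Finset.sum_nonneg fun A _ => hd0 A)
  have hpt : ∀ t y, logOneAdd (W.meanRatio b q t y)
      ≤ ENNReal.ofReal c₀ + ∑ A : Finset ι, ENNReal.ofReal
        (1 / (2 * s) * (chiSum g p v ∅ t y ^ 2 + chiSum g p v A t y ^ 2)) := by
    intro t y
    rw [← ENNReal.ofReal_sum_of_nonneg fun A _ => by positivity, ← ENNReal.ofReal_add hc₀0
      (Finset.sum_nonneg fun A _ => by positivity)]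
    refine ENNReal.ofReal_le_ofReal ?_
    have hdp : ∀ A, 0 < (W.dens A t y).toReal := fun A =>
      ENNReal.toReal_pos (W.ne_zero _ _ _) (W.ne_top _ _ _)
    set a : Finset ι → ℝ := fun A => Real.log (W.dens A t y).toReal -
      Real.log (W.dens ∅ t y).toReal - Real.log (∏ i ∈ A, b i : ℕ) with ha
    have hmr : (W.meanRatio b q t y).toReal = ∑ A, Real.exp (a A) := by
      rw [DensityFamily.meanRatio, ENNReal.toReal_sum]
      · refine Finset.sum_congr rfl fun A _ => ?_
        rw [ENNReal.toReal_mul, ENNReal.toReal_inv, ENNReal.toReal_natCast, ENNReal.toReal_div,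
          ← hq t y, ha]
        simp only
        rw [Real.exp_sub, Real.exp_sub, Real.exp_log (hdp A), Real.exp_log (hdp ∅),
          Real.exp_log (hbA A)]
        field_simp
      · intro A _
        rw [← hq t y]
        refine ENNReal.mul_ne_top (ENNReal.inv_ne_top.2 ?_)
          (ENNReal.div_ne_top (W.ne_top _ _ _) (W.ne_zero _ _ _))
        have := hbA A
        exact_mod_cast this.ne'
    have hle : ∀ A, Real.exp (a A) ≤ Real.exp (∑ B, max (a B) 0) := fun A =>
      Real.exp_le_exp.2 ((le_max_left _ _).trans
        (Finset.single_le_sum (f := fun B => max (a B) 0) (fun B _ => le_max_right _ _)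
          (Finset.mem_univ A)))
    have h1 : 1 + (W.meanRatio b q t y).toReal
        ≤ (1 + Fintype.card (Finset ι)) * Real.exp (∑ B, max (a B) 0) := by
      rw [hmr, add_mul, one_mul]
      refine add_le_add (Real.one_le_exp (Finset.sum_nonneg fun B _ => le_max_right _ _)) ?_
      refine (Finset.sum_le_sum fun A _ => hle A).trans ?_
      simp [Finset.card_univ]
    have h2 : Real.log (1 + (W.meanRatio b q t y).toReal)
        ≤ Real.log (1 + Fintype.card (Finset ι)) + ∑ B, max (a B) 0 := by
      refine (Real.log_le_log (by positivity) h1).trans ?_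
      rw [Real.log_mul (by positivity) (by positivity), Real.log_exp]
    refine h2.trans ?_
    rw [hc₀, add_assoc, ← Finset.sum_add_distrib]
    gcongr with A _
    have h3 : a A = infoSum g p v ∅ A + (1 / 2 * chiSum g p v ∅ t y - 1 / 2 * chiSum g p v A t y)
        - Real.log (∏ i ∈ A, b i : ℕ) := by
      rw [ha, ← log_dens_sub g p hv ∅ A t y]
    set x := 1 / 2 * chiSum g p v ∅ t y - 1 / 2 * chiSum g p v A t y with hx
    have h4 : x ^ 2 ≤ (chiSum g p v ∅ t y ^ 2 + chiSum g p v A t y ^ 2) / 2 := by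
      rw [hx]
      nlinarith [sq_nonneg (chiSum g p v ∅ t y + chiSum g p v A t y)]
    have h5 : |x| ≤ s + 1 / (2 * s) * (chiSum g p v ∅ t y ^ 2 + chiSum g p v A t y ^ 2) := by
      have h6 : x ^ 2 / s ≤ 1 / (2 * s) * (chiSum g p v ∅ t y ^ 2 + chiSum g p v A t y ^ 2) := by
        rw [div_le_iff₀ hs]
        calc _ ≤ _ := h4
          _ = _ := by field_simp
      -- Trades the absolute value for a second moment, with `s` free; taking `s` proportional to
      -- `n` later makes the quadratic part bounded on average.
      have h7 : |x| ≤ s + x ^ 2 / s := by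
        rw [← sub_le_iff_le_add', le_div_iff₀ hs, ← sq_abs]
        nlinarith [sq_nonneg (|x| - s), abs_nonneg x]
      linarith
    have h8 : x ≤ |x| := le_abs_self x
    have h9 := le_max_left (infoSum g p v ∅ A - Real.log (∏ i ∈ A, b i : ℕ)) 0
    have h10 := le_max_right (infoSum g p v ∅ A - Real.log (∏ i ∈ A, b i : ℕ)) 0
    refine max_le ?_ ?_
    · rw [h3]
      simp only [hd]
      linarith
    · have := hd0 A
      positivity
  refine (W.expect_mono _ hpt).trans ?_
  have hmA : ∀ A : Finset ι, Measurable fun q : (ι → κ → ℝ) × (κ → ℝ) => ENNReal.ofReal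
        (1 / (2 * s) * (chiSum g p v ∅ q.1 q.2 ^ 2 + chiSum g p v A q.1 q.2 ^ 2)) := fun A =>
    ((((measurable_chiSum g p v ∅).pow_const 2).add
      ((measurable_chiSum g p v A).pow_const 2)).const_mul _).ennreal_ofReal
  rw [W.expect_add _ measurable_const, W.expect_const, W.expect_finsetSum _ _ hmA]
  have e2 : ∀ A : Finset ι, _ := fun A => expect_const_mul_chiSum_sq_add g p hv
    (Finset.subset_univ (∅ : Finset ι)) (Finset.subset_univ A) (c := 1 / (2 * s)) (by positivity)
  have hG := gaussSqVar_nonneg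
  rw [Finset.sum_congr rfl fun A _ => e2 A, ← ENNReal.ofReal_sum_of_nonneg fun A _ => by positivity,
    ← ENNReal.ofReal_add hc₀0 (Finset.sum_nonneg fun A _ => by positivity)]
  refine ENNReal.ofReal_le_ofReal (le_of_eq ?_)
  rw [hc₀, add_assoc, ← Finset.sum_add_distrib]
  congr 1
  refine Finset.sum_congr rfl fun A _ => ?_
  simp only [hd]
  congr 1
  field_simp

end GaussFamily

/-! ### Information quantities of Gaussian inputs -/

lemma map_mul_add_gaussianReal_prod (a m₁ m₂ : ℝ) (u₁ u₂ : ℝ≥0) :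
    ((gaussianReal m₁ u₁).prod (gaussianReal m₂ u₂)).map (fun z => a * z.1 + z.2)
      = gaussianReal (a * m₁ + m₂) (‖a‖₊ ^ 2 * u₁ + u₂) := by
  have h : (fun z : ℝ × ℝ => a * z.1 + z.2) = (fun z => z.1 + z.2) ∘ Prod.map (a * ·) id := rfl
  rw [h, ← Measure.map_map (by fun_prop) (by fun_prop),
    ← Measure.map_prod_map _ _ (by fun_prop) (by fun_prop), Measure.map_id,
    gaussianReal_map_const_mul]
  have h2 := gaussianReal_conv_gaussianReal (m₁ := a * m₁) (m₂ := m₂)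
    (v₁ := .mk (a ^ 2) (sq_nonneg _) * u₁) (v₂ := u₂)
  rw [Measure.conv] at h2
  rw [h2]
  congr 2
  ext
  simp

/-- Disjoint blocks of coordinates are independent, so the block `B` can be replaced by a fresh
copy. -/
lemma lintegral_pi_restrict₂ {ι 𝒯 : Type*} [Fintype ι] [MeasurableSpace 𝒯]
    (μ : ι → Measure 𝒯) [∀ i, IsProbabilityMeasure (μ i)] {A B : Finset ι} (hAB : Disjoint A B)
    {H : (A → 𝒯) → (B → 𝒯) → ℝ≥0∞} (hH : Measurable fun q : (A → 𝒯) × (B → 𝒯) => H q.1 q.2) :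
    ∫⁻ t, ∫⁻ b, H (fun i => t i) b ∂(Measure.pi fun i : B => μ i) ∂Measure.pi μ
      = ∫⁻ t, H (fun i => t i) (fun i => t i) ∂Measure.pi μ := by
  have hi : iIndepFun (fun i (t : ι → 𝒯) => t i) (Measure.pi μ) :=
    iIndepFun_pi (X := fun _ x => x) fun i => aemeasurable_id
  have h := hi.indepFun_finset A B hAB (fun i => measurable_pi_apply i)
  have hmr : ∀ A : Finset ι, Measurable fun (t : ι → 𝒯) (i : A) => t i := fun A =>
    measurable_pi_lambda _ fun i => measurable_pi_apply _
  rw [indepFun_iff_map_prod_eq_prod_map_map (hmr A).aemeasurable (hmr B).aemeasurable] at h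
  have hA : (Measure.pi μ).map (fun t (i : A) => t i) = Measure.pi fun i : A => μ i :=
    map_pi_comp μ Subtype.val_injective
  have hB : (Measure.pi μ).map (fun t (i : B) => t i) = Measure.pi fun i : B => μ i :=
    map_pi_comp μ Subtype.val_injective
  rw [hA, hB] at h
  have hm : Measurable fun a : A → 𝒯 => ∫⁻ b, H a b ∂(Measure.pi fun i : B => μ i) :=
    hH.lintegral_prod_right'
  have h1 := lintegral_map (μ := Measure.pi μ) hm (g := fun t (i : A) => t i) (hmr A)
  rw [hA] at h1
  rw [← h1, ← lintegral_prod _ hH.aemeasurable, ← h, lintegral_map hH ((hmr A).prodMk (hmr B))]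

namespace GaussianICEE

variable {G : GaussianICEE}

/-- The gain from auxiliary variable `i` to output `r`. -/
def auxGain (G : GaussianICEE) (r : Fin 3) (i : Fin 6) : ℝ := G.gain r (user i)

/-- The variance of jamming plus noise at output `r`. -/
def noiseVar (G : GaussianICEE) (r : Fin 3) (jam : Fin 2 → ℝ≥0) : ℝ≥0 :=
  ‖G.gain r 0‖₊ ^ 2 * jam 0 + (‖G.gain r 1‖₊ ^ 2 * jam 1 + 1)

lemma noiseVar_ne_zero (G : GaussianICEE) (r : Fin 3) (jam : Fin 2 → ℝ≥0) :
    G.noiseVar r jam ≠ 0 := by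
  unfold noiseVar; positivity

/-- Only the `r`-th noise marginal enters, which is why the dependence among the three noises plays
no role. -/
lemma map_jam_noise (G : GaussianICEE) (r : Fin 3) (jam : Fin 2 → ℝ≥0) :
    ((Measure.pi fun k => gaussianReal 0 (jam k)).prod G.noise).map
        (fun z => G.gain r 0 * z.1 0 + (G.gain r 1 * z.1 1 + z.2 r))
      = gaussianReal 0 (G.noiseVar r jam) := by
  have h0 : (fun z : (Fin 2 → ℝ) × (Fin 3 → ℝ) =>
      G.gain r 0 * z.1 0 + (G.gain r 1 * z.1 1 + z.2 r))
      = (fun w : ℝ × ℝ => G.gain r 0 * w.1 + w.2) ∘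
        (Prod.map id (fun w : ℝ × ℝ => G.gain r 1 * w.1 + w.2)) ∘ MeasurableEquiv.prodAssoc ∘
        (Prod.map (MeasurableEquiv.piFinTwo fun _ => ℝ) (fun z : Fin 3 → ℝ => z r)) := rfl
  have h1 : (Measure.pi fun k => gaussianReal 0 (jam k)).map (MeasurableEquiv.piFinTwo fun _ => ℝ)
      = (gaussianReal 0 (jam 0)).prod (gaussianReal 0 (jam 1)) :=
    (measurePreserving_piFinTwo fun k => gaussianReal 0 (jam k)).map_eq
  rw [h0, ← Measure.map_map (by fun_prop) (by fun_prop), ← Measure.map_map (by fun_prop)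
    (by fun_prop), ← Measure.map_map (by fun_prop) (by fun_prop),
    ← Measure.map_prod_map _ _ (by fun_prop) (by fun_prop), h1, G.noise_marginal]
  have h2 := (measurePreserving_prodAssoc (gaussianReal 0 (jam 0)) (gaussianReal 0 (jam 1))
    (gaussianReal 0 1)).map_eq
  rw [h2, ← Measure.map_prod_map _ _ (by fun_prop) (by fun_prop), Measure.map_id,
    map_mul_add_gaussianReal_prod, map_mul_add_gaussianReal_prod]
  simp [noiseVar]

lemma filter_user_zero : (Finset.univ.filter fun i => user i = 0) = {0, 1, 2} := by decide

lemma filter_user_one : (Finset.univ.filter fun i => user i = 1) = {3, 4, 5} := by decide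

lemma auxGain_sum (G : GaussianICEE) (r : Fin 3) (t : Fin 6 → ℝ) :
    outMean (G.auxGain r) Finset.univ t = G.gain r 0 * (∑ i with user i = 0, t i)
      + G.gain r 1 * ∑ i with user i = 1, t i := by
  rw [filter_user_zero, filter_user_one]
  simp [outMean, auxGain, Fin.sum_univ_succ, user]
  ring

namespace GaussianInput

/-- The densities of output `r` given auxiliary variables and `Q = q`. -/
def family (p : G.GaussianInput) (r : Fin 3) (q : Fin p.m) :=
  gaussFamilyLetter (G.auxGain r) (p.auxPower q) (G.noiseVar r (p.jamPower q))
    (G.noiseVar_ne_zero r _)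

/-- Conditional variance of output `r` given the auxiliary variables in `A` and `Q = q`. -/
def condVar (p : G.GaussianInput) (r : Fin 3) (q : Fin p.m) (A : Finset (Fin 6)) : ℝ≥0 :=
  outVar (G.auxGain r) (p.auxPower q) (G.noiseVar r (p.jamPower q)) A

lemma condVar_ne_zero (p : G.GaussianInput) (r : Fin 3) (q : Fin p.m) (A : Finset (Fin 6)) :
    p.condVar r q A ≠ 0 := outVar_ne_zero _ _ (G.noiseVar_ne_zero r _) _

/-- `I(T_{D \ A}; Y_r | T_A, Q)` in nats. -/
def rate (p : G.GaussianInput) (r : Fin 3) (A D : Finset (Fin 6)) : ℝ :=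
  ∑ q, (p.pQ q : ℝ) * (1 / 2 * Real.log (p.condVar r q A / p.condVar r q D))

lemma measurable_Y (p : G.GaussianInput) (r : Fin 3) : Measurable (p.Y r) := by
  unfold Y output X; fun_prop

/-- Reduces every expectation that involves a single output to expectations under the density
families, one for each value of the time-sharing variable. -/
lemma lintegral_law (p : G.GaussianInput) (r : Fin 3) {F : Fin p.m → (Fin 6 → ℝ) → ℝ → ℝ≥0∞}
    (hF : ∀ q, Measurable fun z : (Fin 6 → ℝ) × ℝ => F q z.1 z.2) :
    ∫⁻ ω, F ω.1 ω.2.1 (p.Y r ω) ∂p.law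
      = ∑ q, (p.pQ q : ℝ≥0∞) * (p.family r q).expect Finset.univ (F q) := by
  have hF' : Measurable fun z : Fin p.m × (Fin 6 → ℝ) × ℝ => F z.1 z.2.1 z.2.2 :=
    measurable_from_prod_countable_right hF
  have hFω : Measurable fun ω : p.Sample => F ω.1 ω.2.1 (p.Y r ω) :=
    hF'.comp (measurable_fst.prodMk (measurable_snd.fst.prodMk (p.measurable_Y r)))
  rw [law, lintegral_finsetSum_measure]
  refine Finset.sum_congr rfl fun q _ => ?_
  rw [lintegral_smul_measure, smul_eq_mul]
  congr 1
  rw [lintegral_prod _ hFω.aemeasurable, lintegral_dirac' _ hFω.lintegral_prod_right']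
  have hFq : Measurable fun ω : (Fin 6 → ℝ) × (Fin 2 → ℝ) × (Fin 3 → ℝ) =>
      F q ω.1 (p.Y r (q, ω)) := hFω.comp (measurable_const.prodMk measurable_id)
  rw [lintegral_prod _ hFq.aemeasurable, DensityFamily.expect_eq_lintegral_input _ (hF q)]
  refine lintegral_congr fun t => ?_
  have hFt : Measurable (F q t) := (hF q).comp (measurable_const.prodMk measurable_id)
  have hY : ∀ z : (Fin 2 → ℝ) × (Fin 3 → ℝ), p.Y r (q, t, z) =
      outMean (G.auxGain r) Finset.univ t +
        (G.gain r 0 * z.1 0 + (G.gain r 1 * z.1 1 + z.2 r)) := by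
    intro z
    rw [auxGain_sum]
    simp only [Y, output, X]
    ring
  simp_rw [hY]
  rw [← lintegral_map (f := fun y => F q t (outMean (G.auxGain r) Finset.univ t + y))
    (hFt.comp (measurable_const_add _)) (by fun_prop), map_jam_noise,
    ← lintegral_map (f := F q t) hFt (measurable_const_add _), gaussianReal_map_const_add, zero_add,
    gaussianReal_of_var_ne_zero _ (G.noiseVar_ne_zero r _),
    lintegral_withDensity_eq_lintegral_mul _ (by fun_prop) hFt]
  refine lintegral_congr fun y => ?_
  simp [family, gaussFamilyLetter, outVar, mul_comm]

end GaussianInput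
end GaussianICEE

namespace DensityFamily

variable {ι 𝒯 𝒴 : Type*} [DecidableEq ι] [MeasurableSpace 𝒯] [MeasurableSpace 𝒴]
  {μ : ι → Measure 𝒯} {ν : Measure 𝒴} (W : DensityFamily μ ν) [Fintype ι]
  [∀ i, IsProbabilityMeasure (μ i)] [SFinite ν]

lemma expect_input (D : Finset ι) {f : (ι → 𝒯) → ℝ≥0∞} (hf : Measurable f) :
    W.expect D (fun t _ => f t) = ∫⁻ t, f t ∂Measure.pi μ := by
  rw [W.expect_eq_lintegral_input (hf.comp measurable_fst)]
  refine lintegral_congr fun t => ?_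
  have hm : Measurable fun y => W.dens D t y := W.meas_comp D measurable_const measurable_id
  rw [lintegral_const_mul _ hm, W.lintegral_eq_one, mul_one]

end DensityFamily

/-- The divergence of a measure given by a positive density. -/
lemma klDiv_withDensity {α : Type*} [MeasurableSpace α] {ν : Measure α} [IsProbabilityMeasure ν]
    {ρ : α → ℝ≥0∞} (hρ : Measurable ρ) [IsProbabilityMeasure (ν.withDensity ρ)] {h : α → ℝ}
    (hh : ∀ x, Real.log (ρ x).toReal = h x) (hinteg : Integrable h (ν.withDensity ρ)) :
    InformationTheory.klDiv (ν.withDensity ρ) ν = ENNReal.ofReal (∫ x, h x ∂ν.withDensity ρ) := by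
  have hac : ν.withDensity ρ ≪ ν := withDensity_absolutelyContinuous _ _
  have hllr : llr (ν.withDensity ρ) ν =ᵐ[ν.withDensity ρ] h := by
    filter_upwards [hac.ae_le (Measure.rnDeriv_withDensity ν hρ)] with x hx
    rw [llr, hx, hh]
  rw [InformationTheory.klDiv_of_ac_of_integrable hac ((integrable_congr hllr).2 hinteg),
    integral_congr_ae hllr]
  simp

namespace GaussianICEE
namespace GaussianInput

variable {G : GaussianICEE} (p : G.GaussianInput) (r : Fin 3)

lemma family_dens (q : Fin p.m) (A : Finset (Fin 6)) (t : Fin 6 → ℝ) (y : ℝ) :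
    (p.family r q).dens A t y = gaussianPDF (outMean (G.auxGain r) A t) (p.condVar r q A) y := rfl

section CondInfo

variable (A S : Finset (Fin 6))

/-- The law of `T_S` given `Q`. -/
def auxKernel : Kernel ((A → ℝ) × Fin p.m) (S → ℝ) where
  toFun c := Measure.pi fun i : S => gaussianReal 0 (p.auxPower c.2 i)
  measurable' := (Measurable.of_discrete (f := fun q : Fin p.m =>
    (Measure.pi fun i : S => gaussianReal 0 (p.auxPower q i)))).comp measurable_snd

instance : IsMarkovKernel (p.auxKernel A S) :=
  ⟨fun c => by
    change IsProbabilityMeasure (Measure.pi fun i : S => gaussianReal 0 (p.auxPower c.2 i))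
    infer_instance⟩

/-- The law of `Y_r` given `T_A` and `Q`. -/
def outKernel : Kernel ((A → ℝ) × Fin p.m) ℝ where
  toFun c := gaussianReal (∑ i : A, G.auxGain r i * c.1 i) (p.condVar r c.2 A)
  measurable' := by
    have hm : Measurable fun c : (A → ℝ) × Fin p.m => ∑ i : A, G.auxGain r i * c.1 i :=
      Finset.measurable_fun_sum _ fun i _ =>
        ((measurable_pi_apply i).comp measurable_fst).const_mul _
    refine measurable_gaussianReal.comp (hm.prodMk ?_)
    exact (Measurable.of_discrete (f := fun q : Fin p.m => p.condVar r q A)).comp measurable_snd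

instance : IsMarkovKernel (p.outKernel r A) :=
  ⟨fun c => by
    change IsProbabilityMeasure (gaussianReal _ _)
    infer_instance⟩

/-- The conditioning variables `(T_A, Q)`. -/
def condVars (ω : p.Sample) : (A → ℝ) × Fin p.m := (p.T A ω, p.Q ω)

lemma measurable_T : Measurable (p.T S) := by
  unfold T
  exact measurable_pi_lambda _ fun i => (measurable_pi_apply _).comp measurable_snd.fst

lemma measurable_condVars : Measurable (p.condVars A) :=
  (p.measurable_T A).prodMk measurable_fst

lemma sum_coe_eq_outMean (t : Fin 6 → ℝ) :
    ∑ i : A, G.auxGain r i * t i = outMean (G.auxGain r) A t :=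
  Finset.sum_coe_sort A fun i => G.auxGain r i * t i

lemma measurable_restrict : Measurable fun (t : Fin 6 → ℝ) (i : A) => t i :=
  measurable_pi_lambda _ fun _ => measurable_pi_apply _

lemma lintegral_map_condVars {H : (A → ℝ) × Fin p.m → ℝ≥0∞} (hH : Measurable H) :
    ∫⁻ c, H c ∂(p.law.map (p.condVars A))
      = ∑ q, (p.pQ q : ℝ≥0∞) *
        ∫⁻ t, H (fun i => t i, q) ∂(Measure.pi fun i => gaussianReal 0 (p.auxPower q i)) := by
  rw [lintegral_map hH (p.measurable_condVars A)]
  have hm : ∀ q, Measurable fun t : Fin 6 → ℝ => H (fun i => t i, q) := fun q =>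
    hH.comp ((measurable_restrict A).prodMk measurable_const)
  refine (p.lintegral_law 0 (F := fun q t _ => H (fun i => t i, q))
    fun q => (hm q).comp measurable_fst).trans ?_
  exact Finset.sum_congr rfl fun q _ => by rw [DensityFamily.expect_input _ _ (hm q)]

lemma map_condVars_aux (hAS : Disjoint A S) :
    p.law.map (fun ω => (p.condVars A ω, p.T S ω)) = p.law.map (p.condVars A) ⊗ₘ p.auxKernel A S := by
  refine Measure.ext_of_lintegral _ fun F hF => ?_
  rw [Measure.lintegral_compProd hF, lintegral_map_condVars p A
    hF.lintegral_kernel_prod_right', lintegral_map hF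
    ((p.measurable_condVars A).prodMk (p.measurable_T S))]
  have hm : ∀ q, Measurable fun t : Fin 6 → ℝ => F ((fun i => t i, q), fun i => t i) := fun q =>
    hF.comp (((measurable_restrict A).prodMk measurable_const).prodMk (measurable_restrict S))
  refine (p.lintegral_law 0 (F := fun q t _ => F ((fun i => t i, q), fun i => t i))
    fun q => (hm q).comp measurable_fst).trans ?_
  refine Finset.sum_congr rfl fun q _ => ?_
  rw [DensityFamily.expect_input _ _ (hm q)]
  congr 1
  exact (lintegral_pi_restrict₂ (fun i => gaussianReal 0 (p.auxPower q i)) hAS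
    (H := fun a b => F ((a, q), b)) (hF.comp (by fun_prop))).symm

lemma lintegral_outKernel (q : Fin p.m) (t : Fin 6 → ℝ) {f : ℝ → ℝ≥0∞} (hf : Measurable f) :
    ∫⁻ y, f y ∂(p.outKernel r A (fun i => t i, q)) = ∫⁻ y, f y * (p.family r q).dens A t y := by
  change ∫⁻ y, f y ∂gaussianReal (∑ i : A, G.auxGain r i * t i) (p.condVar r q A) = _
  rw [sum_coe_eq_outMean, gaussianReal_of_var_ne_zero _ (p.condVar_ne_zero r q A),
    lintegral_withDensity_eq_lintegral_mul _ (by fun_prop) hf]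
  exact lintegral_congr fun y => mul_comm _ _

lemma map_condVars_out :
    p.law.map (fun ω => (p.condVars A ω, p.Y r ω)) = p.law.map (p.condVars A) ⊗ₘ p.outKernel r A := by
  refine Measure.ext_of_lintegral _ fun F hF => ?_
  rw [Measure.lintegral_compProd hF, lintegral_map_condVars p A
    hF.lintegral_kernel_prod_right', lintegral_map hF
    ((p.measurable_condVars A).prodMk (p.measurable_Y r))]
  have hm : ∀ q, Measurable fun z : (Fin 6 → ℝ) × ℝ => F ((fun i => z.1 i, q), z.2) := fun q =>
    hF.comp ((((measurable_restrict A).comp measurable_fst).prodMk measurable_const).prodMk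
      measurable_snd)
  refine (p.lintegral_law r (F := fun q t y => F ((fun i => t i, q), y)) hm).trans ?_
  refine Finset.sum_congr rfl fun q _ => ?_
  rw [DensityFamily.expect_subset _ (Finset.subset_univ A) (F := fun t y => F ((fun i => t i, q), y))
    (hm q), DensityFamily.expect_eq_lintegral_input _ (hm q)]
  · congr 1
    refine lintegral_congr fun t => ?_
    exact (lintegral_outKernel p r A q t (f := fun y => F ((fun i => t i, q), y))
      (hF.comp (by fun_prop))).symm
  · intro t t' y h
    have : (fun i : A => t i) = fun i : A => t' i := funext fun i => h i i.2
    rw [this]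

/-- A disintegration determines `condDistrib` almost everywhere, so the explicit product-Gaussian
and Gaussian kernels can replace it in the reference measure of `condMutualInfo`. -/
lemma compProd_condDistrib (hAS : Disjoint A S) :
    (p.law.map (p.condVars A)).compProd
        (condDistrib (p.T S) (p.condVars A) p.law ×ₖ condDistrib (p.Y r) (p.condVars A) p.law)
      = (p.law.map (p.condVars A)) ⊗ₘ (p.auxKernel A S ×ₖ p.outKernel r A) := by
  refine Measure.compProd_congr ?_
  filter_upwards [condDistrib_ae_eq_of_measure_eq_compProd (p.condVars A)
    (p.measurable_T S).aemeasurable (p.map_condVars_aux A S hAS),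
    condDistrib_ae_eq_of_measure_eq_compProd (p.condVars A)
    (p.measurable_Y r).aemeasurable (p.map_condVars_out r A)] with c h1 h2
  rw [Kernel.prod_apply, Kernel.prod_apply, h1, h2]

lemma measurable_restrict₂ (q : Fin p.m) : Measurable fun z : (Fin 6 → ℝ) × ℝ =>
    (((fun i => z.1 i : A → ℝ), q), (fun i => z.1 i : S → ℝ), z.2) :=
  (((measurable_restrict A).comp measurable_fst).prodMk measurable_const).prodMk
    (((measurable_restrict S).comp measurable_fst).prodMk measurable_snd)

lemma lintegral_reference (hAS : Disjoint A S)
    {F : ((A → ℝ) × Fin p.m) × (S → ℝ) × ℝ → ℝ≥0∞} (hF : Measurable F) :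
    ∫⁻ z, F z ∂((p.law.map (p.condVars A)) ⊗ₘ (p.auxKernel A S ×ₖ p.outKernel r A))
      = ∑ q, (p.pQ q : ℝ≥0∞) * (p.family r q).expect A
          (fun t y => F ((fun i => t i, q), fun i => t i, y)) := by
  rw [Measure.lintegral_compProd hF, lintegral_map_condVars p A hF.lintegral_kernel_prod_right']
  refine Finset.sum_congr rfl fun q _ => ?_
  have hm := hF.comp (p.measurable_restrict₂ A S q)
  rw [DensityFamily.expect_eq_lintegral_input _ hm]
  congr 1
  set H : (A → ℝ) → (S → ℝ) → ℝ≥0∞ := fun a b => ∫⁻ y, F ((a, q), b, y) ∂(p.outKernel r A (a, q))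
    with hHd
  have hH : Measurable fun z : (A → ℝ) × (S → ℝ) => H z.1 z.2 := by
    let κ' : Kernel ((A → ℝ) × (S → ℝ)) ℝ :=
      (p.outKernel r A).comap (fun z => (z.1, q)) (by fun_prop)
    have : Measurable fun z : ((A → ℝ) × (S → ℝ)) × ℝ => F ((z.1.1, q), z.1.2, z.2) :=
      hF.comp (by fun_prop)
    exact this.lintegral_kernel_prod_right' (κ := κ')
  calc _ = ∫⁻ t, ∫⁻ b, H (fun i => t i) b ∂(Measure.pi fun i : S => gaussianReal 0 (p.auxPower q i))
        ∂(Measure.pi fun i => gaussianReal 0 (p.auxPower q i)) := by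
        refine lintegral_congr fun t => ?_
        rw [Kernel.prod_apply, lintegral_prod]
        · rfl
        · exact (hF.comp (by fun_prop)).aemeasurable
    _ = _ := lintegral_pi_restrict₂ (fun i => gaussianReal 0 (p.auxPower q i)) hAS hH
    _ = _ := by
        refine lintegral_congr fun t => ?_
        rw [hHd]
        exact lintegral_outKernel p r A q t (hF.comp (by fun_prop))

/-- The likelihood ratio of the true law to the conditionally independent one. -/
def likelihoodRatio (z : ((A → ℝ) × Fin p.m) × (S → ℝ) × ℝ) : ℝ≥0∞ :=
  gaussianPDF (∑ i : A, G.auxGain r i * z.1.1 i + ∑ i : S, G.auxGain r i * z.2.1 i)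
      (p.condVar r z.1.2 (A ∪ S)) z.2.2 /
    gaussianPDF (∑ i : A, G.auxGain r i * z.1.1 i) (p.condVar r z.1.2 A) z.2.2

lemma measurable_likelihoodRatio : Measurable (p.likelihoodRatio r A S) := by
  have h1 : ∀ B : Finset (Fin 6), Measurable fun z : ((A → ℝ) × Fin p.m) × (S → ℝ) × ℝ =>
      p.condVar r z.1.2 B := fun B =>
    (Measurable.of_discrete (f := fun q : Fin p.m => p.condVar r q B)).comp (by fun_prop)
  have h2 := h1 A
  have h3 := h1 (A ∪ S)
  unfold likelihoodRatio gaussianPDF gaussianPDFReal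
  fun_prop

lemma likelihoodRatio_eq (hAS : Disjoint A S) (q : Fin p.m) (t : Fin 6 → ℝ) (y : ℝ) :
    p.likelihoodRatio r A S ((fun i => t i, q), fun i => t i, y)
      = (p.family r q).dens (A ∪ S) t y / (p.family r q).dens A t y := by
  simp only [likelihoodRatio, family_dens, sum_coe_eq_outMean]
  congr 2
  simp only [outMean]
  rw [Finset.sum_union hAS]

/-- The true law has output density given `A ∪ S`, the reference law has it given `A` only. The
input part is common to both, so the quotient of output densities is the full density. -/
lemma map_eq_withDensity (hAS : Disjoint A S) :
    p.law.map (fun ω => (p.condVars A ω, p.T S ω, p.Y r ω))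
      = ((p.law.map (p.condVars A)) ⊗ₘ (p.auxKernel A S ×ₖ p.outKernel r A)).withDensity
        (p.likelihoodRatio r A S) := by
  refine Measure.ext_of_lintegral _ fun F hF => ?_
  rw [lintegral_withDensity_eq_lintegral_mul _ (p.measurable_likelihoodRatio r A S) hF,
    lintegral_reference p r A S hAS ((p.measurable_likelihoodRatio r A S).mul hF),
    lintegral_map hF ((p.measurable_condVars A).prodMk ((p.measurable_T S).prodMk
      (p.measurable_Y r)))]
  have hm := fun q => hF.comp (p.measurable_restrict₂ A S q)
  refine (p.lintegral_law r (F := fun q t y => F ((fun i => t i, q), fun i => t i, y)) hm).trans ?_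
  refine Finset.sum_congr rfl fun q _ => ?_
  rw [DensityFamily.expect_subset _ (Finset.subset_univ (A ∪ S))
    (F := fun t y => F ((fun i => t i, q), fun i => t i, y)) (hm q)]
  · congr 1
    unfold DensityFamily.expect
    refine lintegral_congr fun y => lintegral_congr fun t => ?_
    simp only [Pi.mul_apply]
    rw [likelihoodRatio_eq p r A S hAS, mul_right_comm, ENNReal.div_mul_cancel
      ((p.family r q).ne_zero _ _ _) ((p.family r q).ne_top _ _ _), mul_comm]
  · intro t t' y h
    have h1 : (fun i : A => t i) = fun i : A => t' i :=
      funext fun i => h i (Finset.mem_union_left _ i.2)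
    have h2 : (fun i : S => t i) = fun i : S => t' i :=
      funext fun i => h i (Finset.mem_union_right _ i.2)
    rw [h1, h2]

/-- Normalized square of the output noise given the auxiliary variables in `B`. -/
def normSq (B : Finset (Fin 6)) (ω : p.Sample) : ℝ :=
  (p.condVar r ω.1 B : ℝ)⁻¹ * (p.Y r ω - outMean (G.auxGain r) B ω.2.1) ^ 2

lemma lintegral_normSq (B : Finset (Fin 6)) :
    ∫⁻ ω, ENNReal.ofReal (p.normSq r B ω) ∂p.law = 1 := by
  have hmean := measurable_outMean (G.auxGain r) B
  have hm : ∀ q, Measurable fun z : (Fin 6 → ℝ) × ℝ => ENNReal.ofReal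
      ((p.condVar r q B : ℝ)⁻¹ * (z.2 - outMean (G.auxGain r) B z.1) ^ 2) := fun q => by fun_prop
  refine (p.lintegral_law r (F := fun q t y => ENNReal.ofReal
    ((p.condVar r q B : ℝ)⁻¹ * (y - outMean (G.auxGain r) B t) ^ 2)) hm).trans ?_
  have h : ∀ q, (p.family r q).expect Finset.univ (fun t y => ENNReal.ofReal
      ((p.condVar r q B : ℝ)⁻¹ * (y - outMean (G.auxGain r) B t) ^ 2)) = 1 := by
    intro q
    have hv : (0 : ℝ) < p.condVar r q B := by
      have := p.condVar_ne_zero r q B; positivity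
    rw [DensityFamily.expect_subset _ (Finset.subset_univ B) (hm q),
      DensityFamily.expect_eq_lintegral_input _ (hm q)]
    · have h1 : ∀ t, ∫⁻ y, ENNReal.ofReal
          ((p.condVar r q B : ℝ)⁻¹ * (y - outMean (G.auxGain r) B t) ^ 2) *
            (p.family r q).dens B t y = 1 := by
        intro t
        have hmt : Measurable fun y => ENNReal.ofReal
          ((p.condVar r q B : ℝ)⁻¹ * (y - outMean (G.auxGain r) B t) ^ 2) := by fun_prop
        have h2 := lintegral_withDensity_eq_lintegral_mul volume
          (measurable_gaussianPDF (outMean (G.auxGain r) B t) (p.condVar r q B)) hmt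
        rw [← gaussianReal_of_var_ne_zero _ (p.condVar_ne_zero r q B), gaussianReal_eq_map,
          lintegral_map hmt (by fun_prop)] at h2
        have h3 : ∀ x : ℝ, (p.condVar r q B : ℝ)⁻¹ * (outMean (G.auxGain r) B t +
            √(p.condVar r q B) * x - outMean (G.auxGain r) B t) ^ 2 = x ^ 2 := by
          intro x
          rw [add_sub_cancel_left, mul_pow, Real.sq_sqrt hv.le, ← mul_assoc,
            inv_mul_cancel₀ hv.ne', one_mul]
        simp_rw [h3] at h2
        rw [← ofReal_integral_eq_lintegral_ofReal (memLp_sq_gaussianReal.integrable one_le_two)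
          (ae_of_all _ fun x => sq_nonneg x), integral_sq_gaussianReal, ENNReal.ofReal_one] at h2
        rw [h2]
        exact lintegral_congr fun y => mul_comm _ _
      simp_rw [h1]
      simp
    · intro t t' y h
      have : outMean (G.auxGain r) B t = outMean (G.auxGain r) B t' := by
        unfold outMean
        exact Finset.sum_congr rfl fun i hi => by rw [h i hi]
      rw [this]
  simp_rw [h, mul_one]
  exact_mod_cast congrArg (fun x : ℝ≥0 => (x : ℝ≥0∞)) p.pQ_sum

lemma normSq_nonneg (B : Finset (Fin 6)) (ω : p.Sample) : 0 ≤ p.normSq r B ω := by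
  unfold normSq; positivity

lemma measurable_condVar (B : Finset (Fin 6)) :
    Measurable fun ω : p.Sample => (p.condVar r ω.1 B : ℝ) :=
  (Measurable.of_discrete (f := fun q : Fin p.m => (p.condVar r q B : ℝ))).comp measurable_fst

lemma measurable_normSq (B : Finset (Fin 6)) : Measurable (p.normSq r B) := by
  have h1 := measurable_outMean (G.auxGain r) B
  have h2 := p.measurable_Y r
  have h3 := p.measurable_condVar r B
  unfold normSq
  fun_prop

lemma integrable_normSq (B : Finset (Fin 6)) : Integrable (p.normSq r B) p.law := by
  refine ⟨(p.measurable_normSq r B).aestronglyMeasurable, ?_⟩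
  rw [hasFiniteIntegral_iff_ofReal (ae_of_all _ (p.normSq_nonneg r B)), lintegral_normSq]
  exact ENNReal.one_lt_top

lemma integral_normSq (B : Finset (Fin 6)) : ∫ ω, p.normSq r B ω ∂p.law = 1 := by
  rw [integral_eq_lintegral_of_nonneg_ae (ae_of_all _ (p.normSq_nonneg r B))
    (p.measurable_normSq r B).aestronglyMeasurable, lintegral_normSq]
  simp

lemma integrable_and_integral_time_sharing {h : Fin p.m → ℝ} (h0 : ∀ q, 0 ≤ h q) :
    Integrable (fun ω : p.Sample => h ω.1) p.law ∧
      ∫ ω, h ω.1 ∂p.law = ∑ q, (p.pQ q : ℝ) * h q := by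
  have hm : Measurable fun ω : p.Sample => h ω.1 := Measurable.of_discrete.comp measurable_fst
  have hl : ∫⁻ ω : p.Sample, ENNReal.ofReal (h ω.1) ∂p.law
      = ENNReal.ofReal (∑ q, (p.pQ q : ℝ) * h q) := by
    refine (p.lintegral_law 0 (F := fun q _ _ => ENNReal.ofReal (h q))
      fun q => measurable_const).trans ?_
    rw [ENNReal.ofReal_sum_of_nonneg (f := fun q => (p.pQ q : ℝ) * h q)
      fun q _ => mul_nonneg (p.pQ q).coe_nonneg (h0 q)]
    refine Finset.sum_congr rfl fun q _ => ?_
    rw [DensityFamily.expect_const, ENNReal.ofReal_mul (p.pQ q).coe_nonneg, ENNReal.ofReal_coe_nnreal]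
  refine ⟨⟨hm.aestronglyMeasurable, ?_⟩, ?_⟩
  · rw [hasFiniteIntegral_iff_ofReal (ae_of_all _ fun ω : p.Sample => h0 ω.1), hl]
    exact ENNReal.ofReal_lt_top
  · rw [integral_eq_lintegral_of_nonneg_ae (ae_of_all _ fun ω : p.Sample => h0 ω.1) hm.aestronglyMeasurable,
      hl, ENNReal.toReal_ofReal (Finset.sum_nonneg fun q _ => mul_nonneg (p.pQ q).coe_nonneg (h0 q))]

lemma condVar_anti {B B' : Finset (Fin 6)} (h : B ⊆ B') (q : Fin p.m) :
    p.condVar r q B' ≤ p.condVar r q B := by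
  unfold condVar outVar
  gcongr

lemma log_condVar_nonneg {B B' : Finset (Fin 6)} (h : B ⊆ B') (q : Fin p.m) :
    0 ≤ 1 / 2 * Real.log (p.condVar r q B / p.condVar r q B') := by
  have h1 := p.condVar_ne_zero r q B'
  have h2 : (0 : ℝ) < p.condVar r q B' := by positivity
  refine mul_nonneg (by norm_num) (Real.log_nonneg ?_)
  rw [one_le_div h2]
  exact_mod_cast p.condVar_anti r h q

lemma rate_nonneg {B B' : Finset (Fin 6)} (h : B ⊆ B') : 0 ≤ p.rate r B B' :=
  Finset.sum_nonneg fun q _ => mul_nonneg (p.pQ q).coe_nonneg (p.log_condVar_nonneg r h q)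

end CondInfo

/-- The log-likelihood ratio of the true law to the conditionally independent one. -/
def logRatio (A S : Finset (Fin 6)) (z : ((A → ℝ) × Fin p.m) × (S → ℝ) × ℝ) : ℝ :=
  Real.log (p.likelihoodRatio r A S z).toReal

lemma logRatio_eq {A S : Finset (Fin 6)} (hAS : Disjoint A S) (ω : p.Sample) :
    p.logRatio r A S (p.condVars A ω, p.T S ω, p.Y r ω)
      = 1 / 2 * Real.log (p.condVar r ω.1 A / p.condVar r ω.1 (A ∪ S))
        + (1 / 2 * p.normSq r A ω - 1 / 2 * p.normSq r (A ∪ S) ω) := by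
  have h := p.likelihoodRatio_eq r A S hAS ω.1 ω.2.1 (p.Y r ω)
  have h' : p.logRatio r A S (p.condVars A ω, p.T S ω, p.Y r ω) = Real.log
      ((p.family r ω.1).dens (A ∪ S) ω.2.1 (p.Y r ω) / (p.family r ω.1).dens A ω.2.1
        (p.Y r ω)).toReal := by
    rw [← h]; rfl
  have hv := p.condVar_ne_zero r ω.1
  have hpos : ∀ B, (0 : ℝ) < p.condVar r ω.1 B := fun B => by have := hv B; positivity
  rw [h', ENNReal.toReal_div, family_dens, family_dens, gaussianPDF, gaussianPDF,
    ENNReal.toReal_ofReal (gaussianPDFReal_nonneg _ _ _),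
    ENNReal.toReal_ofReal (gaussianPDFReal_nonneg _ _ _),
    Real.log_div (gaussianPDFReal_pos _ _ _ (hv _)).ne' (gaussianPDFReal_pos _ _ _ (hv _)).ne',
    log_gaussianPDFReal _ (hv _), log_gaussianPDFReal _ (hv _),
    Real.log_div (hpos _).ne' (hpos _).ne', normSq, normSq]
  have h1 := inv_mul_cancel₀ (hpos A).ne'
  have h2 := inv_mul_cancel₀ (hpos (A ∪ S)).ne'
  linear_combination (1 / 2) * h2 - (1 / 2) * h1

/-- `I(T_S; Y_r | T_{D \ S}, Q)` in closed form. -/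
lemma info_eq {D S : Finset (Fin 6)} (hS : S ⊆ D) :
    p.info r D S = ENNReal.ofReal (p.rate r (D \ S) D / Real.log 2) := by
  have hAS : Disjoint (D \ S) S := Finset.sdiff_disjoint
  have hun : (D \ S) ∪ S = D := Finset.sdiff_union_of_subset hS
  have hmeas : Measurable fun ω : p.Sample => (p.condVars (D \ S) ω, p.T S ω, p.Y r ω) :=
    (p.measurable_condVars _).prodMk ((p.measurable_T S).prodMk (p.measurable_Y r))
  have hmlog : Measurable (p.logRatio r (D \ S) S) :=
    Real.measurable_log.comp (p.measurable_likelihoodRatio r (D \ S) S).ennreal_toReal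
  obtain ⟨hi, hv⟩ := p.integrable_and_integral_time_sharing
    (p.log_condVar_nonneg r (Finset.sdiff_subset (s := D) (t := S)))
  have hi1 := (p.integrable_normSq r (D \ S)).const_mul (1 / 2)
  have hi2 := (p.integrable_normSq r D).const_mul (1 / 2)
  have hprob : IsProbabilityMeasure (p.law.map fun ω =>
      (p.condVars (D \ S) ω, p.T S ω, p.Y r ω)) :=
    Measure.isProbabilityMeasure_map hmeas.aemeasurable
  have hprob' : IsProbabilityMeasure (p.law.map (p.condVars (D \ S))) :=
    Measure.isProbabilityMeasure_map (p.measurable_condVars _).aemeasurable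
  have heq := p.map_eq_withDensity r (D \ S) S hAS
  have hlog : ∀ ω, p.logRatio r (D \ S) S (p.condVars (D \ S) ω, p.T S ω, p.Y r ω)
      = 1 / 2 * Real.log (p.condVar r ω.1 (D \ S) / p.condVar r ω.1 D)
        + (1 / 2 * p.normSq r (D \ S) ω - 1 / 2 * p.normSq r D ω) := by
    intro ω
    rw [logRatio_eq p r hAS, hun]
  have hinteg : Integrable (p.logRatio r (D \ S) S)
      (p.law.map fun ω => (p.condVars (D \ S) ω, p.T S ω, p.Y r ω)) := by
    rw [integrable_map_measure hmlog.aestronglyMeasurable hmeas.aemeasurable]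
    refine (hi.add (hi1.sub hi2)).congr (ae_of_all _ fun ω => ?_)
    exact (hlog ω).symm
  -- Both normalized squares have mean one and cancel, so only the averaged logarithm of the
  -- variance ratio survives.
  have hval : ∫ z, p.logRatio r (D \ S) S z
      ∂(p.law.map fun ω => (p.condVars (D \ S) ω, p.T S ω, p.Y r ω)) = p.rate r (D \ S) D := by
    rw [integral_map hmeas.aemeasurable hmlog.aestronglyMeasurable]
    simp_rw [hlog]
    have hi12 : Integrable (fun ω => 1 / 2 * p.normSq r (D \ S) ω - 1 / 2 * p.normSq r D ω) p.law :=
      hi1.sub hi2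
    rw [integral_add hi hi12, hv, integral_sub hi1 hi2, integral_const_mul,
      integral_const_mul, integral_normSq, integral_normSq, sub_self, add_zero]
    rfl
  have hkl : InformationTheory.klDiv
      (p.law.map fun ω => (p.condVars (D \ S) ω, p.T S ω, p.Y r ω))
      ((p.law.map (p.condVars (D \ S))) ⊗ₘ (p.auxKernel (D \ S) S ×ₖ p.outKernel r (D \ S)))
      = ENNReal.ofReal (p.rate r (D \ S) D) := by
    rw [← hval]
    rw [heq] at hinteg hprob ⊢
    exact klDiv_withDensity (p.measurable_likelihoodRatio r (D \ S) S) (fun z => rfl) hinteg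
  rw [ENNReal.ofReal_div_of_pos (Real.log_pos one_lt_two), ← hkl,
    ← p.compProd_condDistrib r (D \ S) S hAS]
  rfl

end GaussianInput
end GaussianICEE

/-! ### Deterministic decoders -/

/-- Choosing the least maximizing index makes the maximizer measurable. -/
lemma exists_measurable_argmax {𝒴 : Type*} [MeasurableSpace 𝒴] {M : ℕ} (hM : 0 < M)
    (F : Fin M → 𝒴 → ℝ≥0∞) (hF : ∀ m, Measurable (F m)) :
    ∃ dec : 𝒴 → Fin M, Measurable dec ∧ ∀ y m, F m y ≤ F (dec y) y := by
  classical
  let P : 𝒴 → ℕ → Prop := fun y N => ∃ h : N < M, ∀ m, F m y ≤ F ⟨N, h⟩ y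
  have hP : ∀ y, ∃ N, P y N := by
    intro y
    have : Nonempty (Fin M) := ⟨⟨0, hM⟩⟩
    obtain ⟨m, -, hm⟩ := Finset.exists_max_image Finset.univ (fun m => F m y) Finset.univ_nonempty
    exact ⟨m, m.2, fun m' => hm m' (Finset.mem_univ _)⟩
  have hPm : ∀ k, MeasurableSet {y | P y k} := by
    intro k
    by_cases h : k < M
    · have : {y | P y k} = ⋂ m, {y | F m y ≤ F ⟨k, h⟩ y} := by
        ext y; simp [P, h]
      rw [this]
      exact MeasurableSet.iInter fun m => measurableSet_le (hF m) (hF _)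
    · have : {y | P y k} = ∅ := by
        ext y; simp [P, h]
      rw [this]; exact MeasurableSet.empty
  have hlt : ∀ y, Nat.find (hP y) < M := fun y => (Nat.find_spec (hP y)).1
  refine ⟨fun y => ⟨Nat.find (hP y), hlt y⟩, ?_, fun y m => (Nat.find_spec (hP y)).2 m⟩
  refine measurable_to_countable' fun m => ?_
  have : (fun y => (⟨Nat.find (hP y), hlt y⟩ : Fin M)) ⁻¹' {m}
      = (fun y => Nat.find (hP y)) ⁻¹' {m.1} := by
    ext y; simp [Fin.ext_iff]
  rw [this]
  exact measurable_find hP hPm (measurableSet_singleton _)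

/-- A randomized decoder, choosing `m` with probability `K m y`, can be replaced by a deterministic
one that errs no more often on average. -/
lemma exists_decoder_le {𝒲 𝒴 : Type*} [Fintype 𝒲] [MeasurableSpace 𝒴] (ν : Measure 𝒴) {M : ℕ}
    (hM : 0 < M) (φ : 𝒲 → Fin M) (f : 𝒲 → 𝒴 → ℝ≥0∞) (hf : ∀ w, Measurable (f w))
    (hft : ∀ w y, f w y ≠ ∞) (K E : Fin M → 𝒴 → ℝ≥0∞) (hE : ∀ m, Measurable (E m))
    (hK : ∀ y, ∑ m, K m y ≤ 1) (hKE : ∀ m y, 1 ≤ K m y + E m y) :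
    ∃ dec : 𝒴 → Fin M, Measurable dec ∧
      ∑ w, (ν.withDensity (f w)) {y | dec y ≠ φ w} ≤ ∑ w, ∫⁻ y, f w y * E (φ w) y ∂ν := by
  classical
  -- The total likelihood of all message pairs whose decoded component is `m`; the decoder maximizes
  -- it in `m`.
  let F : Fin M → 𝒴 → ℝ≥0∞ := fun m y => ∑ w with φ w = m, f w y
  have hFm : ∀ m, Measurable (F m) := fun m => Finset.measurable_fun_sum _ fun w _ => hf w
  obtain ⟨dec, hdec, hmax⟩ := exists_measurable_argmax hM F hFm
  refine ⟨dec, hdec, ?_⟩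
  have hset : ∀ w, MeasurableSet {y | dec y ≠ φ w} := fun w =>
    (hdec (measurableSet_singleton (φ w))).compl
  have h1 : ∀ w, (ν.withDensity (f w)) {y | dec y ≠ φ w}
      = ∫⁻ y, f w y * ({y | dec y ≠ φ w}.indicator 1 y) ∂ν := by
    intro w
    rw [withDensity_apply _ (hset w), ← lintegral_indicator (hset w)]
    refine lintegral_congr fun y => ?_
    by_cases h : y ∈ {y | dec y ≠ φ w} <;> simp [Set.indicator, h]
  simp_rw [h1]
  rw [← lintegral_finsetSum _ fun w _ => (hf w).fun_mul (measurable_one.indicator (hset w)),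
    ← lintegral_finsetSum _ fun w _ => (hf w).fun_mul (hE _)]
  refine lintegral_mono fun y => ?_
  have hreg : ∀ H : Fin M → ℝ≥0∞, ∑ w, f w y * H (φ w) = ∑ m, F m y * H m := by
    intro H
    rw [← Finset.sum_fiberwise Finset.univ φ]
    refine Finset.sum_congr rfl fun m _ => ?_
    rw [Finset.sum_mul]
    exact Finset.sum_congr rfl fun w hw => by rw [(Finset.mem_filter.1 hw).2]
  have hL := hreg fun m => if dec y ≠ m then 1 else 0
  have hR := hreg fun m => E m y
  have hL' : ∑ w, f w y * ({y | dec y ≠ φ w}.indicator 1 y)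
      = ∑ w, f w y * (if dec y ≠ φ w then 1 else 0) :=
    Finset.sum_congr rfl fun w _ => by simp [Set.indicator]
  rw [hL', hL, hR]
  have hFt : F (dec y) y ≠ ∞ := ENNReal.sum_ne_top.2 fun w _ => hft w y
  have hsum : F (dec y) y + ∑ m, F m y * (if dec y ≠ m then 1 else 0) = ∑ m, F m y := by
    rw [← Finset.add_sum_erase _ (fun m => F m y) (Finset.mem_univ (dec y)),
      ← Finset.add_sum_erase _ (fun m => F m y * (if dec y ≠ m then 1 else 0))
        (Finset.mem_univ (dec y))]
    simp only [ne_eq, not_true_eq_false, if_false, mul_zero, zero_add]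
    congr 1
    exact Finset.sum_congr rfl fun m hm => by rw [if_pos (Finset.ne_of_mem_erase hm).symm, mul_one]
  -- Adding the likelihood of the chosen message to both sides compares probabilities of success
  -- without subtraction: a randomized choice succeeds with a weighted average of the `F m y`, hence
  -- at most the maximum.
  rw [← ENNReal.add_le_add_iff_left hFt, hsum]
  calc ∑ m, F m y ≤ ∑ m, (F m y * K m y + F m y * E m y) := by
        refine Finset.sum_le_sum fun m _ => ?_
        rw [← mul_add]
        exact le_mul_of_one_le_right' (hKE m y)
    _ ≤ ∑ m, F (dec y) y * K m y + ∑ m, F m y * E m y := by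
        rw [Finset.sum_add_distrib]
        gcongr with m
        exact hmax y m
    _ ≤ _ := by
        rw [← Finset.mul_sum]
        gcongr
        exact (mul_le_mul_right (hK y) _).trans (mul_one _).le

/-! ### A lower bound for the equivocation -/

lemma rnDeriv_le_of_le_withDensity {β : Type*} [MeasurableSpace β] {P Q : Measure β}
    [SigmaFinite P] [SigmaFinite Q] (hPQ : P ≪ Q) {f : β → ℝ≥0∞}
    (h : P ≤ Q.withDensity f) : P.rnDeriv Q ≤ᵐ[Q] f := by
  refine ae_le_of_forall_setLIntegral_le_of_sigmaFinite (Measure.measurable_rnDeriv _ _)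
    fun s hs _ => ?_
  rw [Measure.setLIntegral_rnDeriv hPQ, ← withDensity_apply _ hs]
  exact h s

/-- The posterior law satisfies `π log M ≤ -π log π + π log (1 + f) + π / F` when its density
relative to a reference law is at most `f / (M F)`. -/
lemma mul_log_le_negMulLog_add {π F f M : ℝ} (hπ : 0 ≤ π) (hF : 0 < F) (hM : 0 < M)
    (h : M * (π * F) ≤ f) :
    π * Real.log M ≤ Real.negMulLog π + π * Real.log (1 + f) + π * F⁻¹ := by
  rcases hπ.eq_or_lt with rfl | hπ'
  · simp
  have h1 : Real.log (M * (π * F)) ≤ Real.log (1 + f) :=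
    Real.log_le_log (by positivity) (by linarith)
  rw [Real.log_mul hM.ne' (by positivity), Real.log_mul hπ'.ne' hF.ne'] at h1
  have h2 := Real.log_le_sub_one_of_pos (inv_pos.2 hF)
  rw [Real.log_inv] at h2
  have h3 : Real.log M ≤ -Real.log π + Real.log (1 + f) + F⁻¹ := by linarith
  have h4 := mul_le_mul_of_nonneg_left h3 hπ
  rw [Real.negMulLog]
  linarith

lemma condEntropy_nonneg {α β : Type*} [Fintype α] [MeasurableSpace α] [MeasurableSpace β]
    (μ : Measure (α × β)) [IsFiniteMeasure μ] : 0 ≤ condEntropy μ := by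
  refine div_nonneg (integral_nonneg_of_ae ?_) (Real.log_nonneg one_le_two)
  have h : ∀ᵐ y ∂(μ.map Prod.snd), ∀ a,
      ((μ.restrict (Prod.fst ⁻¹' {a})).map Prod.snd).rnDeriv (μ.map Prod.snd) y ≤ 1 := by
    rw [ae_all_iff]
    exact fun a => Measure.rnDeriv_le_one_of_le
      (Measure.map_mono Measure.restrict_le_self measurable_snd)
  filter_upwards [h] with y hy
  refine Finset.sum_nonneg fun a _ => Real.negMulLog_nonneg ENNReal.toReal_nonneg ?_
  exact ENNReal.toReal_le_of_le_ofReal zero_le_one (by simpa using hy a)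

section Equivocation

variable {α β : Type*} [Fintype α] [Nonempty α] [MeasurableSpace α] [MeasurableSingletonClass α]
  [MeasurableSpace β] (P : α → Measure β) [∀ a, IsProbabilityMeasure (P a)]

/-- The joint law of a uniform `W` and of `Y` with law `P a` given `W = a`. -/
def uniformJoint : Measure (α × β) :=
  ∑ a, (Fintype.card α : ℝ≥0∞)⁻¹ • (Measure.dirac a).prod (P a)

instance : IsProbabilityMeasure (uniformJoint P) := by
  refine ⟨?_⟩
  simp only [uniformJoint, Measure.coe_finsetSum, Finset.sum_apply, Measure.smul_apply,
    smul_eq_mul, measure_univ, mul_one, Finset.sum_const, Finset.card_univ, nsmul_eq_mul]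
  exact ENNReal.mul_inv_cancel (by exact_mod_cast Fintype.card_ne_zero) (ENNReal.natCast_ne_top _)

lemma map_restrict_uniformJoint (a : α) :
    ((uniformJoint P).restrict (Prod.fst ⁻¹' {a})).map Prod.snd
      = (Fintype.card α : ℝ≥0∞)⁻¹ • P a := by
  classical
  ext s hs
  rw [Measure.map_apply measurable_snd hs, Measure.restrict_apply (measurable_snd hs)]
  simp only [uniformJoint, Measure.coe_finsetSum, Finset.sum_apply, Measure.smul_apply,
    smul_eq_mul]
  have hset : (Prod.snd ⁻¹' s ∩ Prod.fst ⁻¹' {a} : Set (α × β)) = {a} ×ˢ s := by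
    ext z; simp [and_comm]
  rw [hset, Finset.sum_eq_single a]
  · rw [Measure.prod_prod]; simp
  · intro b _ hb
    rw [Measure.prod_prod]; simp [hb]
  · simp

lemma map_snd_uniformJoint :
    (uniformJoint P).map Prod.snd = ∑ a, (Fintype.card α : ℝ≥0∞)⁻¹ • P a := by
  ext s hs
  rw [Measure.map_apply measurable_snd hs]
  simp only [uniformJoint, Measure.coe_finsetSum, Finset.sum_apply, Measure.smul_apply,
    smul_eq_mul]
  refine Finset.sum_congr rfl fun a _ => ?_
  have hset : (Prod.snd ⁻¹' s : Set (α × β)) = Set.univ ×ˢ s := by ext z; simp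
  rw [hset, Measure.prod_prod]; simp

/-- With `π` the posterior, `m` the output law and `F` its density relative to `Q`, one has `M π F =
dP_a/dQ ≤ f`. Hence `log M` is at most `-log π + log (1 + f) - log F`, and averaging gives the
entropy, the divergence-like term and a remainder. Messages outside `good` need no domination: their
entropy contribution is nonnegative and is kept only for that reason. -/
lemma log_card_le_condEntropy (Q : Measure β) [IsProbabilityMeasure Q] (hPQ : ∀ a, P a ≪ Q)
    (good : Finset α) (f : α → β → ℝ≥0∞) (hf : ∀ a, Measurable (f a)) (hft : ∀ a y, f a y ≠ ∞)
    (hgood : ∀ a ∈ good, P a ≤ Q.withDensity (f a)) :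
    ENNReal.ofReal (good.card * ((Fintype.card α : ℝ)⁻¹ * Real.log (Fintype.card α)))
      ≤ ENNReal.ofReal (condEntropy (uniformJoint P) * Real.log 2) + 1 +
        ∑ a ∈ good, (Fintype.card α : ℝ≥0∞)⁻¹ * ∫⁻ y, f a y * logOneAdd (f a y) ∂Q := by
  classical
  set M := Fintype.card α with hMd
  have hM0 : 0 < M := Fintype.card_pos
  have hMe0 : (M : ℝ≥0∞) ≠ 0 := by exact_mod_cast hM0.ne'
  have hMr : (0 : ℝ) < M := by exact_mod_cast hM0
  have hMet : (M : ℝ≥0∞) ≠ ∞ := ENNReal.natCast_ne_top M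
  set m := ∑ a, (M : ℝ≥0∞)⁻¹ • P a with hm
  have hmapply : ∀ s, m s = ∑ a, (M : ℝ≥0∞)⁻¹ * P a s := by
    intro s
    simp [hm, Measure.coe_finsetSum, Finset.sum_apply]
  have hmprob : IsProbabilityMeasure m := by
    refine ⟨?_⟩
    rw [hmapply]
    simp only [measure_univ, mul_one, Finset.sum_const, Finset.card_univ, ← hMd, nsmul_eq_mul]
    exact ENNReal.mul_inv_cancel hMe0 hMet
  have hfin : ∀ a, IsFiniteMeasure ((M : ℝ≥0∞)⁻¹ • P a) := fun a =>
    Measure.smul_finite _ (ENNReal.inv_ne_top.2 hMe0)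
  have hle : ∀ a, (M : ℝ≥0∞)⁻¹ • P a ≤ m := by
    intro a
    refine Measure.le_iff.2 fun s _ => ?_
    rw [hmapply]
    exact Finset.single_le_sum (f := fun a => (M : ℝ≥0∞)⁻¹ * P a s) (fun _ _ => zero_le)
      (Finset.mem_univ a)
  have hac : ∀ a, (M : ℝ≥0∞)⁻¹ • P a ≪ m := fun a => Measure.absolutelyContinuous_of_le (hle a)
  have hmQ : m ≪ Q := by
    refine Measure.AbsolutelyContinuous.mk fun s _ hs => ?_
    rw [hmapply]
    simp [fun a => hPQ a hs]
  set π : α → β → ℝ≥0∞ := fun a => ((M : ℝ≥0∞)⁻¹ • P a).rnDeriv m with hπ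
  set F : β → ℝ≥0∞ := m.rnDeriv Q with hF
  have hπm : ∀ a, Measurable (π a) := fun a => Measure.measurable_rnDeriv _ _
  have hFm : Measurable F := Measure.measurable_rnDeriv _ _
  have hπle : ∀ᵐ y ∂m, ∀ a, π a y ≤ 1 := by
    rw [ae_all_iff]
    exact fun a => Measure.rnDeriv_le_one_of_le (hle a)
  have hFpos : ∀ᵐ y ∂m, 0 < F y := Measure.rnDeriv_pos hmQ
  have hFtop : ∀ᵐ y ∂m, F y < ∞ := hmQ.ae_le (Measure.rnDeriv_lt_top m Q)
  -- Chain rule for densities: posterior times `dm/dQ` is the density of `M⁻¹ • P a` relative to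
  -- `Q`.
  have hdom : ∀ᵐ y ∂m, ∀ a ∈ good, (M : ℝ≥0∞) * (π a y * F y) ≤ f a y := by
    rw [ae_all_iff]
    intro a
    by_cases ha : a ∈ good
    · have h1 := Measure.rnDeriv_mul_rnDeriv (κ := Q) (hac a)
      have h2 : ((M : ℝ≥0∞)⁻¹ • P a).rnDeriv Q ≤ᵐ[Q] fun y => (M : ℝ≥0∞)⁻¹ * f a y := by
        refine rnDeriv_le_of_le_withDensity ((hac a).trans hmQ) ?_
        have : (fun y => (M : ℝ≥0∞)⁻¹ * f a y) = (M : ℝ≥0∞)⁻¹ • f a := rfl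
        rw [this, withDensity_smul _ (hf a)]
        refine Measure.le_iff.2 fun s _ => ?_
        simp only [Measure.smul_apply, smul_eq_mul]
        gcongr
        exact hgood a ha
      filter_upwards [hmQ.ae_le h1, hmQ.ae_le h2] with y h1 h2 _
      have h3 : π a y * F y ≤ (M : ℝ≥0∞)⁻¹ * f a y := by
        rw [← h1] at h2; exact h2
      calc (M : ℝ≥0∞) * (π a y * F y) ≤ M * ((M : ℝ≥0∞)⁻¹ * f a y) := by gcongr
        _ = f a y := by rw [← mul_assoc, ENNReal.mul_inv_cancel hMe0 hMet, one_mul]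
    · exact ae_of_all _ fun y h => absurd h ha
  have hpost : ∀ a y, posterior (uniformJoint P) a y = (π a y).toReal := by
    intro a y
    rw [_root_.posterior, map_restrict_uniformJoint, map_snd_uniformJoint]
  set ent : β → ℝ := fun y => ∑ a, Real.negMulLog (π a y).toReal with hent
  have hentm : Measurable ent := by
    refine Finset.measurable_fun_sum _ fun a _ => ?_
    exact Real.continuous_negMulLog.measurable.comp (hπm a).ennreal_toReal
  have hent0 : ∀ᵐ y ∂m, 0 ≤ ent y := by
    filter_upwards [hπle] with y hy
    refine Finset.sum_nonneg fun a _ => Real.negMulLog_nonneg ENNReal.toReal_nonneg ?_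
    exact ENNReal.toReal_le_of_le_ofReal zero_le_one (by simpa using hy a)
  have hentint : Integrable ent m := by
    refine Integrable.of_bound hentm.aestronglyMeasurable (C := M) ?_
    filter_upwards [hent0] with y h0
    rw [Real.norm_of_nonneg h0]
    calc ent y ≤ ∑ a : α, (1 : ℝ) := Finset.sum_le_sum fun a _ =>
          (Real.negMulLog_le_one_sub_self ENNReal.toReal_nonneg).trans
            (by linarith [ENNReal.toReal_nonneg (a := π a y)])
      _ = M := by simp [hMd]
  have hH : condEntropy (uniformJoint P) * Real.log 2 = ∫ y, ent y ∂m := by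
    rw [condEntropy, div_mul_cancel₀ _ (Real.log_pos one_lt_two).ne', map_snd_uniformJoint]
    simp_rw [hpost]
    rfl
  rw [hH, ofReal_integral_eq_lintegral_ofReal hentint hent0]
  have hlogM : 0 ≤ Real.log M := Real.log_nonneg (by exact_mod_cast hM0)
  have hpt : ∀ᵐ y ∂m, ∑ a ∈ good, π a y * ENNReal.ofReal (Real.log M)
      ≤ ENNReal.ofReal (ent y) + (∑ a ∈ good, π a y * logOneAdd (f a y) + (F y)⁻¹) := by
    have hsum : ∀ᵐ y ∂m, ∑ a, π a y = 1 := by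
      have h1 : m = m.withDensity fun y => ∑ a, π a y := by
        ext s hs
        rw [withDensity_apply _ hs, lintegral_finsetSum _ fun a _ => hπm a, hmapply]
        refine Finset.sum_congr rfl fun a _ => ?_
        rw [hπ, Measure.setLIntegral_rnDeriv (hac a)]
        rfl
      have h2 := Measure.rnDeriv_withDensity m
        (Finset.measurable_fun_sum Finset.univ fun a _ => hπm a)
      rw [← h1] at h2
      filter_upwards [h2, Measure.rnDeriv_self m] with y h2 h3
      rw [← h2, h3]
    filter_upwards [hπle, hFpos, hFtop, hdom, hsum] with y h1 h2 h3 h4 h5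
    have hπr : ∀ a, π a y = ENNReal.ofReal (π a y).toReal := fun a =>
      (ENNReal.ofReal_toReal (ne_top_of_le_ne_top ENNReal.one_ne_top (h1 a))).symm
    have hFr : (F y)⁻¹ = ENNReal.ofReal (F y).toReal⁻¹ := by
      rw [ENNReal.ofReal_inv_of_pos (ENNReal.toReal_pos h2.ne' h3.ne), ENNReal.ofReal_toReal h3.ne]
    have hF0 : 0 < (F y).toReal := ENNReal.toReal_pos h2.ne' h3.ne
    have hneg : ∀ a, 0 ≤ Real.negMulLog (π a y).toReal := fun a =>
      Real.negMulLog_nonneg ENNReal.toReal_nonneg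
        (ENNReal.toReal_le_of_le_ofReal zero_le_one (by simpa using h1 a))
    have key : ∀ a ∈ good, π a y * ENNReal.ofReal (Real.log M)
        ≤ ENNReal.ofReal (Real.negMulLog (π a y).toReal) + π a y * logOneAdd (f a y)
          + π a y * (F y)⁻¹ := by
      intro a ha
      have hlog0 : 0 ≤ Real.log (1 + (f a y).toReal) :=
        Real.log_nonneg (by linarith [ENNReal.toReal_nonneg (a := f a y)])
      have h6 : (M : ℝ) * ((π a y).toReal * (F y).toReal) ≤ (f a y).toReal := by
        have := ENNReal.toReal_mono (hft a y) (h4 a ha)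
        simpa [ENNReal.toReal_mul] using this
      have h7 := mul_log_le_negMulLog_add (ENNReal.toReal_nonneg (a := π a y)) hF0 hMr h6
      have hp := ENNReal.toReal_nonneg (a := π a y)
      rw [hFr, hπr a, logOneAdd, ENNReal.toReal_ofReal hp, ← ENNReal.ofReal_mul hp,
        ← ENNReal.ofReal_mul hp, ← ENNReal.ofReal_mul hp, ← ENNReal.ofReal_add (hneg a)
        (mul_nonneg hp hlog0), ← ENNReal.ofReal_add (add_nonneg (hneg a) (mul_nonneg hp hlog0))
        (mul_nonneg hp (inv_nonneg.2 hF0.le))]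
      exact ENNReal.ofReal_le_ofReal h7
    refine (Finset.sum_le_sum key).trans ?_
    rw [Finset.sum_add_distrib, Finset.sum_add_distrib, add_assoc]
    gcongr ?_ + (_ + ?_)
    · rw [← ENNReal.ofReal_sum_of_nonneg fun a _ => hneg a]
      exact ENNReal.ofReal_le_ofReal
        (Finset.sum_le_sum_of_subset_of_nonneg (Finset.subset_univ _) fun a _ _ => hneg a)
    · rw [← Finset.sum_mul]
      refine (mul_le_mul_left ?_ _).trans (one_mul _).le
      rw [← h5]
      exact Finset.sum_le_sum_of_subset (Finset.subset_univ _)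
  have hinteg := lintegral_mono_ae hpt
  have hπint : ∀ (a : α) {h : β → ℝ≥0∞}, Measurable h →
      ∫⁻ y, π a y * h y ∂m = (M : ℝ≥0∞)⁻¹ * ∫⁻ y, h y ∂(P a) := by
    intro a h hh
    have h1 := lintegral_withDensity_eq_lintegral_mul m (hπm a) hh
    rw [hπ, Measure.withDensity_rnDeriv_eq _ _ (hac a), lintegral_smul_measure] at h1
    rw [← smul_eq_mul, h1]
    rfl
  have hlm : ∀ a, Measurable fun y => logOneAdd (f a y) := fun a => measurable_logOneAdd.comp (hf a)
  have hL : ∫⁻ y, ∑ a ∈ good, π a y * ENNReal.ofReal (Real.log M) ∂m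
      = ENNReal.ofReal (good.card * ((M : ℝ)⁻¹ * Real.log M)) := by
    rw [lintegral_finsetSum _ fun a _ => (hπm a).mul_const _]
    simp_rw [fun a => hπint a (measurable_const (a := ENNReal.ofReal (Real.log M)))]
    simp only [lintegral_const, measure_univ, mul_one, Finset.sum_const, nsmul_eq_mul]
    rw [ENNReal.ofReal_mul (by positivity), ENNReal.ofReal_natCast, ENNReal.ofReal_mul
      (by positivity), ENNReal.ofReal_inv_of_pos hMr, ENNReal.ofReal_natCast]
  rw [hL, lintegral_add_left hentm.ennreal_ofReal, lintegral_add_left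
    (Finset.measurable_fun_sum _ fun a _ => (hπm a).fun_mul (hlm a)),
    lintegral_finsetSum _ fun a _ => (hπm a).fun_mul (hlm a)] at hinteg
  refine hinteg.trans ?_
  rw [add_assoc, add_comm (1 : ℝ≥0∞)]
  gcongr with a ha
  · rw [hπint a (hlm a)]
    refine mul_le_mul_right ?_ _
    have h1 := lintegral_mono' (hgood a ha) (le_refl fun y => logOneAdd (f a y))
    rw [lintegral_withDensity_eq_lintegral_mul _ (hf a) (hlm a)] at h1
    exact h1
  -- The mean of `1 / F` under `m` is the `Q`-mass of the set where `F` is neither zero nor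
  -- infinite, hence at most one; this is the additive `1` of the bound.
  · have h1 := lintegral_withDensity_eq_lintegral_mul Q hFm hFm.inv
    rw [hF, Measure.withDensity_rnDeriv_eq _ _ hmQ] at h1
    rw [hF]
    refine (le_of_eq h1).trans ?_
    calc _ ≤ ∫⁻ _, (1 : ℝ≥0∞) ∂Q := lintegral_mono fun y => ENNReal.mul_inv_le_one _
      _ = 1 := by simp

end Equivocation

/-! ### Output laws of the channel -/

lemma pi_prod_map {κ : Type*} [Fintype κ] (μ ν : κ → Measure ℝ) [∀ k, IsProbabilityMeasure (μ k)]
    [∀ k, IsProbabilityMeasure (ν k)] {h : ℝ → ℝ → ℝ} (hh : Measurable fun z : ℝ × ℝ => h z.1 z.2) :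
    ((Measure.pi μ).prod (Measure.pi ν)).map (fun z k => h (z.1 k) (z.2 k))
      = Measure.pi fun k => ((μ k).prod (ν k)).map fun z => h z.1 z.2 := by
  rw [← (measurePreserving_arrowProdEquivProdArrow ℝ ℝ κ μ ν).map_eq]
  have hm : Measurable fun (z : (κ → ℝ) × (κ → ℝ)) k => h (z.1 k) (z.2 k) :=
    measurable_pi_lambda _ fun k =>
      Measurable.comp (g := fun z : ℝ × ℝ => h z.1 z.2) hh
        (f := fun z : (κ → ℝ) × (κ → ℝ) => (z.1 k, z.2 k)) (by fun_prop)
  rw [Measure.map_map hm (MeasurableEquiv.measurable _)]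
  have : ∀ k, SigmaFinite (((μ k).prod (ν k)).map fun z => h z.1 z.2) := fun k => by
    have := Measure.isProbabilityMeasure_map (μ := (μ k).prod (ν k)) hh.aemeasurable
    infer_instance
  exact (Measure.pi_map_pi (f := fun _ (z : ℝ × ℝ) => h z.1 z.2) fun k => hh.aemeasurable)

lemma pi_gaussianReal_mul_add {κ : Type*} [Fintype κ] (a : ℝ) (m₁ m₂ : κ → ℝ) (u₁ u₂ : κ → ℝ≥0) :
    ((Measure.pi fun k => gaussianReal (m₁ k) (u₁ k)).prod
        (Measure.pi fun k => gaussianReal (m₂ k) (u₂ k))).map (fun z k => a * z.1 k + z.2 k)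
      = Measure.pi fun k => gaussianReal (a * m₁ k + m₂ k) (‖a‖₊ ^ 2 * u₁ k + u₂ k) := by
  rw [pi_prod_map _ _ (h := fun x y => a * x + y) (by fun_prop)]
  simp_rw [map_mul_add_gaussianReal_prod]

namespace GaussianICEE

variable {G : GaussianICEE} {n : ℕ}

/-- The law of the word at output `r` when the two input words have laws `μ₀`, `μ₁`. -/
def outLaw (G : GaussianICEE) (r : Fin 3) (μ₀ μ₁ : Measure (Fin n → ℝ)) : Measure (Fin n → ℝ) :=
  (μ₀.prod (μ₁.prod (Measure.pi fun _ : Fin n => gaussianReal 0 1))).map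
    fun ω t => G.gain r 0 * ω.1 t + (G.gain r 1 * ω.2.1 t + ω.2.2 t)

lemma measurable_outWord (G : GaussianICEE) (r : Fin 3) :
    Measurable fun (ω : (Fin n → ℝ) × (Fin n → ℝ) × (Fin n → ℝ)) (t : Fin n) =>
      G.gain r 0 * ω.1 t + (G.gain r 1 * ω.2.1 t + ω.2.2 t) := by
  fun_prop

instance (r : Fin 3) (μ₀ μ₁ : Measure (Fin n → ℝ)) [IsProbabilityMeasure μ₀]
    [IsProbabilityMeasure μ₁] : IsProbabilityMeasure (G.outLaw r μ₀ μ₁) :=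
  Measure.isProbabilityMeasure_map (G.measurable_outWord r).aemeasurable

lemma lintegral_outLaw (r : Fin 3) (μ₀ μ₁ : Measure (Fin n → ℝ)) [SFinite μ₀] [SFinite μ₁]
    {F : (Fin n → ℝ) → ℝ≥0∞} (hF : Measurable F) :
    ∫⁻ y, F y ∂G.outLaw r μ₀ μ₁ = ∫⁻ x₀, ∫⁻ x₁, ∫⁻ z,
      F (fun t => G.gain r 0 * x₀ t + (G.gain r 1 * x₁ t + z t))
        ∂(Measure.pi fun _ : Fin n => gaussianReal 0 1) ∂μ₁ ∂μ₀ := by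
  have hm : Measurable fun (ω : (Fin n → ℝ) × (Fin n → ℝ) × (Fin n → ℝ)) => F fun t =>
      G.gain r 0 * ω.1 t + (G.gain r 1 * ω.2.1 t + ω.2.2 t) := hF.comp (G.measurable_outWord r)
  rw [outLaw, lintegral_map hF (G.measurable_outWord r), lintegral_prod _ hm.aemeasurable]
  refine lintegral_congr fun x₀ => ?_
  rw [lintegral_prod]
  exact (hm.comp (measurable_const.prodMk measurable_id)).aemeasurable

/-- The word at output `r` uses only the `r`-th noise component in each letter, which is standard
normal, so the joint noise law can be replaced by white Gaussian noise. -/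
lemma SecretCode.outputLawAt_eq {M : Fin 2 → ℕ} (c : G.SecretCode n M) (r : Fin 3)
    (w : (k : Fin 2) → Fin (M k)) :
    c.outputLawAt r w = G.outLaw r (c.enc 0 (w 0)) (c.enc 1 (w 1)) := by
  have h0 := c.enc_prob 0 (w 0)
  have h1 := c.enc_prob 1 (w 1)
  have hpi : (Measure.pi fun _ : Fin n => gaussianReal 0 1)
      = (Measure.pi fun _ : Fin n => G.noise).map fun z t => z t r := by
    have : ∀ _ : Fin n, SigmaFinite (G.noise.map fun z => z r) := fun _ => by
      rw [G.noise_marginal]; infer_instance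
    have h := Measure.pi_map_pi (ι := Fin n) (μ := fun _ => G.noise) (f := fun _ z => z r)
      fun _ => (measurable_pi_apply r).aemeasurable
    rw [h]
    simp_rw [G.noise_marginal]
  have hout : Measurable fun (ω : (Fin n → ℝ) × (Fin n → ℝ) × (Fin n → Fin 3 → ℝ)) (t : Fin n) =>
      G.output ![ω.1 t, ω.2.1 t] (ω.2.2 t) := by
    unfold output
    refine measurable_pi_lambda _ fun t => measurable_pi_lambda _ fun r => ?_
    simp only [Matrix.cons_val_zero, Matrix.cons_val_one]
    fun_prop
  have hz : Measurable fun (z : Fin n → Fin 3 → ℝ) t => z t r := by fun_prop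
  rw [outputLawAt, outputLaw, Measure.map_map (by fun_prop) hout, outLaw, hpi]
  have h2 : (c.enc 0 (w 0)).prod ((c.enc 1 (w 1)).prod
      ((Measure.pi fun _ : Fin n => G.noise).map fun z t => z t r))
      = ((c.enc 0 (w 0)).prod ((c.enc 1 (w 1)).prod (Measure.pi fun _ : Fin n => G.noise))).map
        (Prod.map id (Prod.map id fun z t => z t r)) := by
    rw [← Measure.map_prod_map _ _ measurable_id (measurable_id.prodMap hz),
      ← Measure.map_prod_map _ _ measurable_id hz, Measure.map_id, Measure.map_id]
  rw [h2, Measure.map_map (G.measurable_outWord r)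
    (measurable_id.prodMap (measurable_id.prodMap hz))]
  congr 1
  ext ω t
  simp [output]
  ring

/-- The output law is bilinear and monotone in the two input laws, so domination of each input
multiplies. -/
lemma outLaw_le (r : Fin 3) {μ₀ μ₁ ν₀ ν₁ : Measure (Fin n → ℝ)} [IsFiniteMeasure μ₀]
    [IsFiniteMeasure μ₁] [IsFiniteMeasure ν₀] [IsFiniteMeasure ν₁] {c₀ c₁ : ℝ≥0∞}
    (h₀ : μ₀ ≤ c₀ • ν₀) (h₁ : μ₁ ≤ c₁ • ν₁) :
    G.outLaw r μ₀ μ₁ ≤ (c₀ * c₁) • G.outLaw r ν₀ ν₁ := by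
  refine Measure.le_iff.2 fun s hs => ?_
  have hF : Measurable (s.indicator (1 : (Fin n → ℝ) → ℝ≥0∞)) := measurable_one.indicator hs
  rw [Measure.smul_apply, ← lintegral_indicator_one hs, ← lintegral_indicator_one hs,
    lintegral_outLaw r _ _ hF, lintegral_outLaw r _ _ hF, smul_eq_mul, mul_assoc]
  have hm : Measurable fun x : (Fin n → ℝ) × (Fin n → ℝ) => ∫⁻ z, s.indicator 1
      (fun t => G.gain r 0 * x.1 t + (G.gain r 1 * x.2 t + z t))
        ∂(Measure.pi fun _ : Fin n => gaussianReal 0 1) := by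
    refine Measurable.lintegral_prod_right' (f := fun x : ((Fin n → ℝ) × (Fin n → ℝ)) × (Fin n → ℝ) =>
      s.indicator 1 (fun t => G.gain r 0 * x.1.1 t + (G.gain r 1 * x.1.2 t + x.2 t))) ?_
    exact hF.comp (by fun_prop)
  refine (lintegral_mono' h₀ le_rfl).trans ?_
  rw [lintegral_smul_measure, smul_eq_mul]
  refine mul_le_mul_right ?_ _
  rw [← lintegral_const_mul _ hm.lintegral_prod_right']
  refine lintegral_mono fun x₀ => ?_
  refine (lintegral_mono' h₁ le_rfl).trans ?_
  rw [lintegral_smul_measure, smul_eq_mul]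

lemma outLaw_absolutelyContinuous (r : Fin 3) (μ₀ μ₁ : Measure (Fin n → ℝ))
    [IsProbabilityMeasure μ₀] [IsProbabilityMeasure μ₁] : G.outLaw r μ₀ μ₁ ≪ volume := by
  refine Measure.AbsolutelyContinuous.mk fun s hs h0 => ?_
  have hF : Measurable (s.indicator (1 : (Fin n → ℝ) → ℝ≥0∞)) := measurable_one.indicator hs
  rw [← lintegral_indicator_one hs, lintegral_outLaw r _ _ hF]
  have h1 : ∀ x₀ x₁ : Fin n → ℝ, ∫⁻ z, s.indicator 1
      (fun t => G.gain r 0 * x₀ t + (G.gain r 1 * x₁ t + z t))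
        ∂(Measure.pi fun _ : Fin n => gaussianReal 0 1) = 0 := by
    intro x₀ x₁
    have hw := withDensity_dens (ι := Fin 0) (κ := Fin n) (fun _ => 0) (fun _ _ => 0)
      (v := fun _ => 1) (fun _ => one_ne_zero) ∅ (fun _ _ => 0)
    have hac : (Measure.pi fun _ : Fin n => gaussianReal 0 1) ≪ (volume : Measure (Fin n → ℝ)) := by
      have : (Measure.pi fun k : Fin n => gaussianReal (outMean (fun _ : Fin 0 => (0 : ℝ)) ∅
          fun _ => 0) (outVar (fun _ : Fin 0 => (0 : ℝ)) (fun _ => 0) 1 ∅))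
          = Measure.pi fun _ : Fin n => gaussianReal 0 1 := by
        simp [outMean, outVar]
      rw [← this, ← hw]
      exact withDensity_absolutelyContinuous _ _
    have hv : (volume : Measure (Fin n → ℝ)) ((fun z t => G.gain r 0 * x₀ t +
        (G.gain r 1 * x₁ t + z t)) ⁻¹' s) = 0 := by
      have he : (fun (z : Fin n → ℝ) t => G.gain r 0 * x₀ t + (G.gain r 1 * x₁ t + z t))
          = fun z => (fun t => G.gain r 0 * x₀ t + G.gain r 1 * x₁ t) + z := by
        ext z t; simp; ring
      rw [he, measure_preimage_add, h0]
    have hms : Measurable fun (z : Fin n → ℝ) t =>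
      G.gain r 0 * x₀ t + (G.gain r 1 * x₁ t + z t) := by fun_prop
    have := hac hv
    rw [← lintegral_indicator_one (hms hs)] at this
    rw [← this]
    rfl
  simp [h1]

lemma outLaw_smul_sum {ι : Type*} [Fintype ι] (r : Fin 3) (c₀ c₁ : ℝ≥0∞)
    (a b : ι → Measure (Fin n → ℝ)) [∀ j, IsFiniteMeasure (a j)] [∀ j, IsFiniteMeasure (b j)] :
    G.outLaw r (c₀ • ∑ j, a j) (c₁ • ∑ j, b j)
      = (c₀ * c₁) • ∑ z : ι × ι, G.outLaw r (a z.1) (b z.2) := by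
  refine Measure.ext_of_lintegral _ fun F hF => ?_
  rw [lintegral_outLaw r _ _ hF, lintegral_smul_measure, lintegral_smul_measure,
    lintegral_finsetSum_measure, lintegral_finsetSum_measure, smul_eq_mul, smul_eq_mul, mul_assoc]
  congr 1
  have hm : Measurable fun x : (Fin n → ℝ) × (Fin n → ℝ) => ∫⁻ z, F
      (fun t => G.gain r 0 * x.1 t + (G.gain r 1 * x.2 t + z t))
        ∂(Measure.pi fun _ : Fin n => gaussianReal 0 1) := by
    refine Measurable.lintegral_prod_right' (f := fun x : ((Fin n → ℝ) × (Fin n → ℝ)) × (Fin n → ℝ) =>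
      F (fun t => G.gain r 0 * x.1.1 t + (G.gain r 1 * x.1.2 t + x.2 t))) ?_
    exact hF.comp (by fun_prop)
  have hmj : ∀ j, Measurable fun x₀ : Fin n → ℝ => ∫⁻ x₁, ∫⁻ z, F
      (fun t => G.gain r 0 * x₀ t + (G.gain r 1 * x₁ t + z t))
        ∂(Measure.pi fun _ : Fin n => gaussianReal 0 1) ∂(b j) := fun j => hm.lintegral_prod_right'
  simp_rw [lintegral_smul_measure, lintegral_finsetSum_measure, smul_eq_mul]
  rw [Fintype.sum_prod_type, Finset.mul_sum]
  refine Finset.sum_congr rfl fun j _ => ?_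
  rw [lintegral_const_mul _ (Finset.measurable_fun_sum _ fun j _ => hmj j),
    lintegral_finsetSum _ fun j _ => hmj j]
  congr 1
  exact Finset.sum_congr rfl fun j' _ => (lintegral_outLaw r _ _ hF).symm

lemma outLaw_gaussian (r : Fin 3) (m₀ m₁ : Fin n → ℝ) (u₀ u₁ : Fin n → ℝ≥0) :
    G.outLaw r (Measure.pi fun t => gaussianReal (m₀ t) (u₀ t))
        (Measure.pi fun t => gaussianReal (m₁ t) (u₁ t))
      = Measure.pi fun t => gaussianReal (G.gain r 0 * m₀ t + G.gain r 1 * m₁ t)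
          (‖G.gain r 0‖₊ ^ 2 * u₀ t + (‖G.gain r 1‖₊ ^ 2 * u₁ t + 1)) := by
  have h0 : (fun (ω : (Fin n → ℝ) × (Fin n → ℝ) × (Fin n → ℝ)) (t : Fin n) =>
      G.gain r 0 * ω.1 t + (G.gain r 1 * ω.2.1 t + ω.2.2 t))
      = (fun (z : (Fin n → ℝ) × (Fin n → ℝ)) t => G.gain r 0 * z.1 t + z.2 t) ∘
        (Prod.map id fun (z : (Fin n → ℝ) × (Fin n → ℝ)) t => G.gain r 1 * z.1 t + z.2 t) := rfl
  rw [outLaw, h0, ← Measure.map_map (by fun_prop) (by fun_prop),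
    ← Measure.map_prod_map _ _ (by fun_prop) (by fun_prop), Measure.map_id,
    pi_gaussianReal_mul_add, pi_gaussianReal_mul_add]
  simp

end GaussianICEE

/-! ### From codes with power constraint in the mean to secret codes -/

lemma logOneAdd_four_mul_le (z : ℝ≥0∞) :
    logOneAdd (4 * z) ≤ ENNReal.ofReal (Real.log 4) + logOneAdd z := by
  have h0 := ENNReal.toReal_nonneg (a := z)
  rw [logOneAdd, logOneAdd, ← ENNReal.ofReal_add (Real.log_nonneg (by norm_num))
    (Real.log_nonneg (by linarith)), ← Real.log_mul (by norm_num) (by linarith)]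
  refine ENNReal.ofReal_le_ofReal (Real.log_le_log ?_ ?_)
  · positivity
  · rw [ENNReal.toReal_mul]
    have : (4 : ℝ≥0∞).toReal = 4 := by simp
    rw [this]
    linarith

namespace GaussianICEE

variable {G : GaussianICEE} {n : ℕ} {M : Fin 2 → ℕ}

/-- The words that meet the power constraint of user `k`. -/
def powerBall (G : GaussianICEE) (n : ℕ) (k : Fin 2) : Set (Fin n → ℝ) :=
  {x | (1 / (n : ℝ)) * ∑ t, x t ^ 2 ≤ G.P k}

lemma measurableSet_powerBall (G : GaussianICEE) (n : ℕ) (k : Fin 2) :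
    MeasurableSet (G.powerBall n k) := by
  unfold powerBall
  exact measurableSet_le (by fun_prop) measurable_const

open Classical in
/-- A random word, conditioned on meeting the power constraint if that is likely. -/
def truncate (G : GaussianICEE) (k : Fin 2) (μ : Measure (Fin n → ℝ)) : Measure (Fin n → ℝ) :=
  if μ (G.powerBall n k)ᶜ ≤ 2⁻¹ then ProbabilityTheory.cond μ (G.powerBall n k)
  else Measure.dirac 0

section Truncate

variable (k : Fin 2) (μ : Measure (Fin n → ℝ)) [IsProbabilityMeasure μ]

lemma inv_two_le_powerBall (h : μ (G.powerBall n k)ᶜ ≤ 2⁻¹) : 2⁻¹ ≤ μ (G.powerBall n k) := by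
  have h1 := prob_add_prob_compl (μ := μ) (G.measurableSet_powerBall n k)
  have h2 : (2⁻¹ : ℝ≥0∞) + 2⁻¹ = 1 := ENNReal.inv_two_add_inv_two
  by_contra! h3
  have := ENNReal.add_lt_add_of_lt_of_le (by simp) h3 h
  rw [h1, h2] at this
  exact lt_irrefl _ this

instance : IsProbabilityMeasure (G.truncate k μ) := by
  unfold truncate
  split_ifs with h
  · refine cond_isProbabilityMeasure ?_
    intro h0
    have := inv_two_le_powerBall k μ h
    rw [h0] at this
    simp at this
  · infer_instance

lemma truncate_power : ∀ᵐ x ∂(G.truncate k μ), (1 / (n : ℝ)) * ∑ t, x t ^ 2 ≤ G.P k := by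
  unfold truncate
  split_ifs with h
  · exact ae_cond_mem (G.measurableSet_powerBall n k)
  · rw [ae_dirac_iff]
    · simp
    · exact G.measurableSet_powerBall n k

/-- Conditioning on an event of probability at least one half at most doubles the law. -/
lemma truncate_le (h : μ (G.powerBall n k)ᶜ ≤ 2⁻¹) : G.truncate k μ ≤ (2 : ℝ≥0∞) • μ := by
  rw [truncate, if_pos h, ProbabilityTheory.cond]
  refine Measure.le_iff.2 fun s _ => ?_
  simp only [Measure.smul_apply, smul_eq_mul]
  refine mul_le_mul' ?_ (Measure.restrict_apply_le _ _)
  rw [ENNReal.inv_le_iff_inv_le]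
  exact inv_two_le_powerBall k μ h

end Truncate

lemma card_messages (M : Fin 2 → ℕ) :
    Fintype.card ((k : Fin 2) → Fin (M k)) = M 0 * M 1 := by
  simp [Fintype.card_pi, Fin.prod_univ_two]

lemma SecretCode.eveJointLaw_eq (c : G.SecretCode n M) :
    c.eveJointLaw = uniformJoint (c.outputLawAt 2) := by
  rw [eveJointLaw, uniformJoint, card_messages]
  push_cast
  rfl

/-- The probability that the word sent for message pair `w` violates a power constraint. -/
def violation (enc : (k : Fin 2) → Fin (M k) → Measure (Fin n → ℝ)) (G : GaussianICEE)
    (w : (k : Fin 2) → Fin (M k)) : ℝ≥0∞ :=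
  ∑ k, enc k (w k) (G.powerBall n k)ᶜ

/-- Enforces the almost sure power constraint. For message pairs with violation probability at most
one half, both truncated inputs are at most doubled, so the output law grows by at most the factor
`4`. By Markov's inequality the other pairs are a fraction of at most `2 * e`. This gives error `4 *
e + 2 * e`, the loss `1 - 2 * e` in the entropy bound, and the term `log 4` from the enlarged
density. -/
lemma exists_secretCode (hM : ∀ k, 0 < M k)
    (enc : (k : Fin 2) → Fin (M k) → Measure (Fin n → ℝ))
    (henc : ∀ k w, IsProbabilityMeasure (enc k w))
    (dec : (k : Fin 2) → (Fin n → ℝ) → Fin (M k)) (hdec : ∀ k, Measurable (dec k))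
    (f : ((k : Fin 2) → Fin (M k)) → (Fin n → ℝ) → ℝ≥0∞) (hf : ∀ w, Measurable (f w))
    (hft : ∀ w y, f w y ≠ ∞)
    (hfout : ∀ w, G.outLaw 2 (enc 0 (w 0)) (enc 1 (w 1)) = volume.withDensity (f w))
    (q : (Fin n → ℝ) → ℝ≥0∞) (hq : Measurable q) (hq0 : ∀ y, q y ≠ 0) (hqt : ∀ y, q y ≠ ∞)
    (hq1 : ∫⁻ y, q y = 1) (e l : ℝ≥0)
    (herr : ∀ k : Fin 2, ∑ w : (k : Fin 2) → Fin (M k),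
      G.outLaw k.castSucc (enc 0 (w 0)) (enc 1 (w 1)) {y | dec k y ≠ w k}
        ≤ (M 0 * M 1 : ℕ) * (e : ℝ≥0∞))
    (hvio : ∑ w, violation enc G w ≤ (M 0 * M 1 : ℕ) * (e : ℝ≥0∞))
    (hleak : ∑ w, ∫⁻ y, f w y * logOneAdd (f w y / q y) ≤ (M 0 * M 1 : ℕ) * (l : ℝ≥0∞)) :
    ∃ c : G.SecretCode n M, (∀ k, c.errorProb k ≤ 6 * e) ∧
      (1 - 2 * e) * Real.log (M 0 * M 1 : ℕ)
        ≤ condEntropy c.eveJointLaw * Real.log 2 + (1 + 4 * Real.log 4 + 4 * l) := by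
  classical
  have hMM : 0 < M 0 * M 1 := Nat.mul_pos (hM 0) (hM 1)
  have hMr : (0 : ℝ) < (M 0 * M 1 : ℕ) := by exact_mod_cast hMM
  have hMe0 : ((M 0 * M 1 : ℕ) : ℝ≥0∞) ≠ 0 := by exact_mod_cast hMM.ne'
  have hMet : ((M 0 * M 1 : ℕ) : ℝ≥0∞) ≠ ∞ := ENNReal.natCast_ne_top _
  have : ∀ k, Nonempty (Fin (M k)) := fun k => ⟨⟨0, hM k⟩⟩
  let c : G.SecretCode n M :=
    { enc := fun k w => G.truncate k (enc k w)
      enc_prob := fun k w => inferInstance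
      power := fun k w => truncate_power k (enc k w)
      dec := dec
      dec_meas := hdec }
  set good : Finset ((k : Fin 2) → Fin (M k)) :=
    Finset.univ.filter fun w => violation enc G w ≤ 2⁻¹ with hgood
  have hle : ∀ w ∈ good, ∀ r, c.outputLawAt r w
      ≤ (4 : ℝ≥0∞) • G.outLaw r (enc 0 (w 0)) (enc 1 (w 1)) := by
    intro w hw r
    have hw' : violation enc G w ≤ 2⁻¹ := (Finset.mem_filter.1 hw).2
    have hk : ∀ k, enc k (w k) (G.powerBall n k)ᶜ ≤ 2⁻¹ := fun k =>
      (Finset.single_le_sum (f := fun k => enc k (w k) (G.powerBall n k)ᶜ)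
        (fun _ _ => zero_le) (Finset.mem_univ k)).trans hw'
    have h4 : (4 : ℝ≥0∞) = 2 * 2 := by norm_num
    rw [c.outputLawAt_eq, h4]
    exact outLaw_le r (truncate_le 0 (enc 0 (w 0)) (hk 0)) (truncate_le 1 (enc 1 (w 1)) (hk 1))
  have hbad : ∀ w ∉ good, 1 ≤ 2 * violation enc G w := by
    intro w hw
    have hw' : ¬ violation enc G w ≤ 2⁻¹ := fun h => hw (Finset.mem_filter.2 ⟨Finset.mem_univ _, h⟩)
    push Not at hw'
    calc (1 : ℝ≥0∞) = 2 * 2⁻¹ := (ENNReal.mul_inv_cancel (by simp) (by simp)).symm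
      _ ≤ _ := by gcongr
  have hprob : ∀ r w, IsProbabilityMeasure (c.outputLawAt r w) := by
    intro r w
    rw [c.outputLawAt_eq]
    have h0 := c.enc_prob 0 (w 0)
    have h1 := c.enc_prob 1 (w 1)
    infer_instance
  refine ⟨c, fun k => ?_, ?_⟩
  · have h1 : ∑ w, c.outputLawAt k.castSucc w {y | c.dec k y ≠ w k}
        ≤ (M 0 * M 1 : ℕ) * ((6 * e : ℝ≥0) : ℝ≥0∞) := by
      calc _ ≤ ∑ w : (k : Fin 2) → Fin (M k),
            (4 * G.outLaw k.castSucc (enc 0 (w 0)) (enc 1 (w 1)) {y | dec k y ≠ w k}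
              + 2 * violation enc G w) := by
            refine Finset.sum_le_sum fun w _ => ?_
            by_cases hw : w ∈ good
            · refine le_add_right ?_
              exact hle w hw k.castSucc {y | dec k y ≠ w k}
            · exact le_add_left (prob_le_one.trans (hbad w hw))
        _ ≤ 4 * ((M 0 * M 1 : ℕ) * (e : ℝ≥0∞)) + 2 * ((M 0 * M 1 : ℕ) * (e : ℝ≥0∞)) := by
            rw [Finset.sum_add_distrib, ← Finset.mul_sum, ← Finset.mul_sum]
            gcongr
            exact herr k
        _ = _ := by push_cast; ring
    have h2 : ∑ w, (c.outputLawAt k.castSucc w).real {y | c.dec k y ≠ w k}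
        ≤ (M 0 * M 1 : ℕ) * (6 * e) := by
      have h3 := ENNReal.toReal_mono (ENNReal.mul_ne_top hMet ENNReal.coe_ne_top) h1
      rw [ENNReal.toReal_sum fun w _ => measure_ne_top _ _] at h3
      simpa [Measure.real, ENNReal.toReal_mul] using h3
    rw [SecretCode.errorProb, one_div, ← div_eq_inv_mul, div_le_iff₀ (by exact_mod_cast hMr)]
    push_cast at h2
    linarith
  · set Q : Measure (Fin n → ℝ) := volume.withDensity q with hQ
    have hQp : IsProbabilityMeasure Q := ⟨by rw [hQ, withDensity_apply _ MeasurableSet.univ]; simpa⟩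
    have hvQ : (volume : Measure (Fin n → ℝ)) ≪ Q :=
      withDensity_absolutelyContinuous' hq.aemeasurable (ae_of_all _ hq0)
    have hPQ : ∀ w, c.outputLawAt 2 w ≪ Q := fun w => by
      rw [c.outputLawAt_eq]
      have h0 := c.enc_prob 0 (w 0)
      have h1 := c.enc_prob 1 (w 1)
      exact (outLaw_absolutelyContinuous 2 _ _).trans hvQ
    have hdivm : ∀ w, Measurable fun y => f w y / q y := fun w => (hf w).div hq
    have hdivt : ∀ w y, f w y / q y ≠ ∞ := fun w y => ENNReal.div_ne_top (hft w y) (hq0 y)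
    have hg : ∀ w ∈ good, c.outputLawAt 2 w ≤ Q.withDensity fun y => 4 * (f w y / q y) := by
      intro w hw
      refine (hle w hw 2).trans (le_of_eq ?_)
      rw [hfout, hQ, ← withDensity_mul _ hq ((hdivm w).const_mul _), ← withDensity_smul _ (hf w)]
      congr 1
      ext y
      simp only [Pi.smul_apply, Pi.mul_apply, smul_eq_mul]
      rw [mul_left_comm, ENNReal.mul_div_cancel (hq0 y) (hqt y)]
    have hmain := log_card_le_condEntropy (c.outputLawAt 2) Q hPQ good _
      (fun w => (hdivm w).const_mul 4) (fun w y => ENNReal.mul_ne_top (by simp) (hdivt w y)) hg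
    rw [← c.eveJointLaw_eq, card_messages] at hmain
    have hfint : ∀ w, ∫⁻ y, f w y = 1 := by
      intro w
      have h1 := henc 0 (w 0)
      have h2 := henc 1 (w 1)
      have h : (G.outLaw 2 (enc 0 (w 0)) (enc 1 (w 1))) Set.univ = 1 := measure_univ
      rw [hfout, withDensity_apply _ MeasurableSet.univ] at h
      simpa using h
    have hlog4 : 0 ≤ Real.log 4 := Real.log_nonneg (by norm_num)
    have hterm : ∀ w, ∫⁻ y, 4 * (f w y / q y) * logOneAdd (4 * (f w y / q y)) ∂Q
        ≤ 4 * ENNReal.ofReal (Real.log 4) + 4 * ∫⁻ y, f w y * logOneAdd (f w y / q y) := by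
      intro w
      have hm1 : Measurable fun y => f w y * logOneAdd (f w y / q y) :=
        (hf w).mul (measurable_logOneAdd.comp (hdivm w))
      have hm2 : Measurable fun y => 4 * (f w y / q y) * logOneAdd (4 * (f w y / q y)) :=
        ((hdivm w).const_mul 4).mul (measurable_logOneAdd.comp ((hdivm w).const_mul 4))
      rw [hQ, lintegral_withDensity_eq_lintegral_mul _ hq
        hm2]
      calc _ ≤ ∫⁻ y, (4 * ENNReal.ofReal (Real.log 4) * f w y
              + 4 * (f w y * logOneAdd (f w y / q y))) := by
            refine lintegral_mono fun y => ?_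
            simp only [Pi.mul_apply, Function.comp]
            have hc : q y * (4 * (f w y / q y) * logOneAdd (4 * (f w y / q y)))
                = 4 * f w y * logOneAdd (4 * (f w y / q y)) := by
              rw [← mul_assoc, mul_left_comm (q y), ENNReal.mul_div_cancel (hq0 y) (hqt y)]
            rw [hc]
            refine (mul_le_mul_right (logOneAdd_four_mul_le _) _).trans (le_of_eq ?_)
            ring
        _ = _ := by
            rw [lintegral_add_left ((hf w).const_mul _), lintegral_const_mul _ (hf w), hfint,
              lintegral_const_mul _ hm1, mul_one]
    have hinv : ((M 0 * M 1 : ℕ) : ℝ≥0∞)⁻¹ * (M 0 * M 1 : ℕ) = 1 := ENNReal.inv_mul_cancel hMe0 hMet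
    have hsum : ∑ w ∈ good, ((M 0 * M 1 : ℕ) : ℝ≥0∞)⁻¹ *
        ∫⁻ y, 4 * (f w y / q y) * logOneAdd (4 * (f w y / q y)) ∂Q
        ≤ 4 * ENNReal.ofReal (Real.log 4) + 4 * l := by
      calc _ ≤ ∑ w, ((M 0 * M 1 : ℕ) : ℝ≥0∞)⁻¹ * (4 * ENNReal.ofReal (Real.log 4)
              + 4 * ∫⁻ y, f w y * logOneAdd (f w y / q y)) := by
            refine (Finset.sum_le_sum_of_subset (Finset.subset_univ good)).trans ?_
            exact Finset.sum_le_sum fun w _ => mul_le_mul_right (hterm w) _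
        _ = ((M 0 * M 1 : ℕ) : ℝ≥0∞)⁻¹ * ((M 0 * M 1 : ℕ) * (4 * ENNReal.ofReal (Real.log 4))
              + 4 * ∑ w, ∫⁻ y, f w y * logOneAdd (f w y / q y)) := by
            rw [← Finset.mul_sum, Finset.sum_add_distrib, Finset.sum_const, Finset.card_univ,
              card_messages, nsmul_eq_mul, ← Finset.mul_sum]
        _ ≤ ((M 0 * M 1 : ℕ) : ℝ≥0∞)⁻¹ * ((M 0 * M 1 : ℕ) * (4 * ENNReal.ofReal (Real.log 4))
              + 4 * ((M 0 * M 1 : ℕ) * (l : ℝ≥0∞))) := by gcongr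
        _ = (((M 0 * M 1 : ℕ) : ℝ≥0∞)⁻¹ * (M 0 * M 1 : ℕ)) *
              (4 * ENNReal.ofReal (Real.log 4) + 4 * l) := by ring
        _ = _ := by rw [hinv, one_mul]
    have hcard : (1 - 2 * e) * (M 0 * M 1 : ℕ) ≤ (good.card : ℝ) := by
      have h1 : ((M 0 * M 1 : ℕ) : ℝ≥0∞) ≤ good.card + 2 * ((M 0 * M 1 : ℕ) * (e : ℝ≥0∞)) := by
        calc ((M 0 * M 1 : ℕ) : ℝ≥0∞) = ∑ w : (k : Fin 2) → Fin (M k), (1 : ℝ≥0∞) := by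
              rw [Finset.sum_const, Finset.card_univ, card_messages]; simp
          _ ≤ ∑ w, ((if w ∈ good then 1 else 0) + 2 * violation enc G w) := by
              refine Finset.sum_le_sum fun w _ => ?_
              by_cases hw : w ∈ good
              · simp [hw]
              · simpa [hw] using hbad w hw
          _ = good.card + 2 * ∑ w, violation enc G w := by
              rw [Finset.sum_add_distrib, ← Finset.mul_sum]; simp
          _ ≤ _ := by gcongr
      have h2 := ENNReal.toReal_mono (ENNReal.add_ne_top.2 ⟨ENNReal.natCast_ne_top _,
        ENNReal.mul_ne_top (by simp) (ENNReal.mul_ne_top hMet ENNReal.coe_ne_top)⟩) h1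
      rw [ENNReal.toReal_add (ENNReal.natCast_ne_top _)
        (ENNReal.mul_ne_top (by simp) (ENNReal.mul_ne_top hMet ENNReal.coe_ne_top))] at h2
      simp only [ENNReal.toReal_mul, ENNReal.toReal_natCast, ENNReal.coe_toReal,
        ENNReal.toReal_ofNat] at h2
      linarith
    have hlogM : 0 ≤ Real.log (M 0 * M 1 : ℕ) := Real.log_nonneg (by exact_mod_cast hMM)
    have hH0 : 0 ≤ condEntropy c.eveJointLaw * Real.log 2 := by
      rw [c.eveJointLaw_eq]
      exact mul_nonneg (condEntropy_nonneg _) (Real.log_nonneg one_le_two)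
    have hfinal := hmain.trans (add_le_add_right hsum _)
    have hr : ENNReal.ofReal (condEntropy c.eveJointLaw * Real.log 2) + 1 +
        (4 * ENNReal.ofReal (Real.log 4) + 4 * l)
        = ENNReal.ofReal (condEntropy c.eveJointLaw * Real.log 2 + (1 + 4 * Real.log 4 + 4 * l)) := by
      have h4 : ∀ z : ℝ, ENNReal.ofReal (4 * z) = 4 * ENNReal.ofReal z := fun z => by
        rw [ENNReal.ofReal_mul (by norm_num)]; simp
      rw [ENNReal.ofReal_add hH0 (by positivity), ENNReal.ofReal_add (by positivity)
        (by positivity), ENNReal.ofReal_add zero_le_one (by positivity),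
        h4, h4, ENNReal.ofReal_one, ENNReal.ofReal_coe_nnreal]
      ring
    rw [hr, ENNReal.ofReal_le_ofReal_iff (by positivity)] at hfinal
    refine le_trans ?_ hfinal
    rw [← mul_assoc]
    refine mul_le_mul_of_nonneg_right ?_ hlogM
    rw [← div_eq_mul_inv, le_div_iff₀ hMr]
    exact hcard

end GaussianICEE

/-! ### Random codes -/

/-- Needed for the tuples compatible with different messages; these sets are disjoint, but need not
cover all tuples. -/
lemma sum_sum_le_of_disjoint {α β : Type*} [Fintype α] [Fintype β] (S : β → Finset α)
    (hS : ∀ b b' a, a ∈ S b → a ∈ S b' → b = b') (g : α → ℝ≥0∞) :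
    ∑ b, ∑ a ∈ S b, g a ≤ ∑ a, g a := by
  classical
  rw [← Finset.sum_biUnion fun b _ b' _ hb => Finset.disjoint_left.2 fun a ha ha' =>
    hb (hS b b' a ha ha')]
  exact Finset.sum_le_sum_of_subset (Finset.subset_univ _)

namespace GaussianICEE

open DensityFamily

/-- The parameters of a random code: per-letter powers, the numbers `A i` of message parts and `B i`
of randomization indices of each auxiliary codebook, and the splitting of messages into parts. -/
structure RandomCode (n : ℕ) (M : Fin 2 → ℕ) where
  pow : Fin n → Fin 6 → ℝ≥0
  jam : Fin n → Fin 2 → ℝ≥0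
  A : Fin 6 → ℕ
  B : Fin 6 → ℕ
  B_ne_zero : ∀ i, B i ≠ 0
  part : (k : Fin 2) → Fin (M k) → (i : Fin 6) → Fin (A i)
  part_inj : ∀ k m m', (∀ i, user i = k → part k m i = part k m' i) → m = m'

namespace RandomCode

variable {n : ℕ} {M : Fin 2 → ℕ} (C : RandomCode n M) (G : GaussianICEE)

/-- Labels of codewords. -/
abbrev Label (i : Fin 6) : Type := Fin (C.A i) × Fin (C.B i)

/-- Randomization indices. -/
abbrev Index : Type := (i : Fin 6) → Fin (C.B i)

/-- Codebooks. -/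
abbrev Book : Type := ((i : Fin 6) × C.Label i) → Fin n → ℝ

/-- The law of the codewords of auxiliary variable `i`. -/
def wordMeasure (i : Fin 6) : Measure (Fin n → ℝ) :=
  Measure.pi fun t => gaussianReal 0 (C.pow t i)

instance (i : Fin 6) : IsProbabilityMeasure (C.wordMeasure i) := by
  unfold wordMeasure; infer_instance

/-- The output densities at output `r`. -/
def chan (r : Fin 3) : DensityFamily C.wordMeasure (volume : Measure (Fin n → ℝ)) :=
  gaussFamily (G.auxGain r) C.pow (fun t => G.noiseVar r (C.jam t))
    fun t => G.noiseVar_ne_zero r (C.jam t)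

/-- The law of the codebook. -/
def bookLaw : Measure C.Book := codebookLaw C.Label C.wordMeasure

instance : IsProbabilityMeasure C.bookLaw := by
  unfold bookLaw; infer_instance

/-- The labels used for message `m` of user `k` with randomization indices `j`. -/
def userLabel (k : Fin 2) (m : Fin (M k)) (j : C.Index) : (i : Fin 6) → C.Label i :=
  fun i => (C.part k m i, j i)

/-- The labels used for message pair `w` with randomization indices `j`. -/
def label (w : (k : Fin 2) → Fin (M k)) (j : C.Index) : (i : Fin 6) → C.Label i :=
  fun i => (C.part (user i) (w (user i)) i, j i)

/-- The law of the input word of user `k` given codewords `s`. -/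
def wordLaw (k : Fin 2) (s : Fin 6 → Fin n → ℝ) : Measure (Fin n → ℝ) :=
  Measure.pi fun t => gaussianReal (∑ i with user i = k, s i t) (C.jam t k)

instance (k : Fin 2) (s : Fin 6 → Fin n → ℝ) : IsProbabilityMeasure (C.wordLaw k s) := by
  unfold wordLaw; infer_instance

/-- The number of randomization indices. -/
def size : ℝ≥0∞ := (∏ i, C.B i : ℕ)

lemma card_index : Fintype.card C.Index = ∏ i, C.B i := by simp [Index, Fintype.card_pi]

lemma size_ne_zero : C.size ≠ 0 := by
  unfold size
  exact_mod_cast Finset.prod_ne_zero_iff.2 fun i _ => C.B_ne_zero i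

lemma size_ne_top : C.size ≠ ∞ := ENNReal.natCast_ne_top _

lemma sum_const_index (c : ℝ≥0∞) : C.size⁻¹ * ∑ _j : C.Index, c = c := by
  rw [Finset.sum_const, Finset.card_univ, card_index, nsmul_eq_mul, ← mul_assoc]
  change C.size⁻¹ * C.size * c = c
  rw [ENNReal.inv_mul_cancel C.size_ne_zero C.size_ne_top, one_mul]

/-- The stochastic encoder of user `k`. -/
def encoder (x : C.Book) (k : Fin 2) (m : Fin (M k)) : Measure (Fin n → ℝ) :=
  C.size⁻¹ • ∑ j : C.Index, C.wordLaw k (select x (C.userLabel k m j))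

instance (x : C.Book) (k : Fin 2) (m : Fin (M k)) : IsProbabilityMeasure (C.encoder x k m) := by
  refine ⟨?_⟩
  simp only [encoder, Measure.smul_apply, Measure.coe_finsetSum, Finset.sum_apply, measure_univ,
    smul_eq_mul]
  exact C.sum_const_index 1

/-- The density at output `r` for message pair `w`. -/
def outDens (x : C.Book) (r : Fin 3) (w : (k : Fin 2) → Fin (M k)) (y : Fin n → ℝ) : ℝ≥0∞ :=
  C.size⁻¹ * ∑ j : C.Index, (C.chan G r).dens Finset.univ (select x (C.label w j)) y

/-- Indices of user 0 taken from `a`, those of user 1 from `b`. -/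
def mix {X : Fin 6 → Type*} (a b : (i : Fin 6) → X i) : (i : Fin 6) → X i :=
  fun i => if user i = 0 then a i else b i

/-- Each user draws all six indices but uses only its own three. Exchanging the unused halves, `(a,
b) ↦ (mix a b, mix b a)`, is an involution, so a pair of independent draws amounts to one joint draw
counted with multiplicity. -/
lemma sum_mix {X : Fin 6 → Type*} [∀ i, Fintype (X i)] {E : Type*} [AddCommMonoid E]
    (H : ((i : Fin 6) → X i) → E) :
    ∑ z : ((i : Fin 6) → X i) × ((i : Fin 6) → X i), H (mix z.1 z.2)
      = Fintype.card ((i : Fin 6) → X i) • ∑ a, H a := by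
  let e : ((i : Fin 6) → X i) × ((i : Fin 6) → X i) ≃ ((i : Fin 6) → X i) × ((i : Fin 6) → X i) :=
    { toFun := fun z => (mix z.1 z.2, mix z.2 z.1)
      invFun := fun z => (mix z.1 z.2, mix z.2 z.1)
      left_inv := fun z => by
        ext i <;> by_cases h : user i = 0 <;> simp [mix, h]
      right_inv := fun z => by
        ext i <;> by_cases h : user i = 0 <;> simp [mix, h] }
  rw [Fintype.sum_equiv e (fun z => H (mix z.1 z.2)) (fun z => H z.1) fun z => rfl,
    Fintype.sum_prod_type_right]
  simp only [Finset.sum_const, Finset.card_univ]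

lemma outLaw_wordLaw (r : Fin 3) (s s' : Fin 6 → Fin n → ℝ) :
    G.outLaw r (C.wordLaw 0 s) (C.wordLaw 1 s')
      = volume.withDensity ((C.chan G r).dens Finset.univ (mix s s')) := by
  unfold wordLaw chan
  rw [outLaw_gaussian, withDensity_dens]
  congr 1
  ext1 t
  rw [auxGain_sum]
  have h0 : ∑ i with user i = 0, mix s s' i t = ∑ i with user i = 0, s i t :=
    Finset.sum_congr rfl fun i hi => by simp [mix, (Finset.mem_filter.1 hi).2]
  have h1 : ∑ i with user i = 1, mix s s' i t = ∑ i with user i = 1, s' i t :=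
    Finset.sum_congr rfl fun i hi => by simp [mix, (Finset.mem_filter.1 hi).2]
  rw [h0, h1]
  congr 1
  simp [outVar, noiseVar]

attribute [local irreducible] chan

lemma measurable_dens_select (r : Fin 3) (D : Finset (Fin 6)) (l : (i : Fin 6) → C.Label i) :
    Measurable fun z : C.Book × (Fin n → ℝ) => (C.chan G r).dens D (select z.1 l) z.2 :=
  (C.chan G r).meas_comp D ((measurable_select l).comp measurable_fst) measurable_snd

lemma measurable_outDens (r : Fin 3) (w : (k : Fin 2) → Fin (M k)) :
    Measurable fun z : C.Book × (Fin n → ℝ) => C.outDens G z.1 r w z.2 :=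
  (Finset.measurable_fun_sum _ fun _ _ => C.measurable_dens_select G r _ _).const_mul _

lemma outDens_ne_top (x : C.Book) (r : Fin 3) (w : (k : Fin 2) → Fin (M k)) (y : Fin n → ℝ) :
    C.outDens G x r w y ≠ ∞ :=
  ENNReal.mul_ne_top (ENNReal.inv_ne_top.2 C.size_ne_zero)
    (ENNReal.sum_ne_top.2 fun _ _ => (C.chan G r).ne_top _ _ _)

lemma outLaw_encoder (x : C.Book) (r : Fin 3) (w : (k : Fin 2) → Fin (M k)) :
    G.outLaw r (C.encoder x 0 (w 0)) (C.encoder x 1 (w 1))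
      = volume.withDensity (C.outDens G x r w) := by
  unfold encoder
  rw [outLaw_smul_sum]
  have hmix : ∀ z : C.Index × C.Index, mix (select x (C.userLabel 0 (w 0) z.1))
      (select x (C.userLabel 1 (w 1) z.2)) = select x (C.label w (mix z.1 z.2)) := by
    intro z
    ext1 i
    by_cases h : user i = 0
    · have h2 : C.part (user i) (w (user i)) i = C.part 0 (w 0) i := by rw [h]
      simp only [mix, h, select, userLabel, label, if_true, h2]
    · have h1 : user i = 1 := by
        have : ∀ k : Fin 2, k ≠ 0 → k = 1 := by decide
        exact this _ h
      have h2 : C.part (user i) (w (user i)) i = C.part 1 (w 1) i := by rw [h1]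
      simp only [mix, h, select, userLabel, label, if_false, h2]
  simp_rw [outLaw_wordLaw, hmix]
  rw [sum_mix fun j => volume.withDensity
    ((C.chan G r).dens Finset.univ (select x (C.label w j))), card_index]
  have hm : ∀ j : C.Index, Measurable fun y =>
      (C.chan G r).dens Finset.univ (select x (C.label w j)) y := fun j =>
    (C.chan G r).meas_comp _ measurable_const measurable_id
  ext s hs
  rw [withDensity_apply _ hs]
  unfold outDens
  rw [lintegral_const_mul _ (Finset.measurable_fun_sum _ fun j _ => hm j),
    lintegral_finsetSum _ fun j _ => hm j]
  simp only [Measure.smul_apply, Measure.coe_finsetSum, Finset.sum_apply, smul_eq_mul,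
    nsmul_eq_mul, withDensity_apply _ hs]
  change C.size⁻¹ * C.size⁻¹ * (C.size * _) = _
  rw [← mul_assoc, mul_assoc C.size⁻¹, ENNReal.inv_mul_cancel C.size_ne_zero C.size_ne_top, mul_one]

/-! #### Decoding errors -/

open Classical in
/-- The label tuples compatible with message `m` of user `k`. -/
def compatible (k : Fin 2) (m : Fin (M k)) : Finset ((i : Fin 6) → C.Label i) :=
  Finset.univ.filter fun l => ∀ i, user i = k → (l i).1 = C.part k m i

open Classical in
/-- The label tuples not compatible with message `m` of user `k`. -/
def incompatible (k : Fin 2) (m : Fin (M k)) : Finset ((i : Fin 6) → C.Label i) :=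
  Finset.univ.filter fun l => ¬ ∀ i, user i = k → (l i).1 = C.part k m i

/-- The total likelihood of a set of label tuples, relative to that of all of them. -/
def relLikelihood (x : C.Book) (r : Fin 3) (D : Finset (Fin 6))
    (Λ : Finset ((i : Fin 6) → C.Label i)) (y : Fin n → ℝ) : ℝ≥0∞ :=
  (∑ l ∈ Λ, (C.chan G r).dens D (select x l) y) /
    ∑ l : (i : Fin 6) → C.Label i, (C.chan G r).dens D (select x l) y

lemma measurable_relLikelihood (r : Fin 3) (D : Finset (Fin 6))
    (Λ : Finset ((i : Fin 6) → C.Label i)) :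
    Measurable fun z : C.Book × (Fin n → ℝ) => C.relLikelihood G z.1 r D Λ z.2 :=
  (Finset.measurable_fun_sum _ fun _ _ => C.measurable_dens_select G r _ _).div
    (Finset.measurable_fun_sum _ fun _ _ => C.measurable_dens_select G r _ _)

/-- The total error probability of the likelihood decoder of receiver `k`. -/
def errSum (x : C.Book) (k : Fin 2) (D : Finset (Fin 6)) : ℝ≥0∞ :=
  ∑ w : (k : Fin 2) → Fin (M k), ∫⁻ y, C.outDens G x k.castSucc w y *
    C.relLikelihood G x k.castSucc D (C.incompatible k (w k)) y

lemma sum_relLikelihood_compatible_le (x : C.Book) (k : Fin 2) (D : Finset (Fin 6))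
    (y : Fin n → ℝ) :
    ∑ m, C.relLikelihood G x k.castSucc D (C.compatible k m) y ≤ 1 := by
  unfold relLikelihood
  simp_rw [div_eq_mul_inv]
  rw [← Finset.sum_mul]
  refine (mul_le_mul_left (sum_sum_le_of_disjoint (C.compatible k) ?_ _) _).trans
    (ENNReal.mul_inv_le_one _)
  intro m m' l hl hl'
  refine C.part_inj k m m' fun i hi => ?_
  rw [← (Finset.mem_filter.1 hl).2 i hi, ← (Finset.mem_filter.1 hl').2 i hi]

lemma one_le_relLikelihood_add [Nonempty ((i : Fin 6) → C.Label i)] (x : C.Book) (k : Fin 2)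
    (D : Finset (Fin 6)) (m : Fin (M k)) (y : Fin n → ℝ) :
    1 ≤ C.relLikelihood G x k.castSucc D (C.compatible k m) y
      + C.relLikelihood G x k.castSucc D (C.incompatible k m) y := by
  classical
  unfold relLikelihood compatible incompatible
  rw [← ENNReal.add_div, Finset.sum_filter_add_sum_filter_not, ENNReal.div_self]
  · intro h0
    obtain ⟨l⟩ := ‹Nonempty ((i : Fin 6) → C.Label i)›
    exact (C.chan G k.castSucc).ne_zero D (select x l) y
      (Finset.sum_eq_zero_iff.1 h0 l (Finset.mem_univ l))
  · exact ENNReal.sum_ne_top.2 fun _ _ => (C.chan G _).ne_top _ _ _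

lemma exists_decoder (x : C.Book) (k : Fin 2) (hM : 0 < M k) (D : Finset (Fin 6)) :
    ∃ dec : (Fin n → ℝ) → Fin (M k), Measurable dec ∧
      ∑ w : (k : Fin 2) → Fin (M k), G.outLaw k.castSucc (C.encoder x 0 (w 0))
        (C.encoder x 1 (w 1)) {y | dec y ≠ w k} ≤ C.errSum G x k D := by
  classical
  simp_rw [outLaw_encoder]
  by_cases hne : Nonempty ((i : Fin 6) → C.Label i)
  swap
  · have : IsEmpty ((i : Fin 6) → C.Label i) := not_nonempty_iff.1 hne
    refine ⟨fun _ => ⟨0, hM⟩, measurable_const, ?_⟩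
    have h0 : ∀ w, C.outDens G x k.castSucc w = 0 := by
      intro w
      ext y
      have : IsEmpty C.Index := ⟨fun j => this.false (C.label w j)⟩
      simp [outDens]
    simp [h0]
  have hmo : ∀ w, Measurable fun y => C.outDens G x k.castSucc w y := fun w =>
    (C.measurable_outDens G k.castSucc w).comp (measurable_const.prodMk measurable_id)
  have hmr : ∀ m : Fin (M k), Measurable fun y =>
      C.relLikelihood G x k.castSucc D (C.incompatible k m) y := fun m =>
    (C.measurable_relLikelihood G _ D _).comp (measurable_const.prodMk measurable_id)
  unfold errSum
  exact exists_decoder_le volume hM (fun w : (k : Fin 2) → Fin (M k) => w k)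
    (fun w y => C.outDens G x k.castSucc w y) hmo (fun w y => C.outDens_ne_top G x _ w y)
    (fun m y => C.relLikelihood G x k.castSucc D (C.compatible k m) y)
    (fun m y => C.relLikelihood G x k.castSucc D (C.incompatible k m) y) hmr
    (fun y => C.sum_relLikelihood_compatible_le G x k D y)
    (fun m y => C.one_le_relLikelihood_add G x k D m y)

/-- The hypothesis on `A i` says that a variable of user `k` outside the decoded set carries no
message. A tuple incompatible with the sent message then differs from it inside `D`, as the
likelihood decoder bound requires; the bound is applied for each fixed randomization index. -/
lemma lintegral_errSum_le (k : Fin 2) (D : Finset (Fin 6))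
    (hD : ∀ i, user i = k → i ∉ D → C.A i = 1) (ε : ℝ≥0∞) :
    ∫⁻ x, C.errSum G x k D ∂C.bookLaw ≤ (M 0 * M 1 : ℕ) * ∑ A ∈ D.powerset.erase D,
      ((C.chan G k.castSucc).lowRatioProb D A
        (∏ i ∈ D \ A, (C.A i * C.B i - 1) : ℕ) ε + ε) := by
  classical
  unfold errSum
  have hm1 : ∀ w : (k : Fin 2) → Fin (M k), Measurable fun x : C.Book =>
      ∫⁻ y, C.outDens G x k.castSucc w y *
        C.relLikelihood G x k.castSucc D (C.incompatible k (w k)) y := fun w =>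
    ((C.measurable_outDens G _ w).mul (C.measurable_relLikelihood G _ D _)).lintegral_prod_right'
  rw [lintegral_finsetSum _ fun w _ => hm1 w]
  have hterm : ∀ w : (k : Fin 2) → Fin (M k), ∫⁻ x, ∫⁻ y, C.outDens G x k.castSucc w y *
      C.relLikelihood G x k.castSucc D (C.incompatible k (w k)) y ∂volume ∂C.bookLaw
      ≤ ∑ A ∈ D.powerset.erase D, ((C.chan G k.castSucc).lowRatioProb D A
        (∏ i ∈ D \ A, (C.A i * C.B i - 1) : ℕ) ε + ε) := by
    intro w
    have hj : ∀ j : C.Index, ∫⁻ x, ∫⁻ y, (C.chan G k.castSucc).dens Finset.univ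
        (select x (C.label w j)) y *
          C.relLikelihood G x k.castSucc D (C.incompatible k (w k)) y ∂volume ∂C.bookLaw
        ≤ ∑ A ∈ D.powerset.erase D, ((C.chan G k.castSucc).lowRatioProb D A
          (∏ i ∈ D \ A, (C.A i * C.B i - 1) : ℕ) ε + ε) := by
      intro j
      refine ((C.chan G k.castSucc).lintegral_likelihood_error_le D (C.label w j)
        (C.incompatible k (w k)) ?_ ε).trans (le_of_eq ?_)
      · intro l hl heq
        refine (Finset.mem_filter.1 hl).2 fun i hi => ?_
        by_cases hiD : i ∈ D
        · rw [← heq] at hiD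
          have := (Finset.mem_filter.1 hiD).2
          rw [← this]
          subst hi
          rfl
        · have h1 := hD i hi hiD
          have : Subsingleton (Fin (C.A i)) := by rw [h1]; infer_instance
          exact Subsingleton.elim _ _
      · simp [Label]
    have hmj : ∀ j : C.Index, Measurable fun z : C.Book × (Fin n → ℝ) =>
        (C.chan G k.castSucc).dens Finset.univ (select z.1 (C.label w j)) z.2 *
          C.relLikelihood G z.1 k.castSucc D (C.incompatible k (w k)) z.2 := fun j =>
      (C.measurable_dens_select G _ _ _).mul (C.measurable_relLikelihood G _ D _)
    have heq : ∀ x, ∫⁻ y, C.outDens G x k.castSucc w y *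
        C.relLikelihood G x k.castSucc D (C.incompatible k (w k)) y
        = C.size⁻¹ * ∑ j : C.Index, ∫⁻ y, (C.chan G k.castSucc).dens Finset.univ
          (select x (C.label w j)) y *
            C.relLikelihood G x k.castSucc D (C.incompatible k (w k)) y := by
      intro x
      have hmx : ∀ j : C.Index, Measurable fun y =>
        (C.chan G k.castSucc).dens Finset.univ (select x (C.label w j)) y *
          C.relLikelihood G x k.castSucc D (C.incompatible k (w k)) y := fun j =>
        (hmj j).comp (measurable_const.prodMk measurable_id)
      rw [← lintegral_finsetSum _ fun j _ => hmx j,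
        ← lintegral_const_mul _ (Finset.measurable_fun_sum _ fun j _ => hmx j)]
      refine lintegral_congr fun y => ?_
      rw [outDens, mul_assoc, Finset.sum_mul]
    simp_rw [heq]
    have hmi : ∀ j : C.Index, Measurable fun x : C.Book => ∫⁻ y,
        (C.chan G k.castSucc).dens Finset.univ (select x (C.label w j)) y *
          C.relLikelihood G x k.castSucc D (C.incompatible k (w k)) y := fun j =>
      (hmj j).lintegral_prod_right'
    rw [lintegral_const_mul _ (Finset.measurable_fun_sum _ fun j _ => hmi j),
      lintegral_finsetSum _ fun j _ => hmi j]
    refine (mul_le_mul_right (Finset.sum_le_sum fun j _ => hj j) _).trans (le_of_eq ?_)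
    exact C.sum_const_index _
  refine (Finset.sum_le_sum fun w _ => hterm w).trans (le_of_eq ?_)
  rw [Finset.sum_const, Finset.card_univ, card_messages, nsmul_eq_mul]

end RandomCode
end GaussianICEE

/-- The sum of independent Gaussian words and a Gaussian word. -/
lemma lintegral_pi_gaussianReal_add {κ : Type*} [Fintype κ] (m : κ → ℝ) (u v : κ → ℝ≥0)
    {F : (κ → ℝ) → ℝ≥0∞} (hF : Measurable F) :
    ∫⁻ s, ∫⁻ x, F x ∂(Measure.pi fun k => gaussianReal (m k + s k) (u k))
        ∂(Measure.pi fun k => gaussianReal 0 (v k))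
      = ∫⁻ x, F x ∂(Measure.pi fun k => gaussianReal (m k) (u k + v k)) := by
  have h := pi_gaussianReal_mul_add 1 (fun _ => 0) m v u
  have h1 : ∀ s : κ → ℝ, (Measure.pi fun k => gaussianReal (m k + s k) (u k))
      = (Measure.pi fun k => gaussianReal (m k) (u k)).map fun x k => 1 * s k + x k := by
    intro s
    have : ∀ k, SigmaFinite ((gaussianReal (m k) (u k)).map fun x => 1 * s k + x) := fun k => by
      rw [gaussianReal_map_const_add]; infer_instance
    rw [Measure.pi_map_pi (f := fun k x => 1 * s k + x) fun k => by fun_prop]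
    simp_rw [gaussianReal_map_const_add, one_mul]
  simp only [mul_zero, zero_add, nnnorm_one, one_pow, one_mul] at h
  simp_rw [h1, fun s : κ → ℝ => lintegral_map (μ := Measure.pi fun k => gaussianReal (m k) (u k)) hF
    (g := fun x k => 1 * s k + x k) (by fun_prop), one_mul]
  rw [← lintegral_prod (fun z : (κ → ℝ) × (κ → ℝ) => F fun k => z.1 k + z.2 k)
    (hF.comp (by fun_prop)).aemeasurable, ← lintegral_map hF (by fun_prop), h]
  simp_rw [add_comm]

lemma measurable_lintegral_pi_gaussianReal {α κ : Type*} [MeasurableSpace α] [Fintype κ]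
    {m : α → κ → ℝ} (hm : Measurable m) (u : κ → ℝ≥0) {F : (κ → ℝ) → ℝ≥0∞} (hF : Measurable F) :
    Measurable fun a => ∫⁻ x, F x ∂(Measure.pi fun k => gaussianReal (m a k) (u k)) := by
  have h1 : ∀ a, (Measure.pi fun k => gaussianReal (m a k) (u k))
      = (Measure.pi fun k => gaussianReal 0 (u k)).map fun x k => m a k + x k := by
    intro a
    have : ∀ k, SigmaFinite ((gaussianReal 0 (u k)).map fun x => m a k + x) := fun k => by
      rw [gaussianReal_map_const_add]; infer_instance
    rw [Measure.pi_map_pi (f := fun k x => m a k + x) fun k => by fun_prop]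
    simp_rw [gaussianReal_map_const_add, zero_add]
  simp_rw [h1, fun a => lintegral_map (μ := Measure.pi fun k => gaussianReal 0 (u k)) hF
    (g := fun x k => m a k + x k) (by fun_prop)]
  refine Measurable.lintegral_prod_right' (f := fun z : α × (κ → ℝ) => F fun k => m z.1 k + z.2 k) ?_
  exact hF.comp (by fun_prop)

/-- An independent centred Gaussian mean turns into extra variance; the words in `I` are absorbed
one at a time. -/
lemma lintegral_pi_gaussianReal_sum {ι κ : Type*} [Fintype ι] [Fintype κ]
    (p : κ → ι → ℝ≥0) (I : Finset ι) (m : κ → ℝ) (u : κ → ℝ≥0)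
    {F : (κ → ℝ) → ℝ≥0∞} (hF : Measurable F) :
    ∫⁻ t, ∫⁻ x, F x ∂(Measure.pi fun k => gaussianReal (m k + ∑ i ∈ I, t i k) (u k))
        ∂(Measure.pi fun i => Measure.pi fun k => gaussianReal 0 (p k i))
      = ∫⁻ x, F x ∂(Measure.pi fun k => gaussianReal (m k) (u k + ∑ i ∈ I, p k i)) := by
  classical
  induction I using Finset.induction_on generalizing u with
  | empty => simp
  | insert j I hj ih =>
    have hmm : ∀ I : Finset ι, Measurable fun (t : ι → κ → ℝ) k => m k + ∑ i ∈ I, t i k :=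
      fun I => by fun_prop
    rw [lintegral_pi_eq_lintegral_update _ j
      (measurable_lintegral_pi_gaussianReal (hmm (insert j I)) u hF)]
    have h1 : ∀ (t : ι → κ → ℝ) (s : κ → ℝ) k, m k + ∑ i ∈ insert j I, Function.update t j s i k
        = (m k + ∑ i ∈ I, t i k) + s k := by
      intro t s k
      rw [Finset.sum_insert hj]
      have : ∑ i ∈ I, Function.update t j s i k = ∑ i ∈ I, t i k :=
        Finset.sum_congr rfl fun i hi => by
          rw [Function.update_of_ne (ne_of_mem_of_not_mem hi hj)]
      rw [this, Function.update_self]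
      ring
    simp_rw [h1]
    have h2 : ∀ t : ι → κ → ℝ, ∫⁻ s, ∫⁻ x, F x ∂(Measure.pi fun k =>
        gaussianReal ((m k + ∑ i ∈ I, t i k) + s k) (u k))
          ∂(Measure.pi fun k => gaussianReal 0 (p k j))
        = ∫⁻ x, F x ∂(Measure.pi fun k => gaussianReal (m k + ∑ i ∈ I, t i k) (u k + p k j)) :=
      fun t => lintegral_pi_gaussianReal_add _ u (fun k => p k j) hF
    simp_rw [h2]
    rw [ih (fun k => u k + p k j)]
    simp_rw [Finset.sum_insert hj, add_assoc]

namespace GaussianICEE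
namespace RandomCode

open DensityFamily

variable {n : ℕ} {M : Fin 2 → ℕ} (C : RandomCode n M) (G : GaussianICEE)

/-! #### Power -/

/-- The law of the input word of user `k` averaged over codebooks. -/
def inputLaw (k : Fin 2) : Measure (Fin n → ℝ) :=
  Measure.pi fun t => gaussianReal 0 (C.jam t k + ∑ i with user i = k, C.pow t i)

lemma measurable_wordLaw (k : Fin 2) {s : Set (Fin n → ℝ)} (hs : MeasurableSet s) :
    Measurable fun t => C.wordLaw k t s := by
  have h := measurable_lintegral_pi_gaussianReal (κ := Fin n)
    (m := fun (t : Fin 6 → Fin n → ℝ) τ => ∑ i with user i = k, t i τ) (by fun_prop)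
    (fun τ => C.jam τ k) (measurable_one.indicator hs)
  simp_rw [lintegral_indicator_one hs] at h
  exact h

lemma lintegral_wordLaw (k : Fin 2) (l : (i : Fin 6) → C.Label i) {s : Set (Fin n → ℝ)}
    (hs : MeasurableSet s) :
    ∫⁻ x, C.wordLaw k (select x l) s ∂C.bookLaw = C.inputLaw k s := by
  unfold bookLaw
  rw [lintegral_select l (C.measurable_wordLaw k hs)]
  have h := lintegral_pi_gaussianReal_sum C.pow (Finset.univ.filter fun i => user i = k)
    (fun _ => 0) (fun t => C.jam t k) (measurable_one.indicator hs)
  simp_rw [lintegral_indicator_one hs, zero_add] at h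
  exact h

lemma measurable_encoder (k : Fin 2) (m : Fin (M k)) {s : Set (Fin n → ℝ)}
    (hs : MeasurableSet s) : Measurable fun x => C.encoder x k m s := by
  simp only [encoder, Measure.smul_apply, Measure.coe_finsetSum, Finset.sum_apply, smul_eq_mul]
  exact (Finset.measurable_fun_sum _ fun j _ =>
    (C.measurable_wordLaw k hs).comp (measurable_select _)).const_mul _

lemma lintegral_encoder (k : Fin 2) (m : Fin (M k)) {s : Set (Fin n → ℝ)}
    (hs : MeasurableSet s) : ∫⁻ x, C.encoder x k m s ∂C.bookLaw = C.inputLaw k s := by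
  have hm : ∀ j : C.Index, Measurable fun x : C.Book =>
      C.wordLaw k (select x (C.userLabel k m j)) s := fun j =>
    (C.measurable_wordLaw k hs).comp (measurable_select _)
  simp only [encoder, Measure.smul_apply, Measure.coe_finsetSum, Finset.sum_apply, smul_eq_mul]
  rw [lintegral_const_mul _ (Finset.measurable_fun_sum _ fun j _ => hm j),
    lintegral_finsetSum _ fun j _ => hm j]
  simp_rw [C.lintegral_wordLaw k _ hs]
  exact C.sum_const_index _

lemma measurable_violation (w : (k : Fin 2) → Fin (M k)) :
    Measurable fun x => violation (C.encoder x) G w :=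
  Finset.measurable_fun_sum _ fun k _ =>
    C.measurable_encoder k (w k) (G.measurableSet_powerBall n k).compl

lemma lintegral_violation :
    ∫⁻ x, ∑ w, violation (C.encoder x) G w ∂C.bookLaw
      = (M 0 * M 1 : ℕ) * ∑ k, C.inputLaw k (G.powerBall n k)ᶜ := by
  rw [lintegral_finsetSum _ fun w _ => C.measurable_violation G w]
  have h : ∀ w, ∫⁻ x, violation (C.encoder x) G w ∂C.bookLaw
      = ∑ k, C.inputLaw k (G.powerBall n k)ᶜ := by
    intro w
    unfold violation
    rw [lintegral_finsetSum _ fun k _ =>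
      C.measurable_encoder k (w k) (G.measurableSet_powerBall n k).compl]
    exact Finset.sum_congr rfl fun k _ =>
      C.lintegral_encoder k (w k) (G.measurableSet_powerBall n k).compl
  simp_rw [h]
  rw [Finset.sum_const, Finset.card_univ, card_messages, nsmul_eq_mul]

/-! #### Leakage -/

/-- The density at output `r` averaged over codebooks. -/
def meanDens (r : Fin 3) (y : Fin n → ℝ) : ℝ≥0∞ := (C.chan G r).dens ∅ (fun _ _ => 0) y

lemma dens_empty (r : Fin 3) (t : Fin 6 → Fin n → ℝ) (y : Fin n → ℝ) :
    (C.chan G r).dens ∅ t y = C.meanDens G r y := (C.chan G r).congr _ _ _ _ (by simp)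

lemma measurable_meanDens (r : Fin 3) : Measurable (C.meanDens G r) :=
  (C.chan G r).meas_comp _ measurable_const measurable_id

/-- The total leakage. -/
def leakSum (x : C.Book) : ℝ≥0∞ :=
  ∑ w, ∫⁻ y, C.outDens G x 2 w y * logOneAdd (C.outDens G x 2 w y / C.meanDens G 2 y)

lemma label_injective (w : (k : Fin 2) → Fin (M k)) : Function.Injective (C.label w) := by
  intro j j' h
  ext1 i
  exact congrArg Prod.snd (congrFun h i)

/-- For a fixed message pair the tuples differ only in their randomization indices: those in `A` are
forced and the others are bounded by all choices. -/
lemma card_agree_label_le (w : (k : Fin 2) → Fin (M k)) (j : C.Index) (A : Finset (Fin 6)) :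
    (((Finset.univ : Finset C.Index).map ⟨C.label w, C.label_injective w⟩).filter fun l' =>
      agree Finset.univ (C.label w j) l' = A).card ≤ ∏ i ∈ Aᶜ, C.B i := by
  rw [Finset.filter_map, Finset.card_map]
  have hsub : (Finset.univ : Finset C.Index).filter ((fun l' =>
      agree Finset.univ (C.label w j) l' = A) ∘ (⟨C.label w, C.label_injective w⟩ : _ ↪ _))
      ⊆ Fintype.piFinset fun i => if i ∈ A then {j i} else Finset.univ := by
    intro j' hj'
    have h := (Finset.mem_filter.1 hj').2
    simp only [Function.comp, Function.Embedding.coeFn_mk] at h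
    rw [Fintype.mem_piFinset]
    intro i
    by_cases hi : i ∈ A
    · rw [← h] at hi
      have h2 := congrArg Prod.snd (Finset.mem_filter.1 hi).2
      rw [if_pos (h ▸ hi)]
      exact Finset.mem_singleton.2 h2.symm
    · simp [hi]
  refine (Finset.card_le_card hsub).trans (le_of_eq ?_)
  rw [Fintype.card_piFinset, ← Finset.prod_mul_prod_compl A]
  have h1 : ∏ i ∈ A, (if i ∈ A then ({j i} : Finset (Fin (C.B i))) else Finset.univ).card = 1 :=
    Finset.prod_eq_one fun i hi => by simp [hi]
  rw [h1, one_mul]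
  refine Finset.prod_congr rfl fun i hi => ?_
  rw [if_neg (Finset.mem_compl.1 hi), Finset.card_univ, Fintype.card_fin]

lemma measurable_leak (w : (k : Fin 2) → Fin (M k)) :
    Measurable fun z : C.Book × (Fin n → ℝ) =>
      logOneAdd (C.outDens G z.1 2 w z.2 / C.meanDens G 2 z.2) :=
  measurable_logOneAdd.comp ((C.measurable_outDens G 2 w).div
    ((C.measurable_meanDens G 2).comp measurable_snd))

lemma measurable_leakSum : Measurable (C.leakSum G) :=
  Finset.measurable_fun_sum _ fun w _ =>
    ((C.measurable_outDens G 2 w).mul (C.measurable_leak G w)).lintegral_prod_right'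

attribute [local irreducible] chan

/-- Soft covering is applied with one index tuple `j` singled out as the sent one. All index choices
give the same bound, so averaging over `j` changes nothing. -/
lemma lintegral_leakSum_le :
    ∫⁻ x, C.leakSum G x ∂C.bookLaw ≤ (M 0 * M 1 : ℕ) * (1 + (C.chan G 2).expect Finset.univ
      (fun t y => logOneAdd ((C.chan G 2).meanRatio C.B (C.meanDens G 2) t y))) := by
  classical
  unfold leakSum
  have hm1 : ∀ w : (k : Fin 2) → Fin (M k), Measurable fun x : C.Book => ∫⁻ y,
      C.outDens G x 2 w y * logOneAdd (C.outDens G x 2 w y / C.meanDens G 2 y) := fun w =>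
    ((C.measurable_outDens G 2 w).mul (C.measurable_leak G w)).lintegral_prod_right'
  rw [lintegral_finsetSum _ fun w _ => hm1 w]
  have hterm : ∀ w : (k : Fin 2) → Fin (M k), ∫⁻ x, ∫⁻ y, C.outDens G x 2 w y *
      logOneAdd (C.outDens G x 2 w y / C.meanDens G 2 y) ∂volume ∂C.bookLaw
      ≤ 1 + (C.chan G 2).expect Finset.univ
        (fun t y => logOneAdd ((C.chan G 2).meanRatio C.B (C.meanDens G 2) t y)) := by
    intro w
    have hj : ∀ j : C.Index, ∫⁻ x, ∫⁻ y, (C.chan G 2).dens Finset.univ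
        (select x (C.label w j)) y *
          logOneAdd (C.outDens G x 2 w y / C.meanDens G 2 y) ∂volume ∂C.bookLaw
        ≤ 1 + (C.chan G 2).expect Finset.univ
          (fun t y => logOneAdd ((C.chan G 2).meanRatio C.B (C.meanDens G 2) t y)) := by
      intro j
      have h := (C.chan G 2).lintegral_dens_mul_logOneAdd_le (C.label w j)
        ((Finset.univ : Finset C.Index).map ⟨C.label w, C.label_injective w⟩) C.B C.B_ne_zero
        (C.card_agree_label_le w j) (C.meanDens G 2) (C.dens_empty G 2) (C.measurable_meanDens G 2)
      simp_rw [Finset.sum_map, Function.Embedding.coeFn_mk] at h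
      refine h.trans (le_of_eq ?_)
      unfold expect
      simp_rw [mul_comm]
    have hmj : ∀ j : C.Index, Measurable fun z : C.Book × (Fin n → ℝ) =>
        (C.chan G 2).dens Finset.univ (select z.1 (C.label w j)) z.2 *
          logOneAdd (C.outDens G z.1 2 w z.2 / C.meanDens G 2 z.2) := fun j =>
      (C.measurable_dens_select G _ _ _).mul (C.measurable_leak G w)
    have heq : ∀ x, ∫⁻ y, C.outDens G x 2 w y *
        logOneAdd (C.outDens G x 2 w y / C.meanDens G 2 y)
        = C.size⁻¹ * ∑ j : C.Index, ∫⁻ y, (C.chan G 2).dens Finset.univ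
          (select x (C.label w j)) y *
            logOneAdd (C.outDens G x 2 w y / C.meanDens G 2 y) := by
      intro x
      have hmx : ∀ j : C.Index, Measurable fun y =>
        (C.chan G 2).dens Finset.univ (select x (C.label w j)) y *
          logOneAdd (C.outDens G x 2 w y / C.meanDens G 2 y) := fun j =>
        (hmj j).comp (measurable_const.prodMk measurable_id)
      rw [← lintegral_finsetSum _ fun j _ => hmx j,
        ← lintegral_const_mul _ (Finset.measurable_fun_sum _ fun j _ => hmx j)]
      refine lintegral_congr fun y => ?_
      rw [← Finset.sum_mul, ← mul_assoc]
      rfl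
    simp_rw [heq]
    have hmi : ∀ j : C.Index, Measurable fun x : C.Book => ∫⁻ y,
        (C.chan G 2).dens Finset.univ (select x (C.label w j)) y *
          logOneAdd (C.outDens G x 2 w y / C.meanDens G 2 y) := fun j =>
      (hmj j).lintegral_prod_right'
    rw [lintegral_const_mul _ (Finset.measurable_fun_sum _ fun j _ => hmi j),
      lintegral_finsetSum _ fun j _ => hmi j]
    refine (mul_le_mul_right (Finset.sum_le_sum fun j _ => hj j) _).trans (le_of_eq ?_)
    exact C.sum_const_index _
  refine (Finset.sum_le_sum fun w _ => hterm w).trans (le_of_eq ?_)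
  rw [Finset.sum_const, Finset.card_univ, card_messages, nsmul_eq_mul]

lemma measurable_errSum (k : Fin 2) (D : Finset (Fin 6)) :
    Measurable fun x => C.errSum G x k D :=
  Finset.measurable_fun_sum _ fun w _ =>
    ((C.measurable_outDens G _ w).mul (C.measurable_relLikelihood G _ D _)).lintegral_prod_right'

/-! #### Existence of a good code -/

lemma exists_secretCode_of_mean (hM : ∀ k, 0 < M k) (D : Fin 2 → Finset (Fin 6)) {e l : ℝ≥0}
    (he : 0 < e) (hl : 0 < l)
    (herr : ∀ k, ∫⁻ x, C.errSum G x k (D k) ∂C.bookLaw ≤ (M 0 * M 1 : ℕ) * (e : ℝ≥0∞))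
    (hvio : ∑ k, C.inputLaw k (G.powerBall n k)ᶜ ≤ e)
    (hleak : (C.chan G 2).expect Finset.univ
      (fun t y => logOneAdd ((C.chan G 2).meanRatio C.B (C.meanDens G 2) t y)) + 1 ≤ l) :
    ∃ c : G.SecretCode n M, (∀ k, c.errorProb k ≤ 24 * e) ∧
      (1 - 8 * e) * Real.log (M 0 * M 1 : ℕ)
        ≤ condEntropy c.eveJointLaw * Real.log 2 + (1 + 4 * Real.log 4 + 16 * l) := by
  set W : ℝ≥0∞ := ((M 0 * M 1 : ℕ) : ℝ≥0∞) with hW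
  have hl0 : (l : ℝ≥0∞) ≠ 0 := by exact_mod_cast hl.ne'
  have he0 : (e : ℝ≥0∞) ≠ 0 := by exact_mod_cast he.ne'
  -- The weights `l` and `e` equalize the scales: two error terms, the violation term and the
  -- leakage each have mean at most `l * (W * e)`. A codebook at or below the mean of `T` then
  -- satisfies all requirements at once, each with the factor `4`.
  let T : C.Book → ℝ≥0∞ := fun x => l * (∑ k, C.errSum G x k (D k) +
    ∑ w, violation (C.encoder x) G w) + e * C.leakSum G x
  have hmE : Measurable fun x => ∑ k, C.errSum G x k (D k) :=
    Finset.measurable_fun_sum _ fun k _ => C.measurable_errSum G k (D k)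
  have hmV : Measurable fun x => ∑ w, violation (C.encoder x) G w :=
    Finset.measurable_fun_sum _ fun w _ => C.measurable_violation G w
  have hmT : Measurable T := ((hmE.add hmV).const_mul _).add ((C.measurable_leakSum G).const_mul _)
  have hT : ∫⁻ x, T x ∂C.bookLaw ≤ 4 * (l * (W * e)) := by
    have h1 := C.lintegral_leakSum_le G
    rw [add_comm (1 : ℝ≥0∞)] at h1
    have h2 := h1.trans (mul_le_mul_right hleak W)
    have h3 := (C.lintegral_violation G).trans_le (mul_le_mul_right hvio W)
    have hEV : Measurable fun x => ∑ k, C.errSum G x k (D k) +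
      ∑ w, violation (C.encoder x) G w := hmE.add hmV
    rw [lintegral_add_left (hEV.const_mul _), lintegral_const_mul _ hEV,
      lintegral_add_left hmE, lintegral_const_mul _ (C.measurable_leakSum G),
      lintegral_finsetSum _ fun k _ => C.measurable_errSum G k (D k), Fin.sum_univ_two]
    calc _ ≤ l * (W * e + W * e + W * e) + e * (W * l) := by
          gcongr
          · exact herr 0
          · exact herr 1
      _ = _ := by ring
  obtain ⟨x, hx⟩ := exists_le_lintegral (μ := C.bookLaw) hmT.aemeasurable
  have hTx := hx.trans hT
  have hfirst : ∑ k, C.errSum G x k (D k) + ∑ w, violation (C.encoder x) G w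
      ≤ W * ((4 * e : ℝ≥0) : ℝ≥0∞) := by
    have h1 : l * (∑ k, C.errSum G x k (D k) + ∑ w, violation (C.encoder x) G w)
        ≤ l * (W * ((4 * e : ℝ≥0) : ℝ≥0∞)) := by
      refine (le_self_add.trans hTx).trans (le_of_eq ?_)
      push_cast; ring
    exact (ENNReal.mul_le_mul_iff_right hl0 ENNReal.coe_ne_top).1 h1
  have hsecond : C.leakSum G x ≤ W * ((4 * l : ℝ≥0) : ℝ≥0∞) := by
    have h1 : e * C.leakSum G x ≤ e * (W * ((4 * l : ℝ≥0) : ℝ≥0∞)) := by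
      refine (le_add_self.trans hTx).trans (le_of_eq ?_)
      push_cast; ring
    exact (ENNReal.mul_le_mul_iff_right he0 ENNReal.coe_ne_top).1 h1
  choose dec hdec hdecle using fun k => C.exists_decoder G x k (hM k) (D k)
  obtain ⟨c, hc1, hc2⟩ := exists_secretCode (G := G) hM (C.encoder x) (fun k w => inferInstance) dec
    hdec (C.outDens G x 2) (fun w => (C.measurable_outDens G 2 w).comp
      (measurable_const.prodMk measurable_id)) (C.outDens_ne_top G x 2) (C.outLaw_encoder G x 2)
    (C.meanDens G 2) (C.measurable_meanDens G 2) (fun y => (C.chan G 2).ne_zero _ _ _)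
    (fun y => (C.chan G 2).ne_top _ _ _) ((C.chan G 2).lintegral_eq_one _ _) (4 * e) (4 * l)
    (fun k => (hdecle k).trans ((Finset.single_le_sum (f := fun k => C.errSum G x k (D k))
      (fun _ _ => zero_le) (Finset.mem_univ k)).trans (le_self_add.trans hfirst)))
    (le_add_self.trans hfirst) hsecond
  refine ⟨c, fun k => (hc1 k).trans (le_of_eq ?_), ?_⟩
  · push_cast; ring
  · push_cast at hc2 ⊢
    linarith

end RandomCode
end GaussianICEE

/-! ### Power of Gaussian words -/

/-- Chebyshev: the mean energy is at most `a * n * P`, so a violation is a deviation of more than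
`(1 - a) * n * P`. -/
lemma pi_gaussianReal_power_le {n : ℕ} (hn : 0 < n) (V : Fin n → ℝ≥0) {v P a : ℝ≥0} (ha : a < 1)
    (hV : ∀ t, V t ≤ v) (hsum : ∑ t, V t ≤ a * (n * P)) :
    (Measure.pi fun t => gaussianReal 0 (V t)) {x | (1 / (n : ℝ)) * ∑ t, x t ^ 2 ≤ P}ᶜ
      ≤ ENNReal.ofReal (n * v ^ 2 * gaussSqVar / ((1 - a) * (n * P)) ^ 2) := by
  have hnr : (0 : ℝ) < n := by exact_mod_cast hn
  have hset : MeasurableSet {x : Fin n → ℝ | (1 / (n : ℝ)) * ∑ t, x t ^ 2 ≤ P} :=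
    measurableSet_le (by fun_prop) measurable_const
  have hmom := lintegral_sq_sum_sq (fun _ : Fin n => (0 : ℝ)) (fun _ => 1) V
  have hsumr : ∑ t, (V t : ℝ) ≤ a * (n * P) := by exact_mod_cast hsum
  have har : (a : ℝ) < 1 := by exact_mod_cast ha
  have hm : Measurable fun y : Fin n → ℝ =>
      ENNReal.ofReal ((∑ k, 1 * ((y k - 0) ^ 2 - (V k : ℝ))) ^ 2) := by fun_prop
  -- For `P = 0` the right side is `0` because division by zero gives zero. The left side is also
  -- null, since all variances vanish and the word is almost surely zero.
  rcases eq_or_ne P 0 with hP | hP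
  · subst hP
    have h0 : ∀ t, V t = 0 := by
      simpa using hsum
    have hz : ∫⁻ y : Fin n → ℝ, ENNReal.ofReal ((∑ k, 1 * ((y k - 0) ^ 2 - (V k : ℝ))) ^ 2)
        ∂(Measure.pi fun t => gaussianReal 0 (V t)) = 0 := by
      rw [hmom]; simp [h0]
    rw [lintegral_eq_zero_iff hm] at hz
    refine le_of_eq_of_le ?_ zero_le
    refine measure_mono_null ?_ hz
    intro x hx
    simp only [Set.mem_compl_iff, Set.mem_ofPred_eq, NNReal.coe_zero, not_le] at hx
    have hpos : 0 < ∑ t, x t ^ 2 := by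
      by_contra! h
      have : (1 / (n : ℝ)) * ∑ t, x t ^ 2 ≤ 0 :=
        mul_nonpos_of_nonneg_of_nonpos (by positivity) h
      linarith
    simp only [h0, NNReal.coe_zero, sub_zero, one_mul]
    intro h
    simp only [Pi.zero_apply, ENNReal.ofReal_eq_zero] at h
    exact absurd h (not_le.2 (pow_pos hpos 2))
  · have hPr : (0 : ℝ) < P := by positivity
    set b : ℝ := (1 - a) * (n * P) with hb
    have hb0 : 0 < b := by
      have : (0 : ℝ) < 1 - a := by linarith
      positivity
    calc _ = ∫⁻ x, ({x : Fin n → ℝ | (1 / (n : ℝ)) * ∑ t, x t ^ 2 ≤ P}ᶜ).indicator 1 x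
          ∂(Measure.pi fun t => gaussianReal 0 (V t)) := (lintegral_indicator_one hset.compl).symm
      _ ≤ ∫⁻ y, ENNReal.ofReal (b ^ 2)⁻¹ * ENNReal.ofReal
          ((∑ k, 1 * ((y k - 0) ^ 2 - (V k : ℝ))) ^ 2)
          ∂(Measure.pi fun t => gaussianReal 0 (V t)) := by
          refine lintegral_mono fun x => ?_
          by_cases hx : x ∈ {x : Fin n → ℝ | (1 / (n : ℝ)) * ∑ t, x t ^ 2 ≤ P}ᶜ
          · rw [Set.indicator_of_mem hx, Pi.one_apply, ← ENNReal.ofReal_mul (by positivity),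
              ← ENNReal.ofReal_one]
            refine ENNReal.ofReal_le_ofReal ?_
            simp only [Set.mem_compl_iff, Set.mem_ofPred_eq, not_le] at hx
            rw [one_div, ← div_eq_inv_mul, lt_div_iff₀ hnr] at hx
            have h1 : b ≤ ∑ k, 1 * ((x k - 0) ^ 2 - (V k : ℝ)) := by
              simp only [sub_zero, one_mul, Finset.sum_sub_distrib]
              rw [hb]; nlinarith
            rw [← div_eq_inv_mul, one_le_div (by positivity)]
            exact pow_le_pow_left₀ hb0.le h1 2
          · rw [Set.indicator_of_notMem hx]; exact zero_le
      _ = ENNReal.ofReal ((b ^ 2)⁻¹ * ((∑ k, (1 * (V k : ℝ)) ^ 2) * gaussSqVar)) := by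
          rw [lintegral_const_mul _ hm, hmom, ← ENNReal.ofReal_mul (by positivity)]
      _ ≤ _ := by
          refine ENNReal.ofReal_le_ofReal ?_
          rw [← div_eq_inv_mul]
          have := gaussSqVar_nonneg
          gcongr
          calc ∑ k, (1 * (V k : ℝ)) ^ 2 ≤ ∑ _k : Fin n, (v : ℝ) ^ 2 := by
                gcongr with k
                rw [one_mul]; exact_mod_cast hV k
            _ = n * (v : ℝ) ^ 2 := by simp

/-! ### Deterministic time sharing -/

/-- Embed the disjoint union of blocks of sizes `c q` into the letters; letters outside the image
get `none` and will be sent without power. -/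
lemma exists_profile {m n : ℕ} (c : Fin m → ℕ) (hc : ∑ q, c q ≤ n) :
    ∃ f : Fin n → Option (Fin m), ∀ h : Option (Fin m) → ℝ,
      h none = 0 → ∑ t, h (f t) = ∑ q, c q * h (some q) := by
  classical
  have hcard : Fintype.card ((q : Fin m) × Fin (c q)) ≤ Fintype.card (Fin n) := by simpa using hc
  obtain ⟨e⟩ := Function.Embedding.nonempty_of_card_le hcard
  refine ⟨fun t => (Function.partialInv e t).map Sigma.fst, fun h h0 => ?_⟩
  have h1 : ∀ t ∈ Finset.univ, t ∉ Finset.univ.map e →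
      h ((Function.partialInv e t).map Sigma.fst) = 0 := by
    intro t _ ht
    have : Function.partialInv e t = none := by
      rw [Option.eq_none_iff_forall_ne_some]
      intro s hs
      exact ht (Finset.mem_map.2 ⟨s, Finset.mem_univ _, (e.injective.isPartialInv s t).1 hs⟩)
    rw [this]
    exact h0
  rw [← Finset.sum_subset (Finset.subset_univ (Finset.univ.map e)) h1, Finset.sum_map]
  simp_rw [Function.partialInv_left e.injective]
  rw [Fintype.sum_sigma]
  simp

namespace GaussianICEE
namespace GaussianInput

variable {G : GaussianICEE} (p : G.GaussianInput)

/-- The input law with all powers scaled by `a`. -/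
def scale (a : ℝ≥0) (ha : a ≤ 1) : G.GaussianInput where
  m := p.m
  pQ := p.pQ
  pQ_sum := p.pQ_sum
  auxPower q i := a * p.auxPower q i
  jamPower q k := a * p.jamPower q k
  power k := by
    refine le_trans (Finset.sum_le_sum fun q _ => ?_) (p.power k)
    rw [← Finset.mul_sum, ← mul_add, mul_assoc]
    exact mul_le_of_le_one_left' ha

lemma scale_power (a : ℝ≥0) (ha : a ≤ 1) (k : Fin 2) :
    ∑ q, ((∑ i with user i = k, (p.scale a ha).auxPower q i) + (p.scale a ha).jamPower q k)
      * (p.scale a ha).pQ q ≤ a * G.P k := by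
  calc _ = a * ∑ q, ((∑ i with user i = k, p.auxPower q i) + p.jamPower q k) * p.pQ q := by
        rw [Finset.mul_sum]
        refine Finset.sum_congr rfl fun q _ => ?_
        simp only [scale, ← Finset.mul_sum, ← mul_add, mul_assoc]
    _ ≤ _ := by gcongr; exact p.power k

/-- The rate as a function of the scaling. -/
def scaledRate (r : Fin 3) (A D : Finset (Fin 6)) (a : ℝ≥0) : ℝ :=
  ∑ q, (p.pQ q : ℝ) * (1 / 2 * Real.log
    (outVar (G.auxGain r) (fun i => a * p.auxPower q i)
        (G.noiseVar r fun k => a * p.jamPower q k) A /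
      outVar (G.auxGain r) (fun i => a * p.auxPower q i)
        (G.noiseVar r fun k => a * p.jamPower q k) D))

lemma continuous_scaledRate (r : Fin 3) (A D : Finset (Fin 6)) :
    Continuous (p.scaledRate r A D) := by
  have hc : ∀ q B, Continuous fun a : ℝ≥0 => (outVar (G.auxGain r) (fun i => a * p.auxPower q i)
      (G.noiseVar r fun k => a * p.jamPower q k) B : ℝ) := fun q B => by
    unfold outVar noiseVar; fun_prop
  have h0 : ∀ q B (a : ℝ≥0), (outVar (G.auxGain r) (fun i => a * p.auxPower q i)
      (G.noiseVar r fun k => a * p.jamPower q k) B : ℝ) ≠ 0 := fun q B a => by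
    exact_mod_cast outVar_ne_zero _ _ (G.noiseVar_ne_zero r _) B
  refine continuous_finsetSum _ fun q _ => continuous_const.mul (continuous_const.mul ?_)
  exact ((hc q A).div (hc q D) (h0 q D)).log fun a => div_ne_zero (h0 q A a) (h0 q D a)

/-- The rates are continuous in the scaling factor at `1`, so a factor strictly below `1` buys power
slack at an arbitrarily small cost in rate. -/
lemma exists_scale {δ : ℝ} (hδ : 0 < δ) :
    ∃ (a : ℝ≥0) (ha : a < 1), ∀ r A D, |(p.scale a ha.le).rate r A D - p.rate r A D| ≤ δ := by
  have h1 : ∀ r A D, p.scaledRate r A D 1 = p.rate r A D := by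
    intro r A D
    simp [scaledRate, rate, condVar]
  have hev : ∀ᶠ a in nhdsWithin (1 : ℝ≥0) (Set.Iio 1), ∀ r A D,
      |p.scaledRate r A D a - p.rate r A D| ≤ δ := by
    simp only [Filter.eventually_all]
    intro r A D
    have ht : Filter.Tendsto (p.scaledRate r A D) (nhdsWithin 1 (Set.Iio 1))
        (nhds (p.rate r A D)) := by
      rw [← h1]
      exact (p.continuous_scaledRate r A D).continuousAt.mono_left nhdsWithin_le_nhds
    filter_upwards [ht (Metric.closedBall_mem_nhds _ hδ)] with a ha
    exact ha
  have : (nhdsWithin (1 : ℝ≥0) (Set.Iio 1)).NeBot := nhdsLT_neBot_of_exists_lt ⟨0, zero_lt_one⟩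
  obtain ⟨a, ha, ha1⟩ := (hev.and self_mem_nhdsWithin).exists
  exact ⟨a, ha1, ha⟩

/-! ### Rates of the time-shared code -/

/-- The number of letters for each value of the time-sharing variable. -/
def count (n : ℕ) (q : Fin p.m) : ℕ := ⌊(n : ℝ≥0) * p.pQ q⌋₊

lemma count_le (n : ℕ) (q : Fin p.m) : (p.count n q : ℝ≥0) ≤ n * p.pQ q :=
  Nat.floor_le zero_le

lemma sum_count_le (n : ℕ) : ∑ q, p.count n q ≤ n := by
  have h : ((∑ q, p.count n q : ℕ) : ℝ≥0) ≤ n := by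
    push_cast
    calc _ ≤ ∑ q, (n : ℝ≥0) * p.pQ q := Finset.sum_le_sum fun q _ => p.count_le n q
      _ = n := by rw [← Finset.mul_sum, p.pQ_sum, mul_one]
  exact_mod_cast h

/-- The time-sharing profile. -/
def profile (n : ℕ) : Fin n → Option (Fin p.m) :=
  (exists_profile (p.count n) (p.sum_count_le n)).choose

lemma sum_profile (n : ℕ) (h : Option (Fin p.m) → ℝ) (h0 : h none = 0) :
    ∑ t, h (p.profile n t) = ∑ q, p.count n q * h (some q) :=
  (exists_profile (p.count n) (p.sum_count_le n)).choose_spec h h0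

/-- Powers of the auxiliary variables in each letter. -/
def letterPower (n : ℕ) (t : Fin n) (i : Fin 6) : ℝ≥0 :=
  (p.profile n t).elim 0 fun q => p.auxPower q i

/-- Powers of the jamming signals in each letter. -/
def letterJam (n : ℕ) (t : Fin n) (k : Fin 2) : ℝ≥0 :=
  (p.profile n t).elim 0 fun q => p.jamPower q k

/-- Each floor loses less than one letter, so the error does not grow with `n`. -/
lemma abs_sum_count_sub_le (n : ℕ) (h : Fin p.m → ℝ) :
    |∑ q, (p.count n q : ℝ) * h q - n * ∑ q, (p.pQ q : ℝ) * h q| ≤ ∑ q, |h q| := by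
  rw [Finset.mul_sum, ← Finset.sum_sub_distrib]
  refine (Finset.abs_sum_le_sum_abs _ _).trans (Finset.sum_le_sum fun q _ => ?_)
  have h1 : (p.count n q : ℝ) ≤ n * p.pQ q := by exact_mod_cast p.count_le n q
  have h2 : (n : ℝ) * p.pQ q < p.count n q + 1 := by
    exact_mod_cast Nat.lt_floor_add_one ((n : ℝ≥0) * p.pQ q)
  rw [← mul_assoc, ← sub_mul, abs_mul]
  refine mul_le_of_le_one_left (abs_nonneg _) ?_
  rw [abs_le]; constructor <;> linarith

/-- The bound for the rounding error of time sharing. -/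
def roundingError : ℝ :=
  ∑ r, ∑ A, ∑ D, ∑ q, |1 / 2 * Real.log (p.condVar r q A / p.condVar r q D)|

lemma roundingError_nonneg : 0 ≤ p.roundingError := by
  unfold roundingError
  positivity

/-- Idle letters have unit variance under every conditioning and contribute `log 1 = 0`, so only the
rounding of the block lengths is left. -/
lemma abs_infoSum_sub_le (n : ℕ) (r : Fin 3) (A D : Finset (Fin 6)) :
    |infoSum (G.auxGain r) (p.letterPower n) (fun t => G.noiseVar r (p.letterJam n t)) A D
      - n * p.rate r A D| ≤ p.roundingError := by
  let h : Option (Fin p.m) → ℝ := fun o => o.elim 0 fun q =>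
    1 / 2 * Real.log (p.condVar r q A / p.condVar r q D)
  have h1 : infoSum (G.auxGain r) (p.letterPower n) (fun t => G.noiseVar r (p.letterJam n t)) A D
      = ∑ t, h (p.profile n t) := by
    unfold infoSum
    refine Finset.sum_congr rfl fun t _ => ?_
    unfold letterPower letterJam
    beta_reduce
    cases p.profile n t with
    | none => simp [h, outVar, noiseVar]
    | some q => rfl
  rw [h1, p.sum_profile n h rfl]
  refine (p.abs_sum_count_sub_le n fun q => h (some q)).trans ?_
  have hs : ∀ {α : Type} [Fintype α] (f : α → ℝ) (a : α), (∀ a, 0 ≤ f a) → f a ≤ ∑ a, f a :=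
    fun f a hf => Finset.single_le_sum (fun a _ => hf a) (Finset.mem_univ a)
  refine le_trans ?_ (hs (fun r => ∑ A, ∑ D, ∑ q,
    |1 / 2 * Real.log (p.condVar r q A / p.condVar r q D)|) r fun _ => by positivity)
  refine le_trans ?_ (hs (fun A => ∑ D, ∑ q,
    |1 / 2 * Real.log (p.condVar r q A / p.condVar r q D)|) A fun _ => by positivity)
  exact hs (fun D => ∑ q, |1 / 2 * Real.log (p.condVar r q A / p.condVar r q D)|) D
    fun _ => by positivity

/-- The bound for the power of one letter. -/
def maxPower (k : Fin 2) : ℝ≥0 := ∑ q, (p.jamPower q k + ∑ i with user i = k, p.auxPower q i)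

lemma letter_power_le (n : ℕ) (k : Fin 2) (t : Fin n) :
    p.letterJam n t k + ∑ i with user i = k, p.letterPower n t i ≤ p.maxPower k := by
  unfold letterPower letterJam
  cases p.profile n t with
  | none => simp
  | some q =>
    exact Finset.single_le_sum (f := fun q => p.jamPower q k + ∑ i with user i = k, p.auxPower q i)
      (fun _ _ => zero_le) (Finset.mem_univ q)

lemma sum_letter_power_le (n : ℕ) (k : Fin 2) :
    ∑ t, (p.letterJam n t k + ∑ i with user i = k, p.letterPower n t i)
      ≤ n * ∑ q, ((∑ i with user i = k, p.auxPower q i) + p.jamPower q k) * p.pQ q := by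
  let h : Option (Fin p.m) → ℝ := fun o => o.elim 0 fun q =>
    ((p.jamPower q k + ∑ i with user i = k, p.auxPower q i : ℝ≥0) : ℝ)
  have h1 : ((∑ t, (p.letterJam n t k + ∑ i with user i = k, p.letterPower n t i) : ℝ≥0) : ℝ)
      = ∑ t, h (p.profile n t) := by
    rw [NNReal.coe_sum]
    refine Finset.sum_congr rfl fun t _ => ?_
    unfold letterPower letterJam
    cases p.profile n t with
    | none => simp [h]
    | some q => rfl
  rw [p.sum_profile n h rfl] at h1
  rw [← NNReal.coe_le_coe, h1]
  push_cast
  rw [Finset.mul_sum]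
  refine Finset.sum_le_sum fun q _ => ?_
  have h2 : (p.count n q : ℝ) ≤ n * p.pQ q := by exact_mod_cast p.count_le n q
  have h3 : h (some q) = (p.jamPower q k : ℝ) + ∑ i with user i = k, (p.auxPower q i : ℝ) := by
    simp [h]
  have h4 : (0 : ℝ) ≤ (p.jamPower q k : ℝ) + ∑ i with user i = k, (p.auxPower q i : ℝ) := by
    positivity
  rw [h3]
  nlinarith [mul_le_mul_of_nonneg_right h2 h4]

/-- Chain rule: the logarithms of the variance ratios telescope. -/
lemma rate_add (r : Fin 3) (A B D : Finset (Fin 6)) :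
    p.rate r A B + p.rate r B D = p.rate r A D := by
  unfold rate
  rw [← Finset.sum_add_distrib]
  refine Finset.sum_congr rfl fun q _ => ?_
  have h : ∀ E, (p.condVar r q E : ℝ) ≠ 0 := fun E => by exact_mod_cast p.condVar_ne_zero r q E
  rw [Real.log_div (h A) (h B), Real.log_div (h B) (h D), Real.log_div (h A) (h D)]
  ring

end GaussianInput
end GaussianICEE

/-! ### Numbers of messages -/

namespace GaussianICEE

/-- The number `⌈2 ^ (n R)⌉` of messages at rate `R`. -/
def numMessages (n : ℕ) (R : ℝ) : ℕ := ⌈(2 : ℝ) ^ ((n : ℝ) * R)⌉₊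

lemma rpow_le_numMessages (n : ℕ) (R : ℝ) : (2 : ℝ) ^ ((n : ℝ) * R) ≤ numMessages n R :=
  Nat.le_ceil _

lemma numMessages_pos (n : ℕ) (R : ℝ) : 0 < numMessages n R :=
  Nat.ceil_pos.2 (Real.rpow_pos_of_pos two_pos _)

lemma numMessages_zero (n : ℕ) : numMessages n 0 = 1 := by simp [numMessages]

lemma le_log_numMessages (n : ℕ) (R : ℝ) : n * R * Real.log 2 ≤ Real.log (numMessages n R) := by
  rw [← Real.log_rpow two_pos]
  exact Real.log_le_log (Real.rpow_pos_of_pos two_pos _) (rpow_le_numMessages n R)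

lemma log_numMessages_le (n : ℕ) {R : ℝ} (hR : 0 ≤ R) :
    Real.log (numMessages n R) ≤ Real.log 2 + n * R * Real.log 2 := by
  have h1 : (1 : ℝ) ≤ (2 : ℝ) ^ ((n : ℝ) * R) := Real.one_le_rpow one_le_two (by positivity)
  rw [← Real.log_rpow two_pos, ← Real.log_mul two_ne_zero (by positivity)]
  refine Real.log_le_log (by exact_mod_cast numMessages_pos n R) ?_
  have h2 := Nat.ceil_lt_add_one (R := ℝ) (a := (2 : ℝ) ^ ((n : ℝ) * R)) (by positivity)
  unfold numMessages
  linarith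

lemma exists_parts (A : Fin 6 → ℕ) (hA : ∀ i, 0 < A i) (k : Fin 2) {M : ℕ}
    (hM : M ≤ ∏ i with user i = k, A i) :
    ∃ part : Fin M → (i : Fin 6) → Fin (A i),
      ∀ m m', (∀ i, user i = k → part m i = part m' i) → m = m' := by
  have hcard : Fintype.card (Fin M) ≤ Fintype.card ((i : {i // user i = k}) → Fin (A i)) := by
    rw [Fintype.card_fin, Fintype.card_pi]
    simp only [Fintype.card_fin]
    refine hM.trans (le_of_eq ?_)
    exact Finset.prod_subtype (Finset.univ.filter fun i => user i = k) (by simp) A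
  obtain ⟨e⟩ := Function.Embedding.nonempty_of_card_le hcard
  refine ⟨fun m i => if h : user i = k then e m ⟨i, h⟩ else ⟨0, hA i⟩, fun m m' h => ?_⟩
  refine e.injective (funext fun i => ?_)
  have := h i.1 i.2
  simpa [i.2] using this

/-- The ceiling of a product is at most the product of the ceilings. There are thus enough tuples of
message parts to encode every message injectively. -/
lemma numMessages_sum_le (n : ℕ) (R : Fin 6 → ℝ) (k : Fin 2) :
    numMessages n (∑ i with user i = k, R i) ≤ ∏ i with user i = k, numMessages n (R i) := by
  refine Nat.ceil_le.2 ?_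
  rw [Finset.mul_sum, Real.rpow_sum_of_pos two_pos]
  push_cast
  exact Finset.prod_le_prod (fun i _ => (Real.rpow_pos_of_pos two_pos _).le)
    fun i _ => rpow_le_numMessages n (R i)

namespace GaussianInput

variable {G : GaussianICEE} (p : G.GaussianInput)

/-- The random code with rates `R`, `Rx` and time sharing according to `p`. -/
def code (n : ℕ) (R Rx : Fin 6 → ℝ) :
    RandomCode n (fun k => numMessages n (∑ i with user i = k, R i)) where
  pow := p.letterPower n
  jam := p.letterJam n
  A i := numMessages n (R i)
  B i := numMessages n (Rx i)
  B_ne_zero i := (numMessages_pos n (Rx i)).ne'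
  part k := (exists_parts (fun i => numMessages n (R i)) (fun i => numMessages_pos n (R i)) k
    (numMessages_sum_le n R k)).choose
  part_inj k := (exists_parts (fun i => numMessages n (R i)) (fun i => numMessages_pos n (R i)) k
    (numMessages_sum_le n R k)).choose_spec

/-- The information in nats that the code gives at output `r`. -/
def codeInfo (n : ℕ) (r : Fin 3) (A D : Finset (Fin 6)) : ℝ :=
  infoSum (G.auxGain r) (p.letterPower n) (fun t => G.noiseVar r (p.letterJam n t)) A D

/-- The auxiliary variables that the receivers decode. -/
def decodes : Fin 2 → Finset (Fin 6) := ![{0, 1, 3, 5}, {0, 2, 3, 4}]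

lemma mem_decodes : ∀ k i, user i = k → i ∉ decodes k → i = 2 ∨ i = 5 := by decide

/-- The number of wrong choices for the auxiliary variables in `S`. -/
def numWrong (n : ℕ) (R Rx : Fin 6 → ℝ) (S : Finset (Fin 6)) : ℕ :=
  ∏ i ∈ S, (numMessages n (R i) * numMessages n (Rx i) - 1)

/-- Each ceiling costs at most a factor `2`; there are two for each of at most six variables, hence
`12 * log 2`. -/
lemma log_numWrong_le (n : ℕ) {R Rx : Fin 6 → ℝ} (hR : ∀ i, 0 ≤ R i) (hRx : ∀ i, 0 ≤ Rx i)
    (S : Finset (Fin 6)) (h : numWrong n R Rx S ≠ 0) :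
    Real.log (numWrong n R Rx S) ≤ 12 * Real.log 2 + n * (∑ i ∈ S, (R i + Rx i)) * Real.log 2 := by
  have hlog := Real.log_nonneg (one_le_two (α := ℝ))
  unfold numWrong at h ⊢
  rw [Nat.cast_prod, Real.log_prod fun i hi => by exact_mod_cast Finset.prod_ne_zero_iff.1 h i hi]
  calc _ ≤ ∑ i ∈ S, (2 * Real.log 2 + n * (R i + Rx i) * Real.log 2) := by
        refine Finset.sum_le_sum fun i hi => ?_
        have h0 : 0 < numMessages n (R i) * numMessages n (Rx i) - 1 :=
          Nat.pos_of_ne_zero (Finset.prod_ne_zero_iff.1 h i hi)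
        have h1 : Real.log (numMessages n (R i) * numMessages n (Rx i) - 1 : ℕ)
            ≤ Real.log (numMessages n (R i) * numMessages n (Rx i) : ℕ) :=
          Real.log_le_log (by exact_mod_cast h0) (by exact_mod_cast Nat.sub_le _ _)
        have h2 : Real.log (numMessages n (R i) * numMessages n (Rx i) : ℕ)
            = Real.log (numMessages n (R i)) + Real.log (numMessages n (Rx i)) := by
          rw [Nat.cast_mul, Real.log_mul]
          · exact_mod_cast (numMessages_pos n (R i)).ne'
          · exact_mod_cast (numMessages_pos n (Rx i)).ne'
        have h3 := log_numMessages_le n (hR i)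
        have h4 := log_numMessages_le n (hRx i)
        rw [h2] at h1
        linarith
    _ ≤ _ := by
        rw [Finset.sum_add_distrib, Finset.sum_const, ← Finset.sum_mul, ← Finset.mul_sum,
          nsmul_eq_mul]
        have hcard : (S.card : ℝ) ≤ 6 := by
          have : S.card ≤ 6 := by simpa using Finset.card_le_univ S
          exact_mod_cast this
        nlinarith

lemma numWrong_eq_zero (n : ℕ) {R Rx : Fin 6 → ℝ} {S : Finset (Fin 6)} {i : Fin 6} (hi : i ∈ S)
    (hR : R i = 0) (hRx : Rx i = 0) : numWrong n R Rx S = 0 :=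
  Finset.prod_eq_zero hi (by simp [hR, hRx, numMessages_zero])

lemma lintegral_errSum_code_le (n : ℕ) {R : Fin 6 → ℝ} (Rx : Fin 6 → ℝ) (hR2 : R 2 = 0)
    (hR5 : R 5 = 0) (k : Fin 2) {e : ℝ≥0} (he : 0 < e) {s : ℝ} (hs : 0 < s)
    (hdec : ∀ A ⊂ decodes k, numWrong n R Rx (decodes k \ A) = 0 ∨
      Real.log (numWrong n R Rx (decodes k \ A)) - Real.log (e / 128) + s
        ≤ p.codeInfo n k.castSucc A (decodes k))
    (hse : n * gaussSqVar / s ^ 2 ≤ e / 128) :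
    ∫⁻ x, (p.code n R Rx).errSum G x k (decodes k) ∂(p.code n R Rx).bookLaw
      ≤ (numMessages n (∑ i with user i = 0, R i) * numMessages n (∑ i with user i = 1, R i) : ℕ)
        * (e : ℝ≥0∞) := by
  have her : (0 : ℝ) < e := by exact_mod_cast he
  refine ((p.code n R Rx).lintegral_errSum_le G k (decodes k) (fun i hi hiD => ?_)
    (ENNReal.ofReal (e / 128))).trans (mul_le_mul_right ?_ _)
  · rcases mem_decodes k i hi hiD with rfl | rfl
    · change numMessages n (R 2) = 1
      rw [hR2, numMessages_zero]
    · change numMessages n (R 5) = 1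
      rw [hR5, numMessages_zero]
  · calc _ ≤ ∑ A ∈ (decodes k).powerset.erase (decodes k),
          (ENNReal.ofReal (e / 128) + ENNReal.ofReal (e / 128)) := by
          refine Finset.sum_le_sum fun A hA => ?_
          rw [Finset.mem_erase, Finset.mem_powerset] at hA
          refine add_le_add_left ?_ _
          have hlow := lowRatioProb_gaussFamily_le (G.auxGain k.castSucc) (p.letterPower n)
            (v := fun t => G.noiseVar k.castSucc (p.letterJam n t))
            (fun t => G.noiseVar_ne_zero _ _) hA.2 (numWrong n R Rx (decodes k \ A))
            (ε := e / 128) (by positivity) hs (hdec A (Finset.ssubset_iff_subset_ne.2 ⟨hA.2, hA.1⟩))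
          refine hlow.trans (ENNReal.ofReal_le_ofReal ?_)
          simpa using hse
      -- There are at most `2 ^ 6 = 64` sets `A`, each contributing two terms `e / 128`.
      _ ≤ 64 * (ENNReal.ofReal (e / 128) + ENNReal.ofReal (e / 128)) := by
          rw [Finset.sum_const, nsmul_eq_mul]
          refine mul_le_mul_left ?_ _
          have : ((decodes k).powerset.erase (decodes k)).card ≤ 64 := by
            simpa using Finset.card_le_univ ((decodes k).powerset.erase (decodes k))
          exact_mod_cast this
      _ = e := by
          rw [← ENNReal.ofReal_add (by positivity) (by positivity)]
          have h64 : (64 : ℝ≥0∞) = ENNReal.ofReal 64 := by simp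
          rw [h64, ← ENNReal.ofReal_mul (by norm_num)]
          have : (64 : ℝ) * (e / 128 + e / 128) = e := by ring
          rw [this, ENNReal.ofReal_coe_nnreal]

lemma expect_leak_code_le (n : ℕ) (R : Fin 6 → ℝ) {Rx : Fin 6 → ℝ} {s d : ℝ} (hs : 0 < s)
    (hsec : ∀ A, p.codeInfo n 2 ∅ A - n * (∑ i ∈ A, Rx i) * Real.log 2 ≤ d) (hd : 0 ≤ d) :
    ((p.code n R Rx).chan G 2).expect Finset.univ (fun t y => logOneAdd
        (((p.code n R Rx).chan G 2).meanRatio (p.code n R Rx).B ((p.code n R Rx).meanDens G 2) t y))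
      ≤ ENNReal.ofReal (Real.log 65 + 64 * (d + s + n * gaussSqVar / s)) := by
  have h := expect_logOneAdd_meanRatio_le (G.auxGain 2) (p.letterPower n)
    (v := fun t => G.noiseVar 2 (p.letterJam n t)) (fun t => G.noiseVar_ne_zero _ _)
    (p.code n R Rx).B (p.code n R Rx).B_ne_zero ((p.code n R Rx).meanDens G 2)
    ((p.code n R Rx).dens_empty G 2) hs
  refine h.trans (ENNReal.ofReal_le_ofReal ?_)
  have hc : (Fintype.card (Finset (Fin 6)) : ℝ) = 64 := by simp
  rw [hc]
  have h65 : (1 + 64 : ℝ) = 65 := by norm_num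
  rw [h65]
  refine add_le_add_right ?_ _
  calc _ ≤ ∑ _A : Finset (Fin 6), (d + s + n * gaussSqVar / s) := by
        refine Finset.sum_le_sum fun A _ => ?_
        rw [Fintype.card_fin]
        refine add_le_add_left (add_le_add_left (max_le ?_ hd) _) _
        refine le_trans (sub_le_sub_left ?_ _) (hsec A)
        rw [Nat.cast_prod, Real.log_prod fun i _ => by
          exact_mod_cast (p.code n R Rx).B_ne_zero i, Finset.mul_sum, Finset.sum_mul]
        exact Finset.sum_le_sum fun i _ => le_log_numMessages n (Rx i)
    _ = _ := by rw [Finset.sum_const, Finset.card_univ, nsmul_eq_mul, hc]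

lemma inputLaw_code_le {n : ℕ} (hn : 0 < n) (R Rx : Fin 6 → ℝ) {a : ℝ≥0} (ha : a < 1) (k : Fin 2)
    (hpow : ∑ q, ((∑ i with user i = k, p.auxPower q i) + p.jamPower q k) * p.pQ q ≤ a * G.P k) :
    (p.code n R Rx).inputLaw k (G.powerBall n k)ᶜ
      ≤ ENNReal.ofReal
        (n * (p.maxPower k : ℝ) ^ 2 * gaussSqVar / ((1 - a) * (n * G.P k)) ^ 2) := by
  refine pi_gaussianReal_power_le hn _ ha (p.letter_power_le n k) ?_
  refine (p.sum_letter_power_le n k).trans ?_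
  calc _ ≤ (n : ℝ≥0) * (a * G.P k) := by gcongr
    _ = _ := by ring

end GaussianInput
end GaussianICEE

/-! ### Achievability -/

namespace GaussianICEE
namespace GaussianInput

variable {G : GaussianICEE} (p : G.GaussianInput)

/-- Truncation at zero could spoil the gain only for a variable whose two reduced rates both vanish.
Such a variable has a single codeword and admits no wrong choice, so it is excluded; every other one
loses at least `δ`. -/
lemma sum_max_sub_le {S : Finset (Fin 6)} (hS : S.Nonempty) {R Rx : Fin 6 → ℝ}
    (hR : ∀ i, 0 ≤ R i) (hRx : ∀ i, 0 ≤ Rx i) {η δ : ℝ} (hδ : 0 < δ) (hδη : δ ≤ η)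
    (h : ∀ i ∈ S, ¬ (max (R i - η) 0 = 0 ∧ max (Rx i - δ) 0 = 0)) :
    ∑ i ∈ S, (max (R i - η) 0 + max (Rx i - δ) 0) ≤ ∑ i ∈ S, (R i + Rx i) - δ := by
  have h1 : ∑ i ∈ S, (max (R i - η) 0 + max (Rx i - δ) 0) ≤ ∑ i ∈ S, (R i + Rx i - δ) := by
    refine Finset.sum_le_sum fun i hi => ?_
    have hi' := h i hi
    rcases le_total (R i - η) 0 with h2 | h2 <;> rcases le_total (Rx i - δ) 0 with h3 | h3
    · exact absurd ⟨max_eq_right h2, max_eq_right h3⟩ hi'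
    · rw [max_eq_right h2, max_eq_left h3]; linarith [hR i]
    · rw [max_eq_left h2, max_eq_right h3]; linarith [hRx i]
    · rw [max_eq_left h2, max_eq_left h3]; linarith
  rw [Finset.sum_sub_distrib, Finset.sum_const, nsmul_eq_mul] at h1
  have hc : (1 : ℝ) ≤ S.card := by exact_mod_cast hS.card_pos
  nlinarith

lemma sub_le_sum_max (A : Finset (Fin 6)) (Rx : Fin 6 → ℝ) {δ : ℝ} (hδ : 0 < δ) :
    ∑ i ∈ A, Rx i - 6 * δ ≤ ∑ i ∈ A, max (Rx i - δ) 0 := by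
  have h1 : ∑ i ∈ A, (Rx i - δ) ≤ ∑ i ∈ A, max (Rx i - δ) 0 :=
    Finset.sum_le_sum fun i _ => le_max_left _ _
  rw [Finset.sum_sub_distrib, Finset.sum_const, nsmul_eq_mul] at h1
  have hcard : (A.card : ℝ) ≤ 6 := by
    have : A.card ≤ 6 := by simpa using Finset.card_le_univ A
    exact_mod_cast this
  nlinarith

set_option maxHeartbeats 1000000 in
/-- Rates strictly inside the decoding constraints, with enough randomization, are achievable. -/
lemma achievable_of_rates {R Rx : Fin 6 → ℝ} (hR : ∀ i, 0 ≤ R i) (hRx : ∀ i, 0 ≤ Rx i)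
    (hR2 : R 2 = 0) (hR5 : R 5 = 0)
    (hdec : ∀ k, ∀ S ⊆ decodes k, (∑ i ∈ S, (R i + Rx i)) * Real.log 2
      ≤ p.rate k.castSucc (decodes k \ S) (decodes k))
    (hsec : ∀ A, p.rate 2 ∅ A ≤ (∑ i ∈ A, Rx i) * Real.log 2) {η : ℝ} (hη : 0 < η) :
    G.Achievable fun k => ∑ i with user i = k, max (R i - η) 0 := by
  have hR' : ∀ i, 0 ≤ max (R i - η) 0 := fun i => le_max_right _ _
  refine ⟨fun k => Finset.sum_nonneg fun i _ => hR' i, fun ε hε => ?_⟩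
  set L := Real.log 2 with hL
  have hL0 : 0 < L := Real.log_pos one_lt_two
  set R' : Fin 6 → ℝ := fun i => max (R i - η) 0 with hR'd
  set ρ : ℝ := ∑ i with user i = 0, R' i + ∑ i with user i = 1, R' i with hρ
  have hρ0 : 0 ≤ ρ := add_nonneg (Finset.sum_nonneg fun i _ => hR' i)
    (Finset.sum_nonneg fun i _ => hR' i)
  -- The leakage bound ends up containing `16 * 64 * 8 = 8192` times `n δ log 2`, and `8192 / 32768
  -- = 1 / 4`. This quarter of the allowance is joined by another for the constants and a half for
  -- the loss `8 * e * ρ`.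
  set δ : ℝ := min η (ε / 32768) with hδd
  have hδ : 0 < δ := lt_min hη (by positivity)
  have hδη : δ ≤ η := min_le_left _ _
  have hδε : δ ≤ ε / 32768 := min_le_right _ _
  set Rx' : Fin 6 → ℝ := fun i => max (Rx i - δ) 0 with hRx'd
  have hRx' : ∀ i, 0 ≤ Rx' i := fun i => le_max_right _ _
  obtain ⟨e, he0, he8, he24, heρ⟩ : ∃ e : ℝ≥0, 0 < e ∧ (e : ℝ) ≤ 1 / 8 ∧ 24 * (e : ℝ) ≤ ε ∧
      8 * (e : ℝ) * ρ ≤ ε / 2 := by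
    have hpos : 0 < min (1 / 8) (min (ε / 24) (ε / (16 * (ρ + 1)))) := by positivity
    refine ⟨⟨min (1 / 8) (min (ε / 24) (ε / (16 * (ρ + 1)))), hpos.le⟩, hpos, ?_, ?_, ?_⟩
    · exact min_le_left _ _
    · have h : min (1 / 8) (min (ε / 24) (ε / (16 * (ρ + 1)))) ≤ ε / 24 :=
        (min_le_right _ _).trans (min_le_left _ _)
      change 24 * min (1 / 8) (min (ε / 24) (ε / (16 * (ρ + 1)))) ≤ ε
      linarith
    · have h : min (1 / 8) (min (ε / 24) (ε / (16 * (ρ + 1)))) ≤ ε / (16 * (ρ + 1)) :=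
        (min_le_right _ _).trans (min_le_right _ _)
      change 8 * min (1 / 8) (min (ε / 24) (ε / (16 * (ρ + 1)))) * ρ ≤ ε / 2
      rw [le_div_iff₀ (by positivity)] at h
      nlinarith
  have her : (0 : ℝ) < e := by exact_mod_cast he0
  obtain ⟨a, ha, hrate⟩ := p.exists_scale (δ := δ * L / 4) (by positivity)
  set p' := p.scale a ha.le with hp'
  set K := p'.roundingError with hK
  have hK0 : 0 ≤ K := p'.roundingError_nonneg
  set γ := gaussSqVar with hγ
  have hγ0 : 0 ≤ γ := gaussSqVar_nonneg
  have ha' : (0 : ℝ) < 1 - a := by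
    have : (a : ℝ) < 1 := by exact_mod_cast ha
    linarith
  -- Thresholds for `n`: `n₁` absorbs the ceilings, the constant `e / 128` and the rounding into
  -- half of the decoding margin, `n₂` serves Chebyshev's inequality in decoding, `n₃` the power
  -- violation, and `n₄` the bounded part of the leakage.
  obtain ⟨n₁, hn₁⟩ := exists_nat_ge ((12 * L - Real.log (e / 128) + K) * 2 / (L * δ))
  obtain ⟨n₂, hn₂⟩ := exists_nat_ge (2048 * γ / (e * (δ * L) ^ 2))
  have hpow : ∃ N : ℕ, ∀ k : Fin 2,
      2 * ((p'.maxPower k : ℝ) ^ 2 * γ / ((1 - a) * G.P k) ^ 2) / e ≤ N := by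
    obtain ⟨N₀, h₀⟩ := exists_nat_ge
      (2 * ((p'.maxPower 0 : ℝ) ^ 2 * γ / ((1 - a) * G.P 0) ^ 2) / e)
    obtain ⟨N₁, h₁⟩ := exists_nat_ge
      (2 * ((p'.maxPower 1 : ℝ) ^ 2 * γ / ((1 - a) * G.P 1) ^ 2) / e)
    refine ⟨N₀ + N₁, fun k => ?_⟩
    fin_cases k
    · refine h₀.trans ?_; push_cast; linarith [(Nat.cast_nonneg N₁ : (0 : ℝ) ≤ N₁)]
    · refine h₁.trans ?_; push_cast; linarith [(Nat.cast_nonneg N₀ : (0 : ℝ) ≤ N₀)]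
  obtain ⟨n₃, hn₃⟩ := hpow
  set X := 1 + 4 * Real.log 4 + 16 * (1 + Real.log 65 + 64 * (K + γ / (δ * L))) with hX
  obtain ⟨n₄, hn₄⟩ := exists_nat_ge (4 * X / (L * ε))
  refine ⟨1 + n₁ + n₂ + n₃ + n₄, fun n hn => ?_⟩
  have hn0 : 0 < n := by omega
  have hnr : (0 : ℝ) < n := by exact_mod_cast hn0
  have h1 : (12 * L - Real.log (e / 128) + K) * 2 ≤ n * (L * δ) := by
    rw [div_le_iff₀ (by positivity)] at hn₁
    refine hn₁.trans ?_
    gcongr; omega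
  have h2 : 2048 * γ ≤ n * (e * (δ * L) ^ 2) := by
    rw [div_le_iff₀ (by positivity)] at hn₂
    refine hn₂.trans ?_
    gcongr; omega
  have h4 : 4 * X ≤ n * (L * ε) := by
    rw [div_le_iff₀ (by positivity)] at hn₄
    refine hn₄.trans ?_
    gcongr; omega
  have hinfo : ∀ r A D, |p'.codeInfo n r A D - n * p'.rate r A D| ≤ K := fun r A D =>
    p'.abs_infoSum_sub_le n r A D
  have hlow : ∀ r A D, n * p.rate r A D - n * (δ * L / 4) - K ≤ p'.codeInfo n r A D := by
    intro r A D
    have h5 := (abs_le.1 (hinfo r A D)).1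
    have h6 := (abs_le.1 (hrate r A D)).1
    have h7 := mul_le_mul_of_nonneg_left h6 hnr.le
    linarith
  have hupp : ∀ r A D, p'.codeInfo n r A D ≤ n * p.rate r A D + n * (δ * L / 4) + K := by
    intro r A D
    have h5 := (abs_le.1 (hinfo r A D)).2
    have h6 := (abs_le.1 (hrate r A D)).2
    have h7 := mul_le_mul_of_nonneg_left h6 hnr.le
    linarith
  -- Of the decoding margin `n * δ * L`, one quarter covers the power scaling, one quarter is the
  -- deviation allowed in Chebyshev's inequality, and one half covers constants.
  have hs : 0 < n * (δ * L / 4) := by positivity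
  have hR'0 : ∀ i, R i = 0 → R' i = 0 := fun i hi => by
    rw [hR'd]; simp only [hi, zero_sub]; exact max_eq_right (by linarith)
  have herr : ∀ k, ∫⁻ x, (p'.code n R' Rx').errSum G x k (decodes k)
      ∂(p'.code n R' Rx').bookLaw ≤ (numMessages n (∑ i with user i = 0, R' i) *
        numMessages n (∑ i with user i = 1, R' i) : ℕ) * (e : ℝ≥0∞) := by
    intro k
    refine p'.lintegral_errSum_code_le n Rx' (hR'0 2 hR2) (hR'0 5 hR5) k he0 hs
      (fun A hA => ?_) ?_
    · by_cases hz : numWrong n R' Rx' (decodes k \ A) = 0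
      · exact Or.inl hz
      refine Or.inr ?_
      have h5 := log_numWrong_le n hR' hRx' (decodes k \ A) hz
      have hne : (decodes k \ A).Nonempty := Finset.sdiff_nonempty.2 hA.2
      have h6 := sum_max_sub_le hne hR hRx hδ hδη fun i hi hi0 =>
        hz (numWrong_eq_zero n hi hi0.1 hi0.2)
      have h7 := hdec k (decodes k \ A) Finset.sdiff_subset
      rw [Finset.sdiff_sdiff_eq_self hA.1] at h7
      have h8 := hlow k.castSucc A (decodes k)
      have h9 : (∑ i ∈ decodes k \ A, (R' i + Rx' i)) * L
          ≤ p.rate k.castSucc A (decodes k) - δ * L :=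
        calc _ ≤ (∑ i ∈ decodes k \ A, (R i + Rx i) - δ) * L :=
              mul_le_mul_of_nonneg_right h6 hL0.le
          _ ≤ _ := by linarith
      have h10 := mul_le_mul_of_nonneg_left h9 hnr.le
      rw [← hL] at h5
      linarith
    · rw [div_le_iff₀ (by positivity)]
      have : (e : ℝ) / 128 * (n * (δ * L / 4)) ^ 2 = n * (n * (e * (δ * L) ^ 2)) / 2048 := by ring
      rw [this, le_div_iff₀ (by norm_num)]
      have := mul_le_mul_of_nonneg_left h2 hnr.le
      linarith
  have hvio : ∑ k, (p'.code n R' Rx').inputLaw k (G.powerBall n k)ᶜ ≤ e := by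
    have hk : ∀ k, (p'.code n R' Rx').inputLaw k (G.powerBall n k)ᶜ ≤ ENNReal.ofReal (e / 2) := by
      intro k
      refine (p'.inputLaw_code_le hn0 R' Rx' ha k (p.scale_power a ha.le k)).trans
        (ENNReal.ofReal_le_ofReal ?_)
      have h5 := hn₃ k
      have h6 : (n₃ : ℝ) ≤ n := by
        have : n₃ ≤ n := by omega
        exact_mod_cast this
      have h7 := h5.trans h6
      rw [div_le_iff₀ her] at h7
      have h8 : n * (p'.maxPower k : ℝ) ^ 2 * γ / ((1 - a) * (n * G.P k)) ^ 2
          = ((p'.maxPower k : ℝ) ^ 2 * γ / ((1 - a) * G.P k) ^ 2) / n := by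
        rw [div_div]
        have h9 : ((1 - a) * (n * G.P k)) ^ 2 = (n : ℝ) * (((1 - a) * G.P k) ^ 2 * n) := by ring
        rw [h9, mul_assoc, mul_div_mul_left _ _ hnr.ne']
      rw [h8, div_le_iff₀ hnr]
      linarith
    calc _ ≤ ∑ _k : Fin 2, ENNReal.ofReal (e / 2) := Finset.sum_le_sum fun k _ => hk k
      _ = e := by
          rw [Fin.sum_univ_two, ← ENNReal.ofReal_add (by positivity) (by positivity), add_halves,
            ENNReal.ofReal_coe_nnreal]
  have hd0 : 0 ≤ n * (7 * (δ * L)) + K := by positivity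
  -- Lowering six randomization rates by `δ` costs `6 * δ`, and the power scaling costs another
  -- quarter of `δ`; together they stay below `7 * δ`.
  have hleak := p'.expect_leak_code_le n R' (Rx := Rx') (s := n * (δ * L))
    (d := n * (7 * (δ * L)) + K) (by positivity) (fun A => by
      have h5 := hupp 2 ∅ A
      have h6 := hsec A
      have h7 := mul_le_mul_of_nonneg_right (sub_le_sum_max A Rx hδ) hL0.le
      have h8 := mul_le_mul_of_nonneg_left h6 hnr.le
      have h9 := mul_le_mul_of_nonneg_left h7 hnr.le
      have h10 : 0 < n * (δ * L) := by positivity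
      rw [← hL]
      linarith) hd0
  have hl65 : 0 ≤ Real.log 65 := Real.log_nonneg (by norm_num)
  have hlog4 : 0 ≤ Real.log 4 := Real.log_nonneg (by norm_num)
  have hge : n * γ / (n * (δ * L)) = γ / (δ * L) := by
    rw [mul_div_mul_left _ _ hnr.ne']
  set l₀ : ℝ := Real.log 65 + 64 * (n * (7 * (δ * L)) + K + n * (δ * L) + γ / (δ * L)) with hl₀
  have hl₀0 : 0 ≤ l₀ := by positivity
  rw [hge] at hleak
  have hleak' : ((p'.code n R' Rx').chan G 2).expect Finset.univ (fun t y => logOneAdd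
      (((p'.code n R' Rx').chan G 2).meanRatio (p'.code n R' Rx').B
        ((p'.code n R' Rx').meanDens G 2) t y)) + 1 ≤ ((Real.toNNReal (l₀ + 1) : ℝ≥0) : ℝ≥0∞) := by
    refine (add_le_add_left hleak 1).trans (le_of_eq ?_)
    rw [← ENNReal.ofReal_one, ← ENNReal.ofReal_add hl₀0 zero_le_one]
    rfl
  obtain ⟨c, hc1, hc2⟩ := (p'.code n R' Rx').exists_secretCode_of_mean G
    (fun k => numMessages_pos n _) decodes he0 (Real.toNNReal_pos.2 (by linarith)) herr hvio hleak'
  refine ⟨c, fun k => (hc1 k).trans he24, ?_⟩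
  rw [Real.coe_toNNReal _ (by linarith), ← hL] at hc2
  have hM : n * ρ * L ≤ Real.log (numMessages n (∑ i with user i = 0, R' i) *
      numMessages n (∑ i with user i = 1, R' i) : ℕ) := by
    rw [Nat.cast_mul, Real.log_mul (by exact_mod_cast (numMessages_pos n _).ne')
      (by exact_mod_cast (numMessages_pos n _).ne')]
    have h5 := le_log_numMessages n (∑ i with user i = 0, R' i)
    have h6 := le_log_numMessages n (∑ i with user i = 1, R' i)
    rw [hρ, hL]
    linarith
  have hM' := (mul_le_mul_of_nonneg_left hM (by linarith : (0 : ℝ) ≤ 1 - 8 * e)).trans hc2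
  unfold SecretCode.equivocationRate
  set H := condEntropy c.eveJointLaw with hH
  change ρ - 1 / (n : ℝ) * H ≤ ε
  have hnL : 0 < n * L := by positivity
  have h11 := mul_le_mul_of_nonneg_left heρ hnL.le
  have h12 := mul_le_mul_of_nonneg_left hδε hnL.le
  have hfin : n * L * ρ - H * L ≤ n * L * ε := by
    have : 16 * (l₀ + 1) + 1 + 4 * Real.log 4 = X + 8192 * (n * L * δ) := by
      rw [hl₀, hX]; ring
    have h14 : (1 - 8 * (e : ℝ)) * (n * ρ * L) = n * L * ρ - n * L * (8 * e * ρ) := by ring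
    rw [h14] at hM'
    linarith
  have h13 : n * L * (ρ - 1 / (n : ℝ) * H) ≤ n * L * ε := by
    have : n * L * (ρ - 1 / (n : ℝ) * H) = n * L * ρ - H * L := by
      field_simp
    rw [this]; exact hfin
  exact le_of_mul_le_mul_left h13 hnL

end GaussianInput
end GaussianICEE

end

theorem mainTheorem2 (G : GaussianICEE) :
    closure (⋃ p : G.GaussianInput, p.rateRegion) ⊆ G.secrecyCapacityRegion := by
  refine closure_minimal (Set.iUnion_subset fun p => closure_minimal ?_ isClosed_closure)
    isClosed_closure
  rintro r ⟨R, Rx, hR, hRx, hR2, hR5, hr0, hr1, h0, h1, h2, h3⟩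
  have hL : 0 < Real.log 2 := Real.log_pos one_lt_two
  have hconv : ∀ {D S : Finset (Fin 6)} {r : Fin 3} {x : ℝ}, S ⊆ D →
      ENNReal.ofReal x ≤ p.info r D S → x * Real.log 2 ≤ p.rate r (D \ S) D := by
    intro D S r x hS h
    rw [p.info_eq r hS, ENNReal.ofReal_le_ofReal_iff
      (div_nonneg (p.rate_nonneg r Finset.sdiff_subset) hL.le), le_div_iff₀ hL] at h
    exact h
  have hdec : ∀ k, ∀ S ⊆ GaussianICEE.GaussianInput.decodes k,
      (∑ i ∈ S, (R i + Rx i)) * Real.log 2 ≤ p.rate k.castSucc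
        (GaussianICEE.GaussianInput.decodes k \ S) (GaussianICEE.GaussianInput.decodes k) := by
    intro k S hS
    fin_cases k
    · exact hconv hS (h0 S hS)
    · exact hconv hS (h1 S hS)
  have htot : (∑ i, Rx i) * Real.log 2 = p.rate 2 ∅ Finset.univ := by
    rw [p.info_eq 2 (Finset.Subset.refl _), Finset.sdiff_self, ENNReal.ofReal_eq_ofReal_iff
      (Finset.sum_nonneg fun i _ => hRx i)
      (div_nonneg (p.rate_nonneg 2 (Finset.empty_subset _)) hL.le), eq_div_iff hL.ne'] at h3
    exact h3
  -- The passage to the soft covering condition: the total equality minus the upper bound for the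
  -- complement of `A`, with the chain rule on the information side. The equality in the definition
  -- of the region is what makes the upper bounds turn into lower bounds.
  have hsec : ∀ A, p.rate 2 ∅ A ≤ (∑ i ∈ A, Rx i) * Real.log 2 := by
    intro A
    have hadd := p.rate_add 2 ∅ A Finset.univ
    have hsum := Finset.sum_add_sum_compl A Rx
    rcases A.eq_empty_or_nonempty with rfl | hA
    -- The complement of the empty set is not a proper subset, so this case is separate; here the
    -- chain rule shows that the rate is zero.
    · have := p.rate_add 2 ∅ ∅ ∅
      rw [Finset.sum_empty]
      linarith
    · have hss : Aᶜ ⊂ Finset.univ := by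
        rw [Finset.ssubset_univ_iff]
        intro h
        exact hA.ne_empty (by simpa using congrArg compl h)
      have h4 := hconv hss.1 (h2 Aᶜ hss)
      rw [← Finset.compl_eq_univ_sdiff, compl_compl] at h4
      rw [← hsum] at htot
      linarith
  have hr : r = fun k => ∑ i with GaussianICEE.user i = k, R i := by
    ext k
    fin_cases k
    · change r 0 = ∑ i with GaussianICEE.user i = 0, R i
      rw [GaussianICEE.filter_user_zero, hr0]
      simp [hR2]
    · change r 1 = ∑ i with GaussianICEE.user i = 1, R i
      rw [GaussianICEE.filter_user_one, hr1]
      simp [hR5]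
  -- The lowered rate pairs are achievable for each `η > 0` and converge to `r`, and the capacity
  -- region is a closure.
  have ht : Filter.Tendsto (fun (η : ℝ) (k : Fin 2) =>
      ∑ i with GaussianICEE.user i = k, max (R i - η) 0) (nhdsWithin 0 (Set.Ioi 0)) (nhds r) := by
    have hc : Continuous fun (η : ℝ) (k : Fin 2) =>
        ∑ i with GaussianICEE.user i = k, max (R i - η) 0 := by fun_prop
    have h := hc.tendsto 0
    have hv : (fun k : Fin 2 => ∑ i with GaussianICEE.user i = k, max (R i - 0) 0) = r := by
      rw [hr]
      ext k
      exact Finset.sum_congr rfl fun i _ => by rw [sub_zero, max_eq_left (hR i)]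
    rw [hv] at h
    exact h.mono_left nhdsWithin_le_nhds
  refine mem_closure_of_tendsto ht ?_
  filter_upwards [self_mem_nhdsWithin] with η hη
  exact p.achievable_of_rates hR hRx hR2 hR5 hdec hsec hη
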